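/- A lattice in $\mathbb{R}^2$ is well-rounded if its non-zero vectors of minimal length span $\mathbb{R}^2$; it is rhombic if it has a basis of two non-orthogonal vectors of equal length. A sublattice of $\mathbb{Z}^2$ (of finite index) is similar if it is the image of $\mathbb{Z}^2$ under a linear isometry followed by a positive scaling, and primitive if it is not contained in $m\mathbb{Z}^2$ for any integer $m>1$. For $n\ge 1$ let $a_\square(n)$, $s_\square(n)$ and $s^{\mathsf{pr}}_\square(n)$ be the numbers of well-rounded, of similar, and of primitive similar sublattices of $\mathbb{Z}^2$ of index $n$. Put $$\Phi_{\square,\mathsf{wr}}(s)=\sum_{n\ge1}\frac{a_\square(n)}{n^s},\qquad \Phi_\square(s)=\sum_{n\ge1}\frac{s_\square(n)}{n^s},\qquad \Phi^{\mathsf{pr}}_\square(s)=\sum_{n\ge1}\frac{s^{\mathsf{pr}}_\square(n)}{n^s},$$ $$\Phi_{\mathsf{wr},even}(s)=\frac{2}{2^s}\,\Phi^{\mathsf{pr}}_\square(s)\sum_{p\ge1}\ \sum_{p<q<\sqrt3\,p}\frac1{p^sq^s},$$ $$\Phi_{\mathsf{wr},odd}(s)=\frac{2}{1+2^{-s}}\,\Phi^{\mathsf{pr}}_\square(s)\sum_{k\ge1}\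 \sum_{k<\ell<\sqrt3\,k+\frac{\sqrt3-1}{2}}\frac1{(2k+1)^s(2\ell+1)^s},$$ where $p,q,k,\ell$ are integers. (1) For all complex $s$ with $\operatorname{Re}s>1$ all these series converge absolutely, and $\Phi_{\square,\mathsf{wr}}(s)=\Phi_\square(s)+\Phi_{\mathsf{wr},even}(s)+\Phi_{\mathsf{wr},odd}(s)$. Here $\Phi_\square(s)=\zeta(2s)\Phi^{\mathsf{pr}}_\square(s)=\zeta_{\mathbb{Q}(i)}(s)=L(s,\chi_{-4})\zeta(s)$, where $\zeta_{\mathbb{Q}(i)}$ is the Dedekind zeta function of $\mathbb{Q}(i)$ and $\chi_{-4}$ is the non-trivial Dirichlet character modulo $4$, and $\Phi_{\mathsf{wr},even}(s)$ and $\Phi_{\mathsf{wr},odd}(s)$ are the (absolutely convergent) Dirichlet series that count the rhombic well-rounded sublattices of $\mathbb{Z}^2$ of even and of odd index, respectively. (2) For all real $s>1$, $$D_\square(s)-\Phi_\square(s)<\Phi_{\square,\mathsf{wr}}(s)<D_\square(s)+\Phi_\square(s),$$ where $$D_\square(s)=\frac{2+2^s}{1+2^s}\cdot\frac{1-\sqrt3^{\,1-s}}{s-1}\cdot\frac{L(s,\chi_{-4})}{\zeta(2s)}\,\zeta(s)\,\zeta(2s-1).$$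 (3) The summatory function $A_\square(x)=\sum_{n\le x}a_\square(n)$ satisfies, as $x\to\infty$, $$A_\square(x)=\frac{\log 3}{2\pi}\,x\log x+o(x\log x).$$ -/

import Mathlib

open scoped ComplexOrder

noncomputable section

namespace WellRounded

/-- The Euclidean plane. -/
abbrev Plane : Type := EuclideanSpace ℝ (Fin 2)

/-- The square lattice `ℤ²` in the Euclidean plane. -/
def squareLattice : AddSubgroup Plane where
  carrier := {x | ∀ i, ∃ k : ℤ, x i = k}
  zero_mem' := fun i => ⟨0, by simp⟩
  add_mem' := by
    intro x y hx hy i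
    obtain ⟨k, hk⟩ := hx i
    obtain ⟨l, hl⟩ := hy i
    exact ⟨k + l, by simp [hk, hl]⟩
  neg_mem' := by
    intro x hx i
    obtain ⟨k, hk⟩ := hx i
    exact ⟨-k, by simp [hk]⟩

/-- The nonzero vectors of minimal length of `Γ`. -/
def minimalVectors (Γ : AddSubgroup Plane) : Set Plane :=
  {v | v ∈ Γ ∧ v ≠ 0 ∧ ∀ w ∈ Γ, w ≠ 0 → ‖v‖ ≤ ‖w‖}

/-- `Γ` is well-rounded: its nonzero vectors of minimal length span the plane. -/
def IsWellRounded (Γ : AddSubgroup Plane) : Prop :=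
  Submodule.span ℝ (minimalVectors Γ) = ⊤

/-- `Γ` is similar to `Λ`: it is the image of `Λ` under a linear isometry followed by a scaling. -/
def IsSimilarTo (Γ Λ : AddSubgroup Plane) : Prop :=
  ∃ (c : ℝ) (R : Plane ≃ₗᵢ[ℝ] Plane), 0 < c ∧ ∀ x, x ∈ Γ ↔ ∃ y ∈ Λ, x = c • R y

/-- `Γ` is primitive in `Λ`: it is not contained in `m Λ` for any integer `m > 1`. -/
def IsPrimitiveIn (Γ Λ : AddSubgroup Plane) : Prop :=
  ∀ m : ℕ, 1 < m → ¬ ∀ x ∈ Γ, ∃ y ∈ Λ, x = m • y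

/-- `Γ` is rhombic (and not square): it has a lattice basis of two vectors of equal length which
are not orthogonal. (A square lattice has no such basis.) -/
def IsRhombic (Γ : AddSubgroup Plane) : Prop :=
  ∃ u v : Plane, LinearIndependent ℝ ![u, v] ∧ ‖u‖ = ‖v‖ ∧ inner ℝ u v ≠ 0 ∧
    Γ = AddSubgroup.closure {u, v}

/-- The number of sublattices of the square lattice of index `n` with the property `P`. Only
`n ≥ 1` is ever used; a subgroup of finite index is automatically of full rank. -/
def countSub (P : AddSubgroup Plane → Prop) (n : ℕ) : ℕ :=
  Set.ncard {Γ : AddSubgroup Plane | Γ ≤ squareLattice ∧ Γ.relIndex squareLattice = n ∧ P Γ}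

/-- The number of well-rounded sublattices of the square lattice of index `n`. -/
def aSq (n : ℕ) : ℕ := countSub IsWellRounded n

/-- The number of similar sublattices of the square lattice of index `n`. -/
def sSq (n : ℕ) : ℕ := countSub (fun Γ => IsSimilarTo Γ squareLattice) n

/-- The number of primitive similar sublattices of the square lattice of index `n`. -/
def sSqPr (n : ℕ) : ℕ :=
  countSub (fun Γ => IsSimilarTo Γ squareLattice ∧ IsPrimitiveIn Γ squareLattice) n

/-- The number of rhombic well-rounded sublattices of index `n` if `n` is even, and `0` else. -/
def rhombicEven (n : ℕ) : ℕ :=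
  if Even n then countSub (fun Γ => IsRhombic Γ ∧ IsWellRounded Γ) n else 0

/-- The number of rhombic well-rounded sublattices of index `n` if `n` is odd, and `0` else. -/
def rhombicOdd (n : ℕ) : ℕ :=
  if Odd n then countSub (fun Γ => IsRhombic Γ ∧ IsWellRounded Γ) n else 0

/-- The Dirichlet series `∑ f(n) / n ^ s` over `n ≥ 1` of a counting function. -/
def dirichletSeries (f : ℕ → ℕ) (s : ℂ) : ℂ := LSeries (fun n => (f n : ℂ)) s

/-- The Dirichlet series of `f` converges absolutely at `s`. -/
def DirichletSummable (f : ℕ → ℕ) (s : ℂ) : Prop := LSeriesSummable (fun n => (f n : ℂ)) s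

/-- The function `L(s, χ₋₄)`. -/
def LChi (s : ℂ) : ℂ :=
  DirichletCharacter.LFunction (ZMod.χ₄.ringHomComp (Int.castRingHom ℂ) : DirichletCharacter ℂ 4) s

/-- The Dirichlet series of the well-rounded sublattices. -/
def PhiWr (s : ℂ) : ℂ := dirichletSeries aSq s

/-- The Dirichlet series of the similar sublattices. -/
def PhiSq (s : ℂ) : ℂ := dirichletSeries sSq s

/-- The Dirichlet series of the primitive similar sublattices. -/
def PhiSqPr (s : ℂ) : ℂ := dirichletSeries sSqPr s

/-- The finite sum over `p < q < √3 p` of `1 / (p ^ s q ^ s)`. -/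
def innerEven (s : ℂ) (p : ℕ) : ℂ :=
  ∑ q ∈ Finset.Ioo p ⌈√3 * (p : ℝ)⌉₊, 1 / ((p : ℂ) ^ s * (q : ℂ) ^ s)

/-- The finite sum over `k < l < √3 k + (√3 - 1) / 2` of `1 / ((2k+1) ^ s (2l+1) ^ s)`. -/
def innerOdd (s : ℂ) (k : ℕ) : ℂ :=
  ∑ l ∈ Finset.Ioo k ⌈√3 * (k : ℝ) + (√3 - 1) / 2⌉₊,
    1 / ((2 * (k : ℂ) + 1) ^ s * (2 * (l : ℂ) + 1) ^ s)

/-- The explicit function for the even indices (the term `p = 0` is an empty sum). -/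
def PhiEven (s : ℂ) : ℂ := 2 / 2 ^ s * PhiSqPr s * ∑' p : ℕ, innerEven s p

/-- The explicit function for the odd indices (the term `k = 0` is an empty sum). -/
def PhiOdd (s : ℂ) : ℂ := 2 / (1 + 2 ^ (-s)) * PhiSqPr s * ∑' k : ℕ, innerOdd s k

/-- The comparison function of the two-sided bound. -/
def DSq (s : ℂ) : ℂ :=
  (2 + 2 ^ s) / (1 + 2 ^ s) * ((1 - ((√3 : ℝ) : ℂ) ^ (1 - s)) / (s - 1)) *
    (LChi s / riemannZeta (2 * s)) * riemannZeta s * riemannZeta (2 * s - 1)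

/-- The summatory function of `aSq`. -/
def ASq (x : ℝ) : ℝ := ∑ n ∈ Finset.Icc 1 ⌊x⌋₊, (aSq n : ℝ)

end WellRounded

end

open WellRounded

/-! Identify `ℤ²` with `ℤ[i]`. Two independent shortest vectors `u`, `v` of a planar lattice have
equal norm `N` and generate it, so being well-rounded means having a reduced basis: equal norms and
`2 |dot u v| ≤ N` (`isWellRounded_iff`). If `dot u v = 0`, then `v = ± i u` and the lattice is a
principal ideal, that is, similar to `ℤ²`; otherwise it is rhombic. No principal ideal is rhombic,
so the two classes are disjoint (`aSq_eq_add`).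

In the rhombic case the diagonals `u + v` and `u - v` are orthogonal, hence of the form `p z` and `q
i z` with `z` primitive, and the reduction condition becomes `1/√3 < p/q < √3`. It is strict because
`√3` is irrational. Strictness also leaves `± u`, `± v` as the only minimal vectors, so `(z, p, q)`
is determined by the lattice once `z` is put in a fixed quadrant (`IsParam.unique`). The index is `p
q N(z) / 2`. Integrality of `u` and `v` means that `p`, `q` are both even, or both odd with `N(z)`
even; since `4 ∤ N(z)` for primitive `z`, these are the cases of even and odd index. The counts are
therefore Dirichlet convolutions of close factorizations with counts of primitive elements. For odd
index one needs primitive elements of norm `2 m` with `m` odd; multiplication by `1 + i` matches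
them with those of norm `m`. Hence the primitive series is `1 + 2 ^ (-s)` times its odd part, which
explains the denominator of `PhiOdd`.

Similar sublattices are the nonzero ideals of `ℤ[i]`. Their number is multiplicative in the norm,
and its values at prime powers identify it with `1 * χ₄` (`sSqArith_eq`).

For the inequality, each inner sum is compared with the integral of `t ^ (-s)` over an interval `[P,
√3 P]`. The integral is a strict upper bound, and it exceeds the sum by less than the first,
omitted, term. The upper bounds add up to `DSq`, and the errors to exactly `2 ζ(2s)` times the
primitive series, that is `2 PhiSq`; adding the summand `PhiSq` makes the bounds symmetric.

The asymptotics use no complex analysis. Counting lattice points in a disc gives `sSq` the mean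
value `π/4`; Möbius inversion over squares gives `3/(2π)` for `sSqPr`, and its odd part has `1/π`.
Close factorizations have logarithmic mean values `log 3 / 4`, and `log 3 / 16` for odd factors.
`tendsto_partialSum_conv_div_mul_log` multiplies these mean values. -/

noncomputable section

namespace WellRounded

/-! ### Sublattices of `ℤ²` as subgroups of the Gaussian integers -/

/-- The embedding of the Gaussian integers into the plane, as the square lattice. -/
def toPlane : GaussianInt →+ Plane where
  toFun z := !₂[(z.re : ℝ), (z.im : ℝ)]
  map_zero' := by ext i; fin_cases i <;> simp
  map_add' z w := by ext i; fin_cases i <;> simp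

@[simp] lemma toPlane_zero_apply (z : GaussianInt) : toPlane z 0 = z.re := rfl

@[simp] lemma toPlane_one_apply (z : GaussianInt) : toPlane z 1 = z.im := rfl

lemma toPlane_injective : Function.Injective toPlane := by
  intro z w h
  have h0 := congrArg (fun x : Plane => x 0) h
  have h1 := congrArg (fun x : Plane => x 1) h
  simp only [toPlane_zero_apply, toPlane_one_apply, Int.cast_inj] at h0 h1
  exact Zsqrtd.ext h0 h1

lemma range_toPlane : toPlane.range = squareLattice := by
  ext x
  constructor
  · rintro ⟨z, rfl⟩ i
    fin_cases i
    · exact ⟨z.re, rfl⟩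
    · exact ⟨z.im, rfl⟩
  · intro h
    obtain ⟨a, ha⟩ := h 0
    obtain ⟨b, hb⟩ := h 1
    refine ⟨⟨a, b⟩, ?_⟩
    ext i
    fin_cases i
    · exact ha.symm
    · exact hb.symm

lemma map_toPlane_le (Λ : AddSubgroup GaussianInt) : Λ.map toPlane ≤ squareLattice := by
  rw [← range_toPlane]
  exact AddSubgroup.map_le_range _ _

lemma relIndex_map_toPlane (Λ : AddSubgroup GaussianInt) :
    (Λ.map toPlane).relIndex squareLattice = Λ.index := by
  rw [← range_toPlane, ← AddSubgroup.index_comap,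
    AddSubgroup.comap_map_eq_self_of_injective toPlane_injective]

lemma countSub_eq (P : AddSubgroup Plane → Prop) (n : ℕ) :
    countSub P n = Set.ncard {Λ : AddSubgroup GaussianInt | Λ.index = n ∧ P (Λ.map toPlane)} := by
  rw [countSub, ← Set.ncard_image_of_injective _
    (AddSubgroup.map_injective toPlane_injective)]
  congr 1
  ext Γ
  constructor
  · rintro ⟨h1, h2, h3⟩
    have : (Γ.comap toPlane).map toPlane = Γ := by
      rw [AddSubgroup.map_comap_eq, range_toPlane]
      exact inf_eq_right.2 h1
    refine ⟨Γ.comap toPlane, ⟨?_, ?_⟩, this⟩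
    · rw [← relIndex_map_toPlane, this, h2]
    · rw [this]; exact h3
  · rintro ⟨Λ, ⟨h1, h2⟩, rfl⟩
    exact ⟨map_toPlane_le Λ, by rw [relIndex_map_toPlane, h1], h2⟩

/-! ### Reduced bases and well-rounded lattices -/

/-- The inner product of two Gaussian integers. -/
def dot (u v : GaussianInt) : ℤ := u.re * v.re + u.im * v.im

/-- The determinant of two Gaussian integers. -/
def crs (u v : GaussianInt) : ℤ := u.re * v.im - u.im * v.re

lemma norm_eq (z : GaussianInt) : z.norm = z.re * z.re + z.im * z.im := by
  rw [Zsqrtd.norm_def]; ring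

lemma dot_sq_add_crs_sq (u v : GaussianInt) :
    dot u v ^ 2 + crs u v ^ 2 = u.norm * v.norm := by
  rw [norm_eq, norm_eq, dot, crs]; ring

lemma inner_toPlane (u v : GaussianInt) : inner ℝ (toPlane u) (toPlane v) = (dot u v : ℝ) := by
  rw [PiLp.inner_apply, Fin.sum_univ_two, dot]
  simp
  ring

lemma norm_sq_toPlane (u : GaussianInt) : ‖toPlane u‖ ^ 2 = (u.norm : ℝ) := by
  rw [← real_inner_self_eq_norm_sq, inner_toPlane, norm_eq, dot]

lemma norm_toPlane_le_iff (u v : GaussianInt) : ‖toPlane u‖ ≤ ‖toPlane v‖ ↔ u.norm ≤ v.norm := by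
  rw [← sq_le_sq₀ (norm_nonneg _) (norm_nonneg _), norm_sq_toPlane, norm_sq_toPlane, Int.cast_le]

lemma norm_toPlane_eq_iff (u v : GaussianInt) : ‖toPlane u‖ = ‖toPlane v‖ ↔ u.norm = v.norm := by
  rw [le_antisymm_iff, norm_toPlane_le_iff, norm_toPlane_le_iff, le_antisymm_iff]

lemma linearIndependent_toPlane_iff (u v : GaussianInt) :
    LinearIndependent ℝ ![toPlane u, toPlane v] ↔ crs u v ≠ 0 := by
  rw [LinearIndependent.pair_iff]
  constructor
  · intro h h0
    have hu : ∀ a b : ℝ, a * u.re + b * v.re = 0 → a * u.im + b * v.im = 0 → a = 0 ∧ b = 0 := by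
      intro a b h1 h2
      refine h a b ?_
      ext i
      fin_cases i
      · simpa using h1
      · simpa using h2
    have h0' : (u.re : ℝ) * v.im - u.im * v.re = 0 := by
      have : ((crs u v : ℤ) : ℝ) = 0 := by rw [h0]; simp
      simpa [crs] using this
    obtain ⟨ha, hb⟩ := hu v.im (-u.im) (by linarith) (by ring)
    obtain ⟨hc, hd⟩ := hu v.re (-u.re) (by ring) (by linarith)
    have := hu 1 0 (by linarith) (by linarith)
    exact one_ne_zero this.1
  · intro h a b hab
    have h0 := congrArg (fun x : Plane => x 0) hab
    have h1 := congrArg (fun x : Plane => x 1) hab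
    simp [-GaussianInt.intCast_re, -GaussianInt.intCast_im] at h0 h1
    have hc : ((crs u v : ℤ) : ℝ) ≠ 0 := by exact_mod_cast h
    rw [crs] at hc
    push_cast at hc
    constructor
    · apply (mul_eq_zero.1 (?_ : a * ((u.re : ℝ) * v.im - u.im * v.re) = 0)).resolve_right hc
      linear_combination v.im * h0 - v.re * h1
    · apply (mul_eq_zero.1 (?_ : b * ((u.re : ℝ) * v.im - u.im * v.re) = 0)).resolve_right hc
      linear_combination u.re * h1 - u.im * h0

lemma mem_closure_pair {G : Type*} [AddCommGroup G] {u v w : G} :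
    w ∈ AddSubgroup.closure {u, v} ↔ ∃ a b : ℤ, w = a • u + b • v := by
  rw [AddSubgroup.mem_closure_pair]
  simp only [eq_comm]

lemma exists_two_mul_abs_sub_le (x D : ℤ) (hD : D ≠ 0) : ∃ a : ℤ, 2 * |x - a * D| ≤ |D| := by
  refine ⟨round ((x : ℚ) / D), ?_⟩
  have h := abs_sub_round ((x : ℚ) / D)
  have hD' : (D : ℚ) ≠ 0 := by exact_mod_cast hD
  have h2 : |((x : ℚ) / D - round ((x : ℚ) / D)) * D| ≤ 1 / 2 * |(D : ℚ)| := by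
    rw [abs_mul]; gcongr
  rw [sub_mul, div_mul_cancel₀ _ hD'] at h2
  have : (2 : ℚ) * |(x : ℚ) - round ((x : ℚ) / D) * D| ≤ |(D : ℚ)| := by linarith
  exact_mod_cast this

/-- Equality would give `crs ^ 2 = 3 * dot ^ 2` by the Lagrange identity `dot_sq_add_crs_sq`, making
`√3` rational: `ℤ²` has no hexagonal sublattice. -/
lemma two_mul_abs_dot_lt_of_le {u v : GaussianInt} (hc : crs u v ≠ 0) (hn : u.norm = v.norm)
    (h : 2 * |dot u v| ≤ u.norm) : 2 * |dot u v| < u.norm := by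
  refine lt_of_le_of_ne h fun he => hc ?_
  have h1 := dot_sq_add_crs_sq u v
  rw [← hn, ← he, ← sq_abs (dot u v)] at h1
  set d := |dot u v|
  have h2 : crs u v ^ 2 = 3 * d ^ 2 := by linarith
  by_contra h0
  have hd : d ≠ 0 := by rintro hd; rw [hd] at h2; apply h0; nlinarith
  have h3 : (((crs u v : ℤ) : ℝ) / d) ^ 2 = 3 := by
    have : (d : ℝ) ≠ 0 := by exact_mod_cast hd
    rw [div_pow, div_eq_iff (by positivity)]
    exact_mod_cast h2
  have h4 := (Nat.Prime.irrational_sqrt Nat.prime_three)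
  apply h4
  refine ⟨|(crs u v : ℚ) / d|, ?_⟩
  rw [Nat.cast_ofNat, ← h3, Real.sqrt_sq_eq_abs]
  push_cast
  rfl

lemma norm_combination (u v : GaussianInt) (a b : ℤ) (h : u.norm = v.norm) :
    (a • u + b • v).norm = (a ^ 2 + b ^ 2) * u.norm + 2 * (a * b) * dot u v := by
  have : (a ^ 2 + b ^ 2) * u.norm = a ^ 2 * u.norm + b ^ 2 * v.norm := by rw [← h]; ring
  rw [this]
  simp only [norm_eq, dot, zsmul_eq_mul, Zsqrtd.re_add, Zsqrtd.im_add, Zsqrtd.re_mul,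
    Zsqrtd.im_mul, Zsqrtd.re_intCast, Zsqrtd.im_intCast]
  ring

/-- Gauss reduction: a lattice vector of minimal length has length at least that of a reduced
rhombic basis. -/
lemma norm_le_of_reduced {u v : GaussianInt} (hn : u.norm = v.norm)
    (h : 2 * |dot u v| ≤ u.norm) {w : GaussianInt} (hw : w ∈ AddSubgroup.closure {u, v})
    (hw0 : w ≠ 0) : u.norm ≤ w.norm := by
  obtain ⟨a, b, rfl⟩ := mem_closure_pair.1 hw
  rw [norm_combination u v a b hn]
  -- The norm is at least `(a² + b² - |a b|) * u.norm`, and the form `a² - |a b| + b²` is at least 1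
  -- at nonzero integer points.
  have h1 : 2 * (a * b) * dot u v ≥ - (|a * b| * u.norm) := by
    have := neg_abs_le (2 * (a * b) * dot u v)
    rw [abs_mul, abs_mul, abs_two] at this
    nlinarith [abs_nonneg (a * b)]
  have h2 : 1 ≤ a ^ 2 + b ^ 2 - |a * b| := by
    have h3 : 0 < a ^ 2 + b ^ 2 := by
      by_contra h3
      have ha : a = 0 := by nlinarith [sq_nonneg a, sq_nonneg b]
      have hb : b = 0 := by nlinarith [sq_nonneg a, sq_nonneg b]
      apply hw0; simp [ha, hb]
    have h4 : 2 * |a * b| ≤ a ^ 2 + b ^ 2 := by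
      rw [abs_mul]
      nlinarith [sq_nonneg (|a| - |b|), sq_abs a, sq_abs b]
    omega
  have hu : 0 ≤ u.norm := GaussianInt.norm_nonneg u
  nlinarith

/-- Two independent minimal vectors of a plane lattice generate it. -/
lemma eq_closure_of_minimal {Λ : AddSubgroup GaussianInt} {u v : GaussianInt} (hu : u ∈ Λ)
    (hv : v ∈ Λ) (hc : crs u v ≠ 0) (hn : u.norm = v.norm)
    (hmin : ∀ w ∈ Λ, w ≠ 0 → u.norm ≤ w.norm) : Λ = AddSubgroup.closure {u, v} := by
  apply le_antisymm
  · intro w hw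
    -- Cramer's rule gives the coordinates of `w` as quotients by `crs u v`; rounding both leaves a
    -- remainder with coordinates at most 1/2 in absolute value, which will be too short to be a
    -- nonzero lattice vector.
    obtain ⟨a, ha⟩ := exists_two_mul_abs_sub_le (crs w v) (crs u v) hc
    obtain ⟨b, hb⟩ := exists_two_mul_abs_sub_le (crs u w) (crs u v) hc
    refine mem_closure_pair.2 ⟨a, b, ?_⟩
    by_contra hne
    have hw' : w - (a • u + b • v) ∈ Λ :=
      Λ.sub_mem hw (Λ.add_mem (Λ.zsmul_mem hu a) (Λ.zsmul_mem hv b))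
    have h1 := hmin _ hw' (sub_ne_zero.2 hne)
    set α := crs w v - a * crs u v
    set β := crs u w - b * crs u v
    have hD : (crs u v) • (w - (a • u + b • v)) = α • u + β • v := by
      ext <;> simp [α, β, crs] <;> ring
    have hN := norm_combination u v α β hn
    rw [← hD, zsmul_eq_mul, Zsqrtd.norm_mul, Zsqrtd.norm_intCast] at hN
    have hDpos : 0 < crs u v ^ 2 := by positivity
    have hα : 4 * α ^ 2 ≤ crs u v ^ 2 := by
      rw [← sq_abs α, ← sq_abs (crs u v)]; nlinarith [abs_nonneg α]
    have hβ : 4 * β ^ 2 ≤ crs u v ^ 2 := by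
      rw [← sq_abs β, ← sq_abs (crs u v)]; nlinarith [abs_nonneg β]
    have hdot : |dot u v| < u.norm := by
      have h2 := dot_sq_add_crs_sq u v
      rw [← hn] at h2
      apply abs_lt_of_sq_lt_sq _ (GaussianInt.norm_nonneg u)
      nlinarith
    have hu0 : 0 ≤ u.norm := GaussianInt.norm_nonneg u
    have h3 : 2 * (α * β) * dot u v ≤ (α ^ 2 + β ^ 2) * |dot u v| := by
      have h4 : 2 * (α * β) * dot u v ≤ |2 * (α * β)| * |dot u v| := by
        rw [← abs_mul]; exact le_abs_self _
      have h5 : |2 * (α * β)| ≤ α ^ 2 + β ^ 2 := by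
        rw [abs_le]; constructor <;> nlinarith [sq_nonneg (α + β), sq_nonneg (α - β)]
      nlinarith [abs_nonneg (dot u v)]
    -- Multiplied by `crs u v ^ 2`, the norm of the remainder is at most `crs u v ^ 2 * (u.norm +
    -- |dot u v|) / 2`, which is less than `crs u v ^ 2 * u.norm` because `|dot u v| < u.norm`.
    have h6 : (α ^ 2 + β ^ 2) * (u.norm + |dot u v|) * 2 ≤ crs u v ^ 2 * (u.norm + |dot u v|) := by
      nlinarith [abs_nonneg (dot u v)]
    nlinarith
  · rw [AddSubgroup.closure_le]
    rintro x (rfl | rfl)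
    · exact hu
    · exact hv

/-- `u, v` is a basis of minimal vectors of `Λ`. -/
def IsReducedBasis (Λ : AddSubgroup GaussianInt) (u v : GaussianInt) : Prop :=
  crs u v ≠ 0 ∧ u.norm = v.norm ∧ 2 * |dot u v| ≤ u.norm ∧ Λ = AddSubgroup.closure {u, v}

lemma ne_zero_of_crs_left {u v : GaussianInt} (h : crs u v ≠ 0) : u ≠ 0 := by
  rintro rfl; simp [crs] at h

lemma ne_zero_of_crs_right {u v : GaussianInt} (h : crs u v ≠ 0) : v ≠ 0 := by
  rintro rfl; simp [crs] at h

lemma isWellRounded_iff (Λ : AddSubgroup GaussianInt) :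
    IsWellRounded (Λ.map toPlane) ↔ ∃ u v, IsReducedBasis Λ u v := by
  constructor
  · intro h
    have hex : ∃ u v, toPlane u ∈ minimalVectors (Λ.map toPlane) ∧
        toPlane v ∈ minimalVectors (Λ.map toPlane) ∧ crs u v ≠ 0 := by
      by_contra hno
      push Not at hno
      have hne : (minimalVectors (Λ.map toPlane)).Nonempty := by
        rw [Set.nonempty_iff_ne_empty]
        intro he
        rw [IsWellRounded, he, Submodule.span_empty] at h
        exact bot_ne_top h
      obtain ⟨x, hx⟩ := hne
      obtain ⟨⟨u, hu, rfl⟩, hx2⟩ := id hx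
      -- The determinant against `u`. If all minimal vectors were parallel to `u`, it would vanish
      -- on their span, in particular at `1` and `i`, and `u` would be zero.
      let φ : Plane →ₗ[ℝ] ℝ := (u.re : ℝ) • (EuclideanSpace.proj (𝕜 := ℝ) (1 : Fin 2)).toLinearMap
        - (u.im : ℝ) • (EuclideanSpace.proj (𝕜 := ℝ) (0 : Fin 2)).toLinearMap
      have hφ : ∀ y : Plane, φ y = u.re * y 1 - u.im * y 0 := fun y => by simp [φ]
      have hle : (⊤ : Submodule ℝ Plane) ≤ LinearMap.ker φ := by
        rw [← h, Submodule.span_le]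
        rintro y hy
        obtain ⟨⟨v, hv, rfl⟩, hy2⟩ := id hy
        have := hno u v hx hy
        rw [SetLike.mem_coe, LinearMap.mem_ker, hφ]
        simp only [toPlane_zero_apply, toPlane_one_apply]
        rw [crs] at this
        exact_mod_cast this
      have h1 : φ (toPlane 1) = 0 := hle (Submodule.mem_top)
      have h2 : φ (toPlane ⟨0, 1⟩) = 0 := hle (Submodule.mem_top)
      rw [hφ] at h1 h2
      simp [-GaussianInt.intCast_re, -GaussianInt.intCast_im] at h1 h2
      apply hx2.1
      have : u = 0 := Zsqrtd.ext h2 h1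
      rw [this, map_zero]
    obtain ⟨u, v, hu, hv, hc⟩ := hex
    have mem : ∀ {w}, toPlane w ∈ Λ.map toPlane → w ∈ Λ := by
      rintro w ⟨w', hw', e⟩
      rwa [← toPlane_injective e]
    have hn : u.norm = v.norm := by
      rw [← norm_toPlane_eq_iff]
      exact le_antisymm (hu.2.2 _ hv.1 hv.2.1) (hv.2.2 _ hu.1 hu.2.1)
    have hmin : ∀ w ∈ Λ, w ≠ 0 → u.norm ≤ w.norm := by
      intro w hw h0
      rw [← norm_toPlane_le_iff]
      refine hu.2.2 _ ⟨w, hw, rfl⟩ ?_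
      rw [← map_zero toPlane]
      exact fun e => h0 (toPlane_injective e)
    refine ⟨u, v, hc, hn, ?_, eq_closure_of_minimal (mem hu.1) (mem hv.1) hc hn hmin⟩
    -- The vectors `u ± v` are nonzero of norm `2 * u.norm ± 2 * dot u v`; minimality bounds both
    -- below by `u.norm`.
    have e1 := norm_combination u v 1 1 hn
    have e2 := norm_combination u v 1 (-1) hn
    have i1 := hmin ((1 : ℤ) • u + (1 : ℤ) • v)
      (Λ.add_mem (Λ.zsmul_mem (mem hu.1) _) (Λ.zsmul_mem (mem hv.1) _)) (by
        intro h0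
        rw [one_zsmul, one_zsmul, add_eq_zero_iff_eq_neg] at h0
        apply hc; rw [h0]; simp [crs]; ring)
    have i2 := hmin ((1 : ℤ) • u + (-1 : ℤ) • v)
      (Λ.add_mem (Λ.zsmul_mem (mem hu.1) _) (Λ.zsmul_mem (mem hv.1) _)) (by
        intro h0
        rw [one_zsmul, neg_one_zsmul, add_neg_eq_zero] at h0
        apply hc; rw [h0]; simp [crs]; ring)
    rw [e1] at i1
    rw [e2] at i2
    have : |dot u v| * 2 ≤ u.norm := by
      rcases abs_cases (dot u v) with ⟨h, -⟩ | ⟨h, -⟩ <;> rw [h] <;> linarith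
    linarith
  · rintro ⟨u, v, hc, hn, hd, rfl⟩
    have key : ∀ w ∈ ({u, v} : Set GaussianInt), toPlane w ∈
        minimalVectors ((AddSubgroup.closure {u, v}).map toPlane) := by
      intro w hw
      refine ⟨⟨w, AddSubgroup.subset_closure hw, rfl⟩, ?_, ?_⟩
      · rw [← map_zero toPlane]
        intro e
        have := toPlane_injective e
        rcases hw with rfl | rfl
        · exact ne_zero_of_crs_left hc this
        · exact ne_zero_of_crs_right hc this
      · rintro x ⟨w', hw', rfl⟩ h0
        rw [norm_toPlane_le_iff]
        have hw : w.norm = u.norm := by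
          rcases hw with rfl | rfl
          · rfl
          · exact hn.symm
        rw [hw]
        refine norm_le_of_reduced hn hd hw' ?_
        rintro rfl
        exact h0 (map_zero _)
    rw [IsWellRounded, eq_top_iff]
    intro x _
    have hsub : Submodule.span ℝ {toPlane u, toPlane v} ≤ Submodule.span ℝ
        (minimalVectors ((AddSubgroup.closure {u, v}).map toPlane)) := by
      apply Submodule.span_mono
      rintro y (rfl | rfl)
      · exact key _ (by simp)
      · exact key _ (by simp)
    apply hsub
    have hD : ((crs u v : ℤ) : ℝ) ≠ 0 := by exact_mod_cast hc
    rw [Submodule.mem_span_pair]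
    -- Cramer's rule.
    refine ⟨(x 0 * v.im - x 1 * v.re) / crs u v, (u.re * x 1 - u.im * x 0) / crs u v, ?_⟩
    ext i
    fin_cases i <;> simp <;> field_simp <;> simp [crs] <;> ring

/-- The `ℤ`-basis `1, i` of the Gaussian integers. -/
def gaussBasis : Module.Basis (Fin 2) ℤ GaussianInt :=
  Module.Basis.ofEquivFun
    { toFun := fun z => ![z.re, z.im]
      invFun := fun f => ⟨f 0, f 1⟩
      map_add' := fun z w => by ext i; fin_cases i <;> simp
      map_smul' := fun a z => by ext i; fin_cases i <;> simp
      left_inv := fun z => by simp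
      right_inv := fun f => by ext i; fin_cases i <;> simp }

lemma gaussBasis_repr (z : GaussianInt) : ⇑(gaussBasis.repr z) = ![z.re, z.im] := by
  rw [← Module.Basis.equivFun_apply, gaussBasis, Module.Basis.equivFun_ofEquivFun]
  rfl

lemma index_closure_pair {u v : GaussianInt} (h : crs u v ≠ 0) :
    (AddSubgroup.closure {u, v}).index = (crs u v).natAbs := by
  have hli : LinearIndependent ℤ ![u, v] := by
    rw [LinearIndependent.pair_iff]
    intro a b hab
    have h0 := congrArg Zsqrtd.re hab
    have h1 := congrArg Zsqrtd.im hab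
    simp at h0 h1
    constructor
    · apply (mul_eq_zero.1 (?_ : a * crs u v = 0)).resolve_right h
      rw [crs]; linear_combination v.im * h0 - v.re * h1
    · apply (mul_eq_zero.1 (?_ : b * crs u v = 0)).resolve_right h
      rw [crs]; linear_combination u.re * h1 - u.im * h0
  have : Module.Free ℤ GaussianInt := Module.Free.of_basis gaussBasis
  have : Module.Finite ℤ GaussianInt := Module.Finite.of_basis gaussBasis
  have hcard := Submodule.natAbs_det_basis_change gaussBasis (Submodule.span ℤ (Set.range ![u, v]))
    (Module.Basis.span hli)
  have hcl : (Submodule.span ℤ (Set.range ![u, v])).toAddSubgroup = AddSubgroup.closure {u, v} := by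
    rw [Submodule.span_int_eq_addSubgroupClosure]
    simp [Set.pair_comm]
  have hdet : gaussBasis.det ((↑) ∘ (Module.Basis.span hli)) = crs u v := by
    rw [Module.Basis.det_apply, Matrix.det_fin_two]
    simp [Module.Basis.toMatrix_apply, Module.Basis.span_apply, gaussBasis_repr, crs]
    ring
  rw [hdet] at hcard
  rw [← hcl, hcard]
  rfl

lemma IsReducedBasis.index_eq {Λ : AddSubgroup GaussianInt} {u v : GaussianInt}
    (h : IsReducedBasis Λ u v) : Λ.index = (crs u v).natAbs := by
  obtain ⟨hc, -, -, rfl⟩ := h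
  exact index_closure_pair hc

/-! ### Similar sublattices as principal ideals -/

/-- The imaginary unit. -/
def gI : GaussianInt := ⟨0, 1⟩

@[simp] lemma re_gI : gI.re = 0 := rfl

@[simp] lemma im_gI : gI.im = 1 := rfl

lemma norm_gI_mul (z : GaussianInt) : (gI * z).norm = z.norm := by
  simp [norm_eq]; ring

lemma gI_mul_gI : gI * gI = -1 := by ext <;> simp [gI]

/-- The additive group of the ideal generated by `z`. -/
def principal (z : GaussianInt) : AddSubgroup GaussianInt :=
  (Ideal.span {z} : Ideal GaussianInt).toAddSubgroup

lemma mem_principal {z w : GaussianInt} : w ∈ principal z ↔ z ∣ w :=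
  Ideal.mem_span_singleton

lemma principal_eq_closure (z : GaussianInt) : principal z = AddSubgroup.closure {z, gI * z} := by
  ext w
  rw [mem_principal, mem_closure_pair]
  constructor
  · rintro ⟨t, rfl⟩
    exact ⟨t.re, t.im, by ext <;> simp <;> ring⟩
  · rintro ⟨a, b, rfl⟩
    exact ⟨⟨a, b⟩, by ext <;> simp <;> ring⟩

lemma isReducedBasis_principal {z : GaussianInt} (hz : z ≠ 0) :
    IsReducedBasis (principal z) z (gI * z) := by
  have h := GaussianInt.norm_pos.2 hz
  rw [norm_eq] at h
  refine ⟨?_, (norm_gI_mul z).symm, ?_, principal_eq_closure z⟩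
  · simp [crs]; omega
  · have : dot z (gI * z) = 0 := by simp [dot]; ring
    rw [this, norm_eq]; simp; omega

lemma index_principal {z : GaussianInt} (hz : z ≠ 0) : (principal z).index = z.norm.natAbs := by
  rw [(isReducedBasis_principal hz).index_eq, norm_eq]
  simp [crs]

/-- The Lagrange identity forces `crs u v = ± u.norm`, and `u.norm * v = dot u v * u + crs u v * (i
u)` then determines `v`. -/
lemma eq_or_eq_of_dot_eq_zero {u v : GaussianInt} (hu : u ≠ 0) (hn : u.norm = v.norm)
    (hd : dot u v = 0) : v = gI * u ∨ v = - (gI * u) := by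
  have h1 := dot_sq_add_crs_sq u v
  have hN : u.norm ≠ 0 := (GaussianInt.norm_pos.2 hu).ne'
  rw [hd, ← hn] at h1
  have h2 : crs u v = u.norm ∨ crs u v = - u.norm := by
    apply sq_eq_sq_iff_eq_or_eq_neg.1; linarith
  have hre : u.norm * v.re = dot u v * u.re - crs u v * u.im := by
    rw [norm_eq, dot, crs]; ring
  have him : u.norm * v.im = dot u v * u.im + crs u v * u.re := by
    rw [norm_eq, dot, crs]; ring
  rw [hd] at hre him
  rcases h2 with h2 | h2 <;> rw [h2] at hre him
  · left
    ext
    · apply mul_left_cancel₀ hN; simp [-mul_eq_mul_left_iff]; linear_combination hre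
    · apply mul_left_cancel₀ hN; simp [-mul_eq_mul_left_iff]; linear_combination him
  · right
    ext
    · apply mul_left_cancel₀ hN; simp [-mul_eq_mul_left_iff]; linear_combination hre
    · apply mul_left_cancel₀ hN; simp [-mul_eq_mul_left_iff]; linear_combination him

lemma closure_pair_neg {G : Type*} [AddCommGroup G] (u v : G) :
    AddSubgroup.closure {u, -v} = AddSubgroup.closure {u, v} := by
  ext w
  rw [mem_closure_pair, mem_closure_pair]
  constructor
  · rintro ⟨a, b, rfl⟩; exact ⟨a, -b, by simp⟩
  · rintro ⟨a, b, rfl⟩; exact ⟨a, -b, by simp⟩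

lemma IsReducedBasis.eq_principal {Λ : AddSubgroup GaussianInt} {u v : GaussianInt}
    (h : IsReducedBasis Λ u v) (hd : dot u v = 0) : Λ = principal u := by
  obtain ⟨hc, hn, -, rfl⟩ := h
  rw [principal_eq_closure]
  rcases eq_or_eq_of_dot_eq_zero (ne_zero_of_crs_left hc) hn hd with h | h
  · rw [h]
  · rw [h, closure_pair_neg]

lemma isRhombic_iff (Λ : AddSubgroup GaussianInt) :
    IsRhombic (Λ.map toPlane) ↔ ∃ u v, crs u v ≠ 0 ∧ u.norm = v.norm ∧ dot u v ≠ 0 ∧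
      Λ = AddSubgroup.closure {u, v} := by
  have hmap : ∀ u v, (AddSubgroup.closure {u, v}).map toPlane =
      AddSubgroup.closure {toPlane u, toPlane v} := by
    intro u v
    rw [AddMonoidHom.map_closure, Set.image_pair]
  constructor
  · rintro ⟨x, y, h1, h2, h3, h4⟩
    obtain ⟨u, hu, rfl⟩ : x ∈ Λ.map toPlane := h4 ▸ AddSubgroup.subset_closure (by simp)
    obtain ⟨v, hv, rfl⟩ : y ∈ Λ.map toPlane := h4 ▸ AddSubgroup.subset_closure (by simp)
    refine ⟨u, v, (linearIndependent_toPlane_iff u v).1 h1, (norm_toPlane_eq_iff u v).1 h2, ?_, ?_⟩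
    · rw [inner_toPlane] at h3; exact_mod_cast h3
    · apply AddSubgroup.map_injective toPlane_injective
      rw [h4, hmap]
  · rintro ⟨u, v, h1, h2, h3, rfl⟩
    refine ⟨toPlane u, toPlane v, (linearIndependent_toPlane_iff u v).2 h1,
      (norm_toPlane_eq_iff u v).2 h2, ?_, hmap u v⟩
    rw [inner_toPlane]; exact_mod_cast h3

lemma dot_mul_left (z a b : GaussianInt) : dot (z * a) (z * b) = z.norm * dot a b := by
  simp [dot, norm_eq]; ring

lemma crs_mul_left (z a b : GaussianInt) : crs (z * a) (z * b) = z.norm * crs a b := by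
  simp [crs, norm_eq]; ring

/-- Dividing a rhombic basis of the ideal by `z` gives `a`, `b` of equal norm with `crs a b = ± 1`,
so that `dot a b ^ 2 + 1 = a.norm ^ 2`. Two squares differ by 1 only if the smaller one is 0, so the
basis is orthogonal. -/
lemma not_isRhombic_principal {z : GaussianInt} (hz : z ≠ 0) :
    ¬ IsRhombic ((principal z).map toPlane) := by
  rw [isRhombic_iff]
  rintro ⟨u, v, hc, hn, hd, h⟩
  have hi := index_principal hz
  rw [h, index_closure_pair hc] at hi
  obtain ⟨a, rfl⟩ : z ∣ u := mem_principal.1 (h ▸ AddSubgroup.subset_closure (by simp))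
  obtain ⟨b, rfl⟩ : z ∣ v := mem_principal.1 (h ▸ AddSubgroup.subset_closure (by simp))
  have hN := GaussianInt.norm_pos.2 hz
  rw [dot_mul_left] at hd
  rw [crs_mul_left, Int.natAbs_mul] at hi
  have hc1 : (crs a b).natAbs = 1 := by
    apply Nat.eq_of_mul_eq_mul_left (Int.natAbs_pos.2 hN.ne')
    rw [hi, mul_one]
  rw [Zsqrtd.norm_mul, Zsqrtd.norm_mul] at hn
  have hn' := mul_left_cancel₀ hN.ne' hn
  have h1 := dot_sq_add_crs_sq a b
  rw [← hn', ← Int.natAbs_sq (crs a b), hc1] at h1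
  have hd0 : dot a b ≠ 0 := right_ne_zero_of_mul hd
  have h3 : 1 ≤ |dot a b| := Int.one_le_abs hd0
  rw [← sq_abs (dot a b)] at h1
  have h4 : 0 ≤ a.norm := GaussianInt.norm_nonneg a
  have h5 : |dot a b| < a.norm := by push_cast at h1; nlinarith
  push_cast at h1
  nlinarith

lemma isRhombic_and_isWellRounded_iff (Λ : AddSubgroup GaussianInt) :
    (IsRhombic (Λ.map toPlane) ∧ IsWellRounded (Λ.map toPlane)) ↔
      ∃ u v, IsReducedBasis Λ u v ∧ dot u v ≠ 0 := by
  rw [isWellRounded_iff]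
  constructor
  · rintro ⟨h, u, v, huv⟩
    refine ⟨u, v, huv, fun hd => ?_⟩
    have := huv.eq_principal hd
    rw [this] at h
    exact not_isRhombic_principal (ne_zero_of_crs_left huv.1) h
  · rintro ⟨u, v, huv, hd⟩
    exact ⟨(isRhombic_iff Λ).2 ⟨u, v, huv.1, huv.2.1, hd, huv.2.2.2⟩, u, v, huv⟩

lemma toPlane_eq_repr (z : GaussianInt) :
    toPlane z = Complex.orthonormalBasisOneI.repr (GaussianInt.toComplex z) := by
  ext i
  fin_cases i <;> simp [-GaussianInt.intCast_re, -GaussianInt.intCast_im, GaussianInt.toComplex_def]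

/-- Multiplication by `z` is the rotation by `z / ‖z‖` followed by scaling with `‖z‖`. -/
lemma isSimilarTo_principal {z : GaussianInt} (hz : z ≠ 0) :
    IsSimilarTo ((principal z).map toPlane) squareLattice := by
  have hz' : GaussianInt.toComplex z ≠ 0 := by rwa [Ne, GaussianInt.toComplex_eq_zero]
  have hpos : 0 < ‖GaussianInt.toComplex z‖ := norm_pos_iff.2 hz'
  let a : Circle := ⟨GaussianInt.toComplex z / ‖GaussianInt.toComplex z‖, by
    simp [Submonoid.unitSphere, hz']⟩
  let E := Complex.orthonormalBasisOneI.repr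
  have key : ∀ w : GaussianInt, toPlane (z * w) =
      ‖GaussianInt.toComplex z‖ • (E.symm.trans ((rotation a).trans E)) (toPlane w) := by
    intro w
    rw [toPlane_eq_repr, toPlane_eq_repr]
    simp only [LinearIsometryEquiv.trans_apply, LinearIsometryEquiv.symm_apply_apply, E]
    rw [← map_smul]
    congr 1
    rw [rotation_apply]
    simp only [a, map_mul, Complex.real_smul]
    field_simp
  refine ⟨‖GaussianInt.toComplex z‖, E.symm.trans ((rotation a).trans E), hpos, fun x => ?_⟩
  rw [← range_toPlane]
  constructor
  · rintro ⟨w, hw, rfl⟩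
    obtain ⟨t, rfl⟩ := mem_principal.1 hw
    exact ⟨toPlane t, ⟨t, rfl⟩, key t⟩
  · rintro ⟨_, ⟨t, rfl⟩, rfl⟩
    exact ⟨z * t, mem_principal.2 (Dvd.intro _ rfl), key t⟩

/-- A similarity sends `1` and `i` to orthogonal vectors of equal length, so the second image is `±
i` times the first, and the two generate the ideal of the first. Reflections cause no trouble: only
the sign changes. -/
lemma isSimilarTo_iff (Λ : AddSubgroup GaussianInt) :
    IsSimilarTo (Λ.map toPlane) squareLattice ↔ ∃ z, z ≠ 0 ∧ Λ = principal z := by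
  constructor
  · rintro ⟨c, R, hc, h⟩
    have mem : ∀ w : GaussianInt, c • R (toPlane w) ∈ Λ.map toPlane := fun w =>
      (h _).2 ⟨toPlane w, by rw [← range_toPlane]; exact ⟨w, rfl⟩, rfl⟩
    obtain ⟨u, hu, hu'⟩ := mem 1
    obtain ⟨v, hv, hv'⟩ := mem gI
    have hnu : u.norm = v.norm := by
      rw [← norm_toPlane_eq_iff, hu', hv', norm_smul, norm_smul, R.norm_map, R.norm_map]
      rw [(norm_toPlane_eq_iff 1 gI).2 (by simp [norm_eq])]
    have hd : dot u v = 0 := by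
      have : inner ℝ (toPlane u) (toPlane v) = 0 := by
        rw [hu', hv', inner_smul_left, inner_smul_right, R.inner_map_map, inner_toPlane]
        simp [dot, gI]
      rw [inner_toPlane] at this
      exact_mod_cast this
    have hu0 : u ≠ 0 := by
      rintro rfl
      rw [map_zero, eq_comm, smul_eq_zero] at hu'
      rcases hu' with h | h
      · exact hc.ne' h
      · rw [LinearIsometryEquiv.map_eq_zero_iff, ← map_zero toPlane] at h
        exact one_ne_zero (toPlane_injective h)
    have hΛ : Λ = AddSubgroup.closure {u, v} := by
      ext w
      rw [mem_closure_pair]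
      constructor
      · intro hw
        obtain ⟨y, hy, hxy⟩ := (h (toPlane w)).1 ⟨w, hw, rfl⟩
        rw [← range_toPlane] at hy
        obtain ⟨t, rfl⟩ := hy
        refine ⟨t.re, t.im, toPlane_injective ?_⟩
        rw [hxy, map_add, map_zsmul, map_zsmul, hu', hv']
        have : t = t.re • 1 + t.im • gI := by ext <;> simp [gI]
        conv_lhs => rw [this, map_add, map_zsmul, map_zsmul]
        rw [← Int.cast_smul_eq_zsmul ℝ, ← Int.cast_smul_eq_zsmul ℝ, map_add, map_smul, map_smul,
          smul_add, smul_comm c, smul_comm c, Int.cast_smul_eq_zsmul, Int.cast_smul_eq_zsmul]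
      · rintro ⟨a, b, rfl⟩
        exact Λ.add_mem (Λ.zsmul_mem hu a) (Λ.zsmul_mem hv b)
    refine ⟨u, hu0, ?_⟩
    rw [hΛ, principal_eq_closure]
    rcases eq_or_eq_of_dot_eq_zero hu0 hnu hd with h | h
    · rw [h]
    · rw [h, closure_pair_neg]
  · rintro ⟨z, hz, rfl⟩
    exact isSimilarTo_principal hz

/-- The ideal lies in `m ℤ²` exactly when `m` divides both coordinates of `z`; the critical value of
`m` is their gcd. -/
lemma isPrimitiveIn_principal_iff {z : GaussianInt} (hz : z ≠ 0) :
    IsPrimitiveIn ((principal z).map toPlane) squareLattice ↔ IsCoprime z.re z.im := by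
  have key : ∀ m : ℕ, (∀ x ∈ (principal z).map toPlane, ∃ y ∈ squareLattice, x = m • y) ↔
      ((m : ℤ) ∣ z.re ∧ (m : ℤ) ∣ z.im) := by
    intro m
    rw [← Zsqrtd.intCast_dvd]
    constructor
    · intro h
      obtain ⟨y, hy, hxy⟩ := h (toPlane z) ⟨z, mem_principal.2 dvd_rfl, rfl⟩
      rw [← range_toPlane] at hy
      obtain ⟨t, rfl⟩ := hy
      rw [← map_nsmul] at hxy
      refine ⟨t, ?_⟩
      rw [toPlane_injective hxy]; simp
    · rintro ⟨t, rfl⟩ x ⟨w, hw, rfl⟩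
      obtain ⟨r, rfl⟩ := mem_principal.1 hw
      refine ⟨toPlane (t * r), by rw [← range_toPlane]; exact ⟨_, rfl⟩, ?_⟩
      rw [← map_nsmul]; simp [mul_assoc]
  rw [IsPrimitiveIn, Int.isCoprime_iff_gcd_eq_one]
  have hpos : 0 < Int.gcd z.re z.im := (Zsqrtd.gcd_pos_iff z).2 hz
  constructor
  · intro h
    by_contra hne
    apply h (Int.gcd z.re z.im) (by omega)
    rw [key]
    exact ⟨Int.gcd_dvd_left .., Int.gcd_dvd_right ..⟩
  · intro h m hm hm'
    rw [key] at hm'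
    have := Int.dvd_coe_gcd hm'.1 hm'.2
    rw [h] at this
    have := Int.natCast_dvd_natCast.1 this
    rw [Nat.dvd_one] at this
    omega

/-! ### Counting ideals by generators in a quadrant -/

/-- The half-open quadrant, a set of representatives of the nonzero Gaussian integers modulo
units. -/
def InQuad (z : GaussianInt) : Prop := 0 < z.re ∧ 0 ≤ z.im

instance : DecidablePred InQuad := fun _ => inferInstanceAs (Decidable (_ ∧ _))

lemma InQuad.ne_zero {z : GaussianInt} (h : InQuad z) : z ≠ 0 := by
  rintro rfl; exact lt_irrefl _ h.1

lemma InQuad.norm_pos {z : GaussianInt} (h : InQuad z) : 0 < z.norm :=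
  GaussianInt.norm_pos.2 h.ne_zero

lemma exists_inQuad {z : GaussianInt} (hz : z ≠ 0) : ∃ w, InQuad w ∧
    (z = w ∨ z = gI * w ∨ z = -w ∨ z = -(gI * w)) := by
  rcases lt_trichotomy z.re 0 with h | h | h
  · rcases le_or_gt z.im 0 with h2 | h2
    · exact ⟨-z, ⟨by simpa using h, by simpa using h2⟩, by simp⟩
    · refine ⟨-(gI * z), ⟨by simpa using h2, by simpa using h.le⟩, Or.inr (Or.inl ?_)⟩
      rw [mul_neg, ← mul_assoc, gI_mul_gI]; ring
  · rcases lt_trichotomy z.im 0 with h2 | h2 | h2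
    · refine ⟨gI * z, ⟨by simpa using h2, by simp [h]⟩, Or.inr (Or.inr (Or.inr ?_))⟩
      rw [← mul_assoc, gI_mul_gI]; ring
    · exact absurd (Zsqrtd.ext h h2) hz
    · refine ⟨-(gI * z), ⟨by simpa using h2, by simp [h]⟩, Or.inr (Or.inl ?_)⟩
      rw [mul_neg, ← mul_assoc, gI_mul_gI]; ring
  · rcases le_or_gt 0 z.im with h2 | h2
    · exact ⟨z, ⟨h, h2⟩, by simp⟩
    · refine ⟨gI * z, ⟨by simpa using h2, by simpa using h.le⟩, Or.inr (Or.inr (Or.inr ?_))⟩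
      rw [← mul_assoc, gI_mul_gI]; ring

/-- The Gaussian integers of norm `n` in the quadrant. -/
def quadReps (n : ℕ) : Finset GaussianInt :=
  (((Finset.Icc (0 : ℤ) n) ×ˢ (Finset.Icc (0 : ℤ) n)).image fun x => ⟨x.1, x.2⟩).filter
    fun z => InQuad z ∧ z.norm = n

lemma mem_quadReps {n : ℕ} {z : GaussianInt} : z ∈ quadReps n ↔ InQuad z ∧ z.norm = n := by
  rw [quadReps, Finset.mem_filter, and_iff_right_iff_imp]
  rintro ⟨⟨h1, h2⟩, h3⟩
  rw [norm_eq] at h3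
  refine Finset.mem_image.2 ⟨(z.re, z.im), ?_, rfl⟩
  simp only [Finset.mem_product, Finset.mem_Icc]
  refine ⟨⟨h1.le, ?_⟩, h2, ?_⟩ <;> nlinarith

/-- The primitive Gaussian integers of norm `n` in the quadrant. -/
def primReps (n : ℕ) : Finset GaussianInt :=
  open Classical in (quadReps n).filter fun z => IsCoprime z.re z.im

lemma mem_primReps {n : ℕ} {z : GaussianInt} :
    z ∈ primReps n ↔ (InQuad z ∧ z.norm = n) ∧ IsCoprime z.re z.im := by
  rw [primReps, Finset.mem_filter, mem_quadReps]

lemma principal_gI_mul (z : GaussianInt) : principal (gI * z) = principal z := by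
  ext w
  rw [mem_principal, mem_principal]
  constructor
  · exact fun h => (Dvd.intro_left _ rfl).trans h
  · rintro ⟨t, rfl⟩
    exact ⟨-(gI * t), by linear_combination (z * t) * gI_mul_gI⟩

lemma principal_neg (z : GaussianInt) : principal (-z) = principal z := by
  ext w
  rw [mem_principal, mem_principal, neg_dvd]

lemma exists_inQuad_principal_eq {z : GaussianInt} (hz : z ≠ 0) :
    ∃ w, InQuad w ∧ principal z = principal w := by
  obtain ⟨w, hw, h⟩ := exists_inQuad hz
  refine ⟨w, hw, ?_⟩
  rcases h with rfl | rfl | rfl | rfl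
  · rfl
  · exact principal_gI_mul w
  · exact principal_neg w
  · rw [principal_neg, principal_gI_mul]

lemma unit_cases {e : GaussianInt} (h : e.norm = 1) : e = 1 ∨ e = gI ∨ e = -1 ∨ e = -gI := by
  rw [norm_eq] at h
  have h1 : e.re ^ 2 ≤ 1 := by nlinarith [sq_nonneg e.im]
  have h2 : e.im ^ 2 ≤ 1 := by nlinarith [sq_nonneg e.re]
  rw [sq_le_one_iff_abs_le_one, abs_le] at h1 h2
  obtain ⟨a, b⟩ := e
  simp only at h h1 h2
  have ha : a = -1 ∨ a = 0 ∨ a = 1 := by omega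
  have hb : b = -1 ∨ b = 0 ∨ b = 1 := by omega
  rcases ha with rfl | rfl | rfl <;> rcases hb with rfl | rfl | rfl <;> norm_num at h <;>
    simp [gI, Zsqrtd.ext_iff]

/-- Multiplication by a unit other than 1 moves a point of the half-open quadrant out of it. -/
lemma InQuad.eq_of_associated {z w : GaussianInt} (hz : InQuad z) (hw : InQuad w)
    (h : Associated z w) : z = w := by
  obtain ⟨e, rfl⟩ := h
  have he : (e : GaussianInt).norm = 1 := by
    rw [Zsqrtd.norm_eq_one_iff' (by norm_num)]; exact e.isUnit
  obtain ⟨h1, h2⟩ := hz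
  obtain ⟨h3, h4⟩ := hw
  rcases unit_cases he with h | h | h | h <;> rw [h] at h3 h4 ⊢ <;> simp at h3 h4 ⊢ <;> omega

lemma InQuad.eq_of_principal_eq {z w : GaussianInt} (hz : InQuad z) (hw : InQuad w)
    (h : principal z = principal w) : z = w := by
  apply hz.eq_of_associated hw
  apply associated_of_dvd_dvd
  · rw [← mem_principal, h, mem_principal]
  · rw [← mem_principal, ← h, mem_principal]

lemma natAbs_norm_eq_iff {z : GaussianInt} {n : ℕ} : z.norm.natAbs = n ↔ z.norm = n := by
  have := GaussianInt.norm_nonneg z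
  omega

lemma setOf_similar_eq (n : ℕ) :
    {Λ : AddSubgroup GaussianInt | Λ.index = n ∧ IsSimilarTo (Λ.map toPlane) squareLattice} =
      principal '' (quadReps n) := by
  ext Λ
  simp only [Set.mem_ofPred_eq, isSimilarTo_iff, Set.mem_image, Finset.mem_coe, mem_quadReps]
  constructor
  · rintro ⟨h1, z, hz, rfl⟩
    obtain ⟨w, hw, h⟩ := exists_inQuad_principal_eq hz
    rw [h, index_principal hw.ne_zero, natAbs_norm_eq_iff] at h1
    exact ⟨w, ⟨hw, h1⟩, h.symm⟩
  · rintro ⟨z, ⟨hz, h⟩, rfl⟩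
    exact ⟨by rw [index_principal hz.ne_zero, natAbs_norm_eq_iff, h], z, hz.ne_zero, rfl⟩

lemma injOn_principal (n : ℕ) : Set.InjOn principal (quadReps n) := by
  intro z hz w hw h
  exact (mem_quadReps.1 hz).1.eq_of_principal_eq (mem_quadReps.1 hw).1 h

lemma sSq_eq_card (n : ℕ) : sSq n = (quadReps n).card := by
  rw [sSq, countSub_eq, setOf_similar_eq n, (injOn_principal n).ncard_image,
    Set.ncard_coe_finset]

lemma sSqPr_eq_card (n : ℕ) : sSqPr n = (primReps n).card := by
  have : {Λ : AddSubgroup GaussianInt | Λ.index = n ∧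
      (IsSimilarTo (Λ.map toPlane) squareLattice ∧ IsPrimitiveIn (Λ.map toPlane) squareLattice)} =
      principal '' (primReps n) := by
    have h := setOf_similar_eq n
    ext Λ
    have h' := Set.ext_iff.1 h Λ
    simp only [Set.mem_ofPred_eq] at h' ⊢
    rw [← and_assoc, h']
    simp only [Set.mem_image, Finset.mem_coe, mem_quadReps, mem_primReps]
    constructor
    · rintro ⟨⟨z, hz, rfl⟩, hp⟩
      exact ⟨z, ⟨hz, (isPrimitiveIn_principal_iff hz.1.ne_zero).1 hp⟩, rfl⟩
    · rintro ⟨z, ⟨hz, hp⟩, rfl⟩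
      exact ⟨⟨z, hz, rfl⟩, (isPrimitiveIn_principal_iff hz.1.ne_zero).2 hp⟩
  have hinj : Set.InjOn principal (primReps n) := (injOn_principal n).mono fun z hz => by
    rw [Finset.mem_coe, primReps] at hz
    exact Finset.mem_of_mem_filter z hz
  rw [sSqPr, countSub_eq, this, hinj.ncard_image, Set.ncard_coe_finset]

/-! ### Rhombic lattices parametrized by their diagonals -/

/-- The lattice of the Gaussian integers `w` with `2 w = s (p z) + t (q i z)`, `s ≡ t mod 2`. -/
def rhomb (z : GaussianInt) (p q : ℤ) : AddSubgroup GaussianInt where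
  carrier := {w | ∃ s t : ℤ, Even (s + t) ∧ 2 * w = z * ⟨s * p, t * q⟩}
  zero_mem' := ⟨0, 0, by simp, by ext <;> simp⟩
  add_mem' := by
    rintro a b ⟨s, t, h1, h2⟩ ⟨s', t', h3, h4⟩
    refine ⟨s + s', t + t', ?_, ?_⟩
    · rw [add_add_add_comm]; exact h1.add h3
    · rw [mul_add, h2, h4]; ext <;> simp <;> ring
  neg_mem' := by
    rintro a ⟨s, t, h1, h2⟩
    refine ⟨-s, -t, ?_, ?_⟩
    · rw [← neg_add]; exact h1.neg
    · rw [mul_neg, h2]; ext <;> simp <;> ring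

lemma mem_rhomb {z w : GaussianInt} {p q : ℤ} :
    w ∈ rhomb z p q ↔ ∃ s t : ℤ, Even (s + t) ∧ 2 * w = z * ⟨s * p, t * q⟩ := Iff.rfl

/-- A quarter turn interchanges the two diagonals. Together with the sign rules below, this allows
`z` to be moved into the quadrant. -/
lemma rhomb_gI_mul (z : GaussianInt) (p q : ℤ) : rhomb (gI * z) p q = rhomb z q p := by
  ext w
  rw [mem_rhomb, mem_rhomb]
  constructor
  · rintro ⟨s, t, h, h2⟩
    refine ⟨-t, s, ?_, ?_⟩
    · have : -t + s = (s + t) + 2 * (-t) := by ring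
      rw [this]; exact h.add (even_two_mul _)
    · rw [h2]; ext <;> simp <;> ring
  · rintro ⟨s, t, h, h2⟩
    refine ⟨t, -s, ?_, ?_⟩
    · have : t + -s = (s + t) + 2 * (-s) := by ring
      rw [this]; exact h.add (even_two_mul _)
    · rw [h2]; ext <;> simp <;> ring

lemma rhomb_neg_right (z : GaussianInt) (p q : ℤ) : rhomb z p (-q) = rhomb z p q := by
  ext w
  rw [mem_rhomb, mem_rhomb]
  constructor
  · rintro ⟨s, t, h, h2⟩
    refine ⟨s, -t, ?_, by rw [h2]; ring_nf⟩
    have : s + -t = (s + t) + 2 * (-t) := by ring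
    rw [this]; exact h.add (even_two_mul _)
  · rintro ⟨s, t, h, h2⟩
    refine ⟨s, -t, ?_, by rw [h2]; ring_nf⟩
    have : s + -t = (s + t) + 2 * (-t) := by ring
    rw [this]; exact h.add (even_two_mul _)

lemma rhomb_neg (z : GaussianInt) (p q : ℤ) : rhomb (-z) p q = rhomb z p q := by
  have : -z = gI * (gI * z) := by rw [← mul_assoc, gI_mul_gI]; ring
  rw [this, rhomb_gI_mul, rhomb_gI_mul]

lemma rhomb_neg_left (z : GaussianInt) (p q : ℤ) : rhomb z (-p) q = rhomb z p q := by
  rw [← rhomb_gI_mul, rhomb_neg_right, rhomb_gI_mul]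

lemma rhomb_natAbs (z : GaussianInt) (p q : ℤ) :
    rhomb z (p.natAbs : ℤ) (q.natAbs : ℤ) = rhomb z p q := by
  rcases Int.natAbs_eq p with hp | hp <;> rcases Int.natAbs_eq q with hq | hq <;>
    · conv_rhs => rw [hp, hq]
      try simp only [rhomb_neg_left, rhomb_neg_right]

/-- The substitution `s = a + b`, `t = a - b` turns the parity condition on `s + t` into integrality
of `a` and `b`. -/
lemma rhomb_eq_closure {z u v : GaussianInt} {p q : ℤ} (hu : 2 * u = z * ⟨p, q⟩)
    (hv : 2 * v = z * ⟨p, -q⟩) : rhomb z p q = AddSubgroup.closure {u, v} := by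
  have h2 : (2 : GaussianInt) ≠ 0 := by norm_num
  ext w
  rw [mem_rhomb, mem_closure_pair]
  constructor
  · rintro ⟨s, t, ⟨a, ha⟩, h⟩
    refine ⟨a, a - t, mul_left_cancel₀ h2 ?_⟩
    have : 2 * (a • u + (a - t) • v) = a • (2 * u) + (a - t) • (2 * v) := by
      simp only [zsmul_eq_mul]; ring
    rw [this, hu, hv, h]
    obtain rfl : s = a + a - t := by omega
    ext <;> simp <;> ring
  · rintro ⟨a, b, rfl⟩
    refine ⟨a + b, a - b, ⟨a, by ring⟩, ?_⟩
    have : 2 * (a • u + b • v) = a • (2 * u) + b • (2 * v) := by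
      simp only [zsmul_eq_mul]; ring
    rw [this, hu, hv]
    ext <;> simp <;> ring

lemma four_mul_dot (u v : GaussianInt) : 4 * dot u v = dot (2 * u) (2 * v) := by
  simp [dot]; ring

lemma four_mul_crs (u v : GaussianInt) : 4 * crs u v = crs (2 * u) (2 * v) := by
  simp [crs]; ring

lemma norm_eq_dot (u : GaussianInt) : u.norm = dot u u := norm_eq u

lemma four_mul_dot_halves {z u v : GaussianInt} {p q : ℤ} (hu : 2 * u = z * ⟨p, q⟩)
    (hv : 2 * v = z * ⟨p, -q⟩) : 4 * dot u v = z.norm * (p ^ 2 - q ^ 2) := by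
  rw [four_mul_dot, hu, hv, dot_mul_left]; simp only [dot]; ring

lemma two_mul_crs_halves {z u v : GaussianInt} {p q : ℤ} (hu : 2 * u = z * ⟨p, q⟩)
    (hv : 2 * v = z * ⟨p, -q⟩) : 2 * crs u v = - (z.norm * (p * q)) := by
  have : 4 * crs u v = - 2 * (z.norm * (p * q)) := by
    rw [four_mul_crs, hu, hv, crs_mul_left]; simp [crs]; ring
  linarith

lemma four_mul_norm_half {z u : GaussianInt} {p q : ℤ} (hu : 2 * u = z * ⟨p, q⟩) :
    4 * u.norm = z.norm * (p ^ 2 + q ^ 2) := by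
  rw [norm_eq_dot u, four_mul_dot, hu, dot_mul_left]; simp only [dot]; ring

/-- Up to the common factor `z.norm / 4`, the inner product is `p² - q²` and the norm is `p² + q²`,
so `2 |dot| ≤ norm` reads `p² ≤ 3 q²` and `q² ≤ 3 p²`. The strict form comes from
`two_mul_abs_dot_lt_of_le`. -/
lemma isReducedBasis_halves_iff {z u v : GaussianInt} {p q : ℤ} (hu : 2 * u = z * ⟨p, q⟩)
    (hv : 2 * v = z * ⟨p, -q⟩) (hz : z ≠ 0) (hp : p ≠ 0) (hq : q ≠ 0) :
    IsReducedBasis (rhomb z p q) u v ↔ p ^ 2 < 3 * q ^ 2 ∧ q ^ 2 < 3 * p ^ 2 := by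
  have hN := GaussianInt.norm_pos.2 hz
  have hc : crs u v ≠ 0 := by
    have := two_mul_crs_halves hu hv
    intro h0
    rw [h0, mul_zero, eq_comm, neg_eq_zero] at this
    exact mul_ne_zero hN.ne' (mul_ne_zero hp hq) this
  have hu' := four_mul_norm_half hu
  have hv' := four_mul_norm_half hv
  have hn : u.norm = v.norm := by
    rw [neg_sq] at hv'; linarith
  have hd := four_mul_dot_halves hu hv
  constructor
  · intro h
    have h1 := two_mul_abs_dot_lt_of_le hc hn h.2.2.1
    have h2 := abs_lt.1 (show |dot u v * 2| < u.norm by rw [abs_mul, abs_two]; linarith)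
    constructor <;> apply lt_of_mul_lt_mul_left _ hN.le <;> linarith
  · rintro ⟨h1, h2⟩
    refine ⟨hc, hn, ?_, rhomb_eq_closure hu hv⟩
    have : |dot u v * 2| ≤ u.norm := by
      rw [abs_le]
      constructor <;> nlinarith
    rw [abs_mul, abs_two] at this; linarith

/-- The conditions on the parameters `z, p, q` of a rhombic well-rounded lattice: the diagonals of
its fundamental rhombus are `p z` and `q i z`. -/
structure IsParam (z : GaussianInt) (p q : ℕ) : Prop where
  inQuad : InQuad z
  coprime : IsCoprime z.re z.im
  ne : p ≠ q
  lt : p ^ 2 < 3 * q ^ 2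
  gt : q ^ 2 < 3 * p ^ 2
  parity : (Even p ∧ Even q) ∨ (Odd p ∧ Odd q ∧ Even z.norm)

lemma IsParam.left_ne_zero {z : GaussianInt} {p q : ℕ} (h : IsParam z p q) : p ≠ 0 := by
  rintro rfl
  have := h.gt
  simp at this

lemma IsParam.right_ne_zero {z : GaussianInt} {p q : ℕ} (h : IsParam z p q) : q ≠ 0 := by
  rintro rfl
  have := h.lt
  simp at this

/-- This decides when the half-diagonal sums `u`, `v` are Gaussian integers. A primitive `z` has a
coordinate that is odd, so only parities of the four coordinates matter. -/
lemma two_dvd_mul_iff {z : GaussianInt} (hz : IsCoprime z.re z.im) (p q : ℤ) :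
    (2 : GaussianInt) ∣ z * ⟨p, q⟩ ↔ (Even p ∧ Even q) ∨ (Odd p ∧ Odd q ∧ Even z.norm) := by
  have hnot : ¬ (Even z.re ∧ Even z.im) := by
    rintro ⟨h1, h2⟩
    have := hz.isUnit_of_dvd' h1.two_dvd h2.two_dvd
    rw [Int.isUnit_iff] at this
    omega
  have h2 : (2 : GaussianInt) = ((2 : ℤ) : GaussianInt) := by norm_num
  rw [h2, Zsqrtd.intCast_dvd, ← even_iff_two_dvd, ← even_iff_two_dvd, norm_eq]
  simp only [Zsqrtd.re_mul, Zsqrtd.im_mul, Int.even_add, Int.even_mul, ← Int.not_even_iff_odd]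
  have : ¬ Even (-1 : ℤ) := by decide
  tauto

lemma IsParam.exists_basis {z : GaussianInt} {p q : ℕ} (h : IsParam z p q) :
    ∃ u v : GaussianInt, 2 * u = z * ⟨p, q⟩ ∧ 2 * v = z * ⟨p, -q⟩ ∧
      IsReducedBasis (rhomb z p q) u v ∧ dot u v ≠ 0 := by
  have hpar : (Even (p : ℤ) ∧ Even (q : ℤ)) ∨ (Odd (p : ℤ) ∧ Odd (q : ℤ) ∧ Even z.norm) := by
    simpa using h.parity
  have hpar' : (Even (p : ℤ) ∧ Even (-q : ℤ)) ∨ (Odd (p : ℤ) ∧ Odd (-q : ℤ) ∧ Even z.norm) := by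
    simpa using h.parity
  obtain ⟨u, hu⟩ := (two_dvd_mul_iff h.coprime p q).2 hpar
  obtain ⟨v, hv⟩ := (two_dvd_mul_iff h.coprime p (-q)).2 hpar'
  refine ⟨u, v, hu.symm, hv.symm, (isReducedBasis_halves_iff hu.symm hv.symm h.inQuad.ne_zero
    (by exact_mod_cast h.left_ne_zero) (by exact_mod_cast h.right_ne_zero)).2
    ⟨by exact_mod_cast h.lt, by exact_mod_cast h.gt⟩, fun h0 => ?_⟩
  have h1 := four_mul_dot_halves hu.symm hv.symm
  rw [h0, mul_zero, eq_comm, mul_eq_zero] at h1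
  have h2 := h1.resolve_left h.inQuad.norm_pos.ne'
  apply h.ne
  have h3 : (p : ℤ) ^ 2 = (q : ℤ) ^ 2 := by linarith
  rw [sq_eq_sq₀ (by positivity) (by positivity)] at h3
  exact_mod_cast h3

lemma IsParam.two_mul_index {z : GaussianInt} {p q : ℕ} (h : IsParam z p q) :
    ((2 * (rhomb z p q).index : ℕ) : ℤ) = p * q * z.norm := by
  obtain ⟨u, v, hu, hv, hr, -⟩ := h.exists_basis
  have h1 := two_mul_crs_halves hu hv
  have h2 : (2 * crs u v).natAbs = 2 * (crs u v).natAbs := by rw [Int.natAbs_mul]; rfl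
  rw [hr.index_eq, ← h2, h1, Int.natAbs_neg, Int.natAbs_of_nonneg]
  · ring
  · have := h.inQuad.norm_pos
    positivity

/-- Since `2 |dot u v| < u.norm` strictly, a combination with both coefficients nonzero is strictly
longer than `u`. Hence a rhombic well-rounded lattice has just four minimal vectors. -/
lemma eq_or_neg_of_norm_eq {u v w : GaussianInt} (hc : crs u v ≠ 0) (hn : u.norm = v.norm)
    (hd : 2 * |dot u v| ≤ u.norm) (hw : w ∈ AddSubgroup.closure {u, v})
    (hw' : w.norm = u.norm) : (w = u ∨ w = -u) ∨ (w = v ∨ w = -v) := by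
  have hlt := two_mul_abs_dot_lt_of_le hc hn hd
  obtain ⟨a, b, rfl⟩ := mem_closure_pair.1 hw
  rw [norm_combination u v a b hn] at hw'
  have hu : 0 < u.norm := GaussianInt.norm_pos.2 (ne_zero_of_crs_left hc)
  have hab : a * b = 0 := by
    by_contra hab
    have h0 : 1 ≤ |a * b| := Int.one_le_abs hab
    have h1 : -(|a * b| * u.norm) < 2 * (a * b) * dot u v := by
      have := neg_abs_le (2 * (a * b) * dot u v)
      rw [abs_mul, abs_mul, abs_two] at this
      nlinarith
    have h4 : 2 * |a * b| ≤ a ^ 2 + b ^ 2 := by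
      rw [abs_mul]
      nlinarith [sq_nonneg (|a| - |b|), sq_abs a, sq_abs b]
    nlinarith
  have hs : a ^ 2 + b ^ 2 = 1 := by
    rw [hab] at hw'
    have : (a ^ 2 + b ^ 2 - 1) * u.norm = 0 := by linarith
    have := (mul_eq_zero.1 this).resolve_right hu.ne'
    linarith
  rcases mul_eq_zero.1 hab with rfl | rfl
  · right
    have : b ^ 2 = 1 := by linarith
    rcases sq_eq_one_iff.1 this with rfl | rfl <;> simp
  · left
    have : a ^ 2 = 1 := by linarith
    rcases sq_eq_one_iff.1 this with rfl | rfl <;> simp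

lemma gcd_natCast_mul {z : GaussianInt} (h : IsCoprime z.re z.im) (p : ℕ) :
    Int.gcd (p * z.re) (p * z.im) = p := by
  rw [Int.gcd_mul_left, Int.isCoprime_iff_gcd_eq_one.1 h]; simp

lemma eq_of_natCast_mul_eq {z z' : GaussianInt} {p p' : ℕ} (hz : IsCoprime z.re z.im)
    (hz' : IsCoprime z'.re z'.im) (hp : p ≠ 0)
    (h : (p' : GaussianInt) * z' = p * z) : z' = z ∧ p' = p := by
  have h1 : (p' : ℤ) * z'.re = p * z.re := by simpa using congrArg Zsqrtd.re h
  have h2 : (p' : ℤ) * z'.im = p * z.im := by simpa using congrArg Zsqrtd.im h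
  have h3 : p' = p := by
    rw [← gcd_natCast_mul hz' p', h1, h2, gcd_natCast_mul hz p]
  subst h3
  have hp' : (p' : ℤ) ≠ 0 := by exact_mod_cast hp
  exact ⟨Zsqrtd.ext (mul_left_cancel₀ hp' h1) (mul_left_cancel₀ hp' h2), rfl⟩

/-- Both reduced bases consist of minimal vectors, and these are `± u`, `± v`. So the diagonal `u' +
v' = p' z'` equals, up to sign, `u + v = p z` or `u - v = q i z`; the quadrant condition selects `p'
z' = p z`. -/
lemma IsParam.unique {z z' : GaussianInt} {p q p' q' : ℕ} (h : IsParam z p q)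
    (h' : IsParam z' p' q') (he : rhomb z' p' q' = rhomb z p q) : z' = z ∧ p' = p ∧ q' = q := by
  obtain ⟨u, v, hu, hv, hr, -⟩ := h.exists_basis
  obtain ⟨u', v', hu', hv', hr', -⟩ := h'.exists_basis
  rw [he] at hr'
  obtain ⟨hc, hn, hd, hΛ⟩ := hr
  obtain ⟨hc', hn', hd', hΛ'⟩ := hr'
  have mem : u ∈ rhomb z p q := hΛ ▸ AddSubgroup.subset_closure (by simp)
  have mem' : u' ∈ rhomb z p q := hΛ' ▸ AddSubgroup.subset_closure (by simp)
  have memv' : v' ∈ rhomb z p q := hΛ' ▸ AddSubgroup.subset_closure (by simp)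
  have hnorm : u'.norm = u.norm := le_antisymm
    (norm_le_of_reduced hn' hd' (hΛ' ▸ mem) (ne_zero_of_crs_left hc))
    (norm_le_of_reduced hn hd (hΛ ▸ mem') (ne_zero_of_crs_left hc'))
  have cu := eq_or_neg_of_norm_eq hc hn hd (hΛ ▸ mem') hnorm
  have cv := eq_or_neg_of_norm_eq hc hn hd (hΛ ▸ memv') (hn'.symm.trans hnorm)
  have hx' : 2 * u' + 2 * v' = 2 * (p' * z') := by rw [hu', hv']; ext <;> simp <;> ring
  have hx : 2 * u + 2 * v = 2 * (p * z) := by rw [hu, hv]; ext <;> simp <;> ring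
  have hy : 2 * u - 2 * v = 2 * (q * (gI * z)) := by rw [hu, hv]; ext <;> simp <;> ring
  have two_ne : (2 : GaussianInt) ≠ 0 := by norm_num
  have key : (p' : GaussianInt) * z' = p * z ∨ (p' : GaussianInt) * z' = -(p * z) ∨
      (p' : GaussianInt) * z' = q * (gI * z) ∨ (p' : GaussianInt) * z' = -(q * (gI * z)) := by
    have e1 : ∀ {a : GaussianInt}, 2 * u' + 2 * v' = 2 * a → (p' : GaussianInt) * z' = a :=
      fun h => mul_left_cancel₀ two_ne (hx'.symm.trans h)
    have c1 : v' ≠ u' := by rintro rfl; apply hc'; simp [crs]; ring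
    have c2 : v' ≠ -u' := by rintro rfl; apply hc'; simp [crs]; ring
    rcases cu with (rfl | rfl) | (rfl | rfl) <;> rcases cv with (rfl | rfl) | (rfl | rfl)
    · exact absurd rfl c1
    · exact absurd rfl c2
    · left; exact e1 hx
    · right; right; left; apply e1; rw [← hy]; ring
    · simp at c2
    · exact absurd rfl c1
    · right; right; right; apply e1; linear_combination -hy
    · right; left; apply e1; linear_combination -hx
    · left; apply e1; rw [← hx]; ring
    · right; right; right; apply e1; linear_combination -hy
    · exact absurd rfl c1
    · exact absurd rfl c2
    · right; right; left; apply e1; rw [← hy]; ring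
    · right; left; apply e1; linear_combination -hx
    · simp at c2
    · exact absurd rfl c1
  have hp : (0 : ℤ) < p := by exact_mod_cast Nat.pos_of_ne_zero h.left_ne_zero
  have hp' : (0 : ℤ) < p' := by exact_mod_cast Nat.pos_of_ne_zero h'.left_ne_zero
  have hq : (0 : ℤ) < q := by exact_mod_cast Nat.pos_of_ne_zero h.right_ne_zero
  obtain ⟨i1, i2⟩ := h.inQuad
  obtain ⟨j1, j2⟩ := h'.inQuad
  have m1 := mul_pos hp i1
  have m2 := mul_nonneg hp.le i2
  have m3 := mul_pos hq i1
  have m4 := mul_nonneg hq.le i2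
  have n1 := mul_pos hp' j1
  have n2 := mul_nonneg hp'.le j2
  -- The point `p' z'` lies in the quadrant, whereas `-p z`, `q i z` and `-q i z` do not. In the
  -- remaining case `p` and `z` are read off from the gcd of the coordinates, and `q` from the
  -- index.
  rcases key with k | k | k | k
  · obtain ⟨rfl, rfl⟩ := eq_of_natCast_mul_eq h.coprime h'.coprime h.left_ne_zero k
    refine ⟨rfl, rfl, ?_⟩
    have i1 := h.two_mul_index
    have i2 := h'.two_mul_index
    rw [he, i1] at i2
    have hN := h.inQuad.norm_pos
    have := mul_right_cancel₀ hN.ne' i2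
    exact_mod_cast (mul_left_cancel₀ hp.ne' this).symm
  · have := congrArg Zsqrtd.re k
    simp at this
    omega
  · have := congrArg Zsqrtd.re k
    simp at this
    omega
  · have := congrArg Zsqrtd.im k
    simp at this
    omega

lemma exists_natCast_mul_primitive {x : GaussianInt} (hx : x ≠ 0) :
    ∃ (p : ℕ) (z : GaussianInt), p ≠ 0 ∧ IsCoprime z.re z.im ∧ x = p * z := by
  have hpos : 0 < Int.gcd x.re x.im := (Zsqrtd.gcd_pos_iff x).2 hx
  obtain ⟨b, h1, h2⟩ := Zsqrtd.exists_coprime_of_gcd_pos hpos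
  exact ⟨_, b, hpos.ne', h2, by simpa using h1⟩

lemma exists_eq_gI_mul_of_dot_eq_zero {z y : GaussianInt} (hz : IsCoprime z.re z.im)
    (h : dot z y = 0) : ∃ q : ℤ, y = q * (gI * z) := by
  obtain ⟨a, b, hab⟩ := hz
  rw [dot] at h
  -- The Bézout relation `a * z.re + b * z.im = 1` recovers the multiplier from the coordinates of
  -- `y = q i z`.
  refine ⟨a * y.im - b * y.re, ?_⟩
  ext
  · simp; linear_combination a * h - y.re * hab
  · simp; linear_combination b * h - y.im * hab

/-- Normalization: a unit moves `z` into the quadrant, with `p` and `q` interchanged when the unit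
is `± i`; signs of `p` and `q` are irrelevant. -/
lemma exists_isParam_of_halves {z u : GaussianInt} {p q : ℤ} (hz : IsCoprime z.re z.im)
    (hz0 : z ≠ 0) (hu : 2 * u = z * ⟨p, q⟩) (hlt : p ^ 2 < 3 * q ^ 2)
    (hgt : q ^ 2 < 3 * p ^ 2) (hne : p ^ 2 ≠ q ^ 2) :
    ∃ (w : GaussianInt) (a b : ℕ), IsParam w a b ∧ rhomb z p q = rhomb w a b := by
  have hpar := (two_dvd_mul_iff hz p q).1 (Dvd.intro _ hu)
  have mk : ∀ w : GaussianInt, InQuad w → IsCoprime w.re w.im → w.norm = z.norm →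
      IsParam w p.natAbs q.natAbs ∧ IsParam w q.natAbs p.natAbs := by
    intro w h1 h2 h3
    have e1 : p.natAbs ≠ q.natAbs := by
      intro h; apply hne; rw [← Int.natAbs_sq p, h, Int.natAbs_sq]
    have e2 : p.natAbs ^ 2 < 3 * q.natAbs ^ 2 := by zify; simpa using hlt
    have e3 : q.natAbs ^ 2 < 3 * p.natAbs ^ 2 := by zify; simpa using hgt
    have e4 : (Even p.natAbs ∧ Even q.natAbs) ∨ (Odd p.natAbs ∧ Odd q.natAbs ∧ Even w.norm) := by
      rw [h3, Int.natAbs_even, Int.natAbs_even, Int.natAbs_odd, Int.natAbs_odd]; exact hpar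
    exact ⟨⟨h1, h2, e1, e2, e3, e4⟩, ⟨h1, h2, e1.symm, e3, e2, by tauto⟩⟩
  obtain ⟨w, hw, hzw⟩ := exists_inQuad hz0
  have hnorm : w.norm = z.norm := by
    rcases hzw with rfl | rfl | rfl | rfl <;> simp only [norm_gI_mul, Zsqrtd.norm_neg]
  have hcop : IsCoprime w.re w.im := by
    rcases hzw with rfl | rfl | rfl | rfl
    · exact hz
    · simpa [IsCoprime.neg_left_iff, IsCoprime.neg_right_iff] using hz.symm
    · simpa [IsCoprime.neg_left_iff, IsCoprime.neg_right_iff] using hz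
    · simpa [IsCoprime.neg_left_iff, IsCoprime.neg_right_iff] using hz.symm
  obtain ⟨m1, m2⟩ := mk w hw hcop hnorm
  rcases hzw with rfl | rfl | rfl | rfl
  · exact ⟨z, _, _, m1, (rhomb_natAbs z p q).symm⟩
  · exact ⟨w, _, _, m2, by rw [rhomb_natAbs, rhomb_gI_mul]⟩
  · exact ⟨w, _, _, m1, by rw [rhomb_natAbs, rhomb_neg]⟩
  · exact ⟨w, _, _, m2, by rw [rhomb_natAbs, rhomb_neg, rhomb_gI_mul]⟩

/-- Write `u + v = p z` with `z` primitive. Equal norms make `u - v` orthogonal to `z`, hence an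
integer multiple `q i z`. -/
lemma isRhombic_and_isWellRounded_iff_param (Λ : AddSubgroup GaussianInt) :
    (IsRhombic (Λ.map toPlane) ∧ IsWellRounded (Λ.map toPlane)) ↔
      ∃ (z : GaussianInt) (p q : ℕ), IsParam z p q ∧ Λ = rhomb z p q := by
  rw [isRhombic_and_isWellRounded_iff]
  constructor
  · rintro ⟨u, v, hr, hd⟩
    obtain ⟨hc, hn, -, hΛ⟩ := id hr
    have hx : u + v ≠ 0 := by
      intro h
      rw [add_eq_zero_iff_eq_neg] at h
      apply hc; rw [h]; simp [crs]; ring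
    obtain ⟨p, z, hp, hz, hpz⟩ := exists_natCast_mul_primitive hx
    have hp' : (p : ℤ) ≠ 0 := by exact_mod_cast hp
    have hz0 : z ≠ 0 := by rintro rfl; simp at hpz; exact hx hpz
    have hdot : dot z (u - v) = 0 := by
      have h1 : dot (u + v) (u - v) = 0 := by
        have : dot (u + v) (u - v) = u.norm - v.norm := by simp [dot, norm_eq]; ring
        rw [this, hn, sub_self]
      have h2 : dot (u + v) (u - v) = p * dot z (u - v) := by rw [hpz]; simp [dot]; ring
      rw [h2] at h1
      exact (mul_eq_zero.1 h1).resolve_left hp'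
    obtain ⟨q, hq⟩ := exists_eq_gI_mul_of_dot_eq_zero hz hdot
    have hu : 2 * u = z * ⟨p, q⟩ := by
      have : 2 * u = (u + v) + (u - v) := by ring
      rw [this, hpz, hq]; ext <;> simp <;> ring
    have hv : 2 * v = z * ⟨p, -q⟩ := by
      have : 2 * v = (u + v) - (u - v) := by ring
      rw [this, hpz, hq]; ext <;> simp <;> ring
    have hq0 : q ≠ 0 := by
      rintro rfl
      have := two_mul_crs_halves hu hv
      apply hc; linarith
    have hne : (p : ℤ) ^ 2 ≠ q ^ 2 := by
      intro h
      have := four_mul_dot_halves hu hv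
      rw [h, sub_self] at this
      apply hd; linarith
    have he : Λ = rhomb z p q := by rw [hΛ, rhomb_eq_closure hu hv]
    rw [he] at hr ⊢
    obtain ⟨hlt, hgt⟩ := (isReducedBasis_halves_iff hu hv hz0 hp' hq0).1 hr
    exact exists_isParam_of_halves hz hz0 hu hlt hgt hne
  · rintro ⟨z, p, q, h, rfl⟩
    obtain ⟨u, v, -, -, hr, hd⟩ := h.exists_basis
    exact ⟨u, v, hr, hd⟩

/-! ### Counting rhombic well-rounded lattices of given index -/

/-- The factorizations `d = p q` with `p < q < √3 p`. -/
def closePairs (d : ℕ) : Finset (ℕ × ℕ) :=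
  d.divisorsAntidiagonal.filter fun x => x.1 < x.2 ∧ x.2 ^ 2 < 3 * x.1 ^ 2

/-- The factorizations `d = p q` with `p ≠ q` and `1 / √3 < p / q < √3`. -/
def symPairs (d : ℕ) : Finset (ℕ × ℕ) :=
  d.divisorsAntidiagonal.filter fun x => x.1 ≠ x.2 ∧ x.1 ^ 2 < 3 * x.2 ^ 2 ∧ x.2 ^ 2 < 3 * x.1 ^ 2

lemma symPairs_eq_union (d : ℕ) :
    symPairs d = closePairs d ∪ (closePairs d).map (Equiv.prodComm ℕ ℕ).toEmbedding := by
  ext ⟨p, q⟩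
  simp only [symPairs, closePairs, Finset.mem_filter, Nat.mem_divisorsAntidiagonal,
    Finset.mem_union, Finset.mem_map_equiv, Equiv.prodComm_symm, Equiv.prodComm_apply,
    Prod.swap_prod_mk, ne_eq]
  constructor
  · rintro ⟨⟨h1, h2⟩, h3, h4, h5⟩
    rcases Nat.lt_or_gt_of_ne h3 with h | h
    · exact Or.inl ⟨⟨h1, h2⟩, h, h5⟩
    · exact Or.inr ⟨⟨by rw [mul_comm, h1], h2⟩, h, h4⟩
  · rintro (⟨⟨h1, h2⟩, h3, h4⟩ | ⟨⟨h1, h2⟩, h3, h4⟩)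
    · refine ⟨⟨h1, h2⟩, h3.ne, ?_, h4⟩
      nlinarith
    · refine ⟨⟨by rw [mul_comm, h1], h2⟩, h3.ne', h4, ?_⟩
      nlinarith

lemma card_symPairs (d : ℕ) : (symPairs d).card = 2 * (closePairs d).card := by
  rw [symPairs_eq_union, Finset.card_union_of_disjoint, Finset.card_map, two_mul]
  rw [Finset.disjoint_left]
  rintro ⟨p, q⟩ h1 h2
  simp only [closePairs, Finset.mem_filter, Finset.mem_map_equiv, Equiv.prodComm_symm,
    Equiv.prodComm_apply, Prod.swap_prod_mk] at h1 h2
  omega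

/-- The sublattices of index `n` which are rhombic and well-rounded. -/
def rhombicSet (n : ℕ) : Set (AddSubgroup GaussianInt) :=
  {Λ | Λ.index = n ∧ (IsRhombic (Λ.map toPlane) ∧ IsWellRounded (Λ.map toPlane))}

lemma mem_rhombicSet_iff {n : ℕ} {Λ : AddSubgroup GaussianInt} :
    Λ ∈ rhombicSet n ↔ ∃ (z : GaussianInt) (p q : ℕ), IsParam z p q ∧ Λ = rhomb z p q ∧
      (p * q : ℤ) * z.norm = 2 * n := by
  rw [rhombicSet, Set.mem_ofPred_eq, isRhombic_and_isWellRounded_iff_param]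
  constructor
  · rintro ⟨h, z, p, q, hp, rfl⟩
    refine ⟨z, p, q, hp, rfl, ?_⟩
    rw [← hp.two_mul_index, h]; push_cast; ring
  · rintro ⟨z, p, q, hp, rfl, h⟩
    refine ⟨?_, z, p, q, hp, rfl⟩
    rw [← hp.two_mul_index] at h
    push_cast at h
    omega

lemma mem_symPairs {d p q : ℕ} : (p, q) ∈ symPairs d ↔
    (p * q = d ∧ d ≠ 0) ∧ p ≠ q ∧ p ^ 2 < 3 * q ^ 2 ∧ q ^ 2 < 3 * p ^ 2 := by
  simp [symPairs]

/-- The parameters of the rhombic well-rounded lattices, with norm `c m` of the primitive vector. -/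
def paramSet (c n : ℕ) : Finset (Σ _ : ℕ × ℕ, (ℕ × ℕ) × GaussianInt) :=
  n.divisorsAntidiagonal.sigma fun x => symPairs x.1 ×ˢ primReps (c * x.2)

lemma mem_paramSet {c n : ℕ} {x : Σ _ : ℕ × ℕ, (ℕ × ℕ) × GaussianInt} :
    x ∈ paramSet c n ↔ (x.1.1 * x.1.2 = n ∧ n ≠ 0) ∧ x.2.1 ∈ symPairs x.1.1 ∧
      x.2.2 ∈ primReps (c * x.1.2) := by
  rw [paramSet, Finset.mem_sigma, Finset.mem_product, Nat.mem_divisorsAntidiagonal]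

lemma card_paramSet (c n : ℕ) : (paramSet c n).card =
    2 * ∑ x ∈ n.divisorsAntidiagonal, (closePairs x.1).card * (primReps (c * x.2)).card := by
  rw [paramSet, Finset.card_sigma, Finset.mul_sum]
  refine Finset.sum_congr rfl fun x _ => ?_
  rw [Finset.card_product, card_symPairs, mul_assoc]

lemma isParam_odd {n : ℕ} (hn : Odd n) {x : Σ _ : ℕ × ℕ, (ℕ × ℕ) × GaussianInt}
    (hx : x ∈ paramSet 2 n) : IsParam x.2.2 x.2.1.1 x.2.1.2 := by
  obtain ⟨⟨d, m⟩, ⟨p, q⟩, z⟩ := x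
  obtain ⟨⟨h1, h2⟩, h3, h4⟩ := mem_paramSet.1 hx
  obtain ⟨⟨rfl, h5⟩, h6, h7, h8⟩ := mem_symPairs.1 h3
  obtain ⟨⟨h9, h10⟩, h11⟩ := mem_primReps.1 h4
  simp only at h1 h10
  refine ⟨h9, h11, h6, h7, h8, Or.inr ?_⟩
  rw [← h1, Nat.odd_mul, Nat.odd_mul] at hn
  refine ⟨hn.1.1, hn.1.2, ?_⟩
  rw [h10]
  push_cast
  exact even_two_mul _

lemma isParam_even {n : ℕ} {x : Σ _ : ℕ × ℕ, (ℕ × ℕ) × GaussianInt}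
    (hx : x ∈ paramSet 1 n) : IsParam x.2.2 (2 * x.2.1.1) (2 * x.2.1.2) := by
  obtain ⟨⟨d, m⟩, ⟨p, q⟩, z⟩ := x
  obtain ⟨⟨h1, h2⟩, h3, h4⟩ := mem_paramSet.1 hx
  obtain ⟨⟨rfl, h5⟩, h6, h7, h8⟩ := mem_symPairs.1 h3
  obtain ⟨⟨h9, h10⟩, h11⟩ := mem_primReps.1 h4
  refine ⟨h9, h11, ?_, ?_, ?_, Or.inl ⟨even_two_mul _, even_two_mul _⟩⟩ <;>
    simp only at h6 h7 h8 ⊢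
  · omega
  · nlinarith
  · nlinarith

/-- A sum of two squares divisible by 4 has both terms even. -/
lemma norm_emod_four_ne_zero {z : GaussianInt} (hz : IsCoprime z.re z.im) : z.norm % 4 ≠ 0 := by
  intro h
  have hnot : ¬ (2 ∣ z.re ∧ 2 ∣ z.im) := by
    rintro ⟨h1, h2⟩
    have := hz.isUnit_of_dvd' h1 h2
    rw [Int.isUnit_iff] at this
    omega
  rw [norm_eq] at h
  have h1 : z.re % 4 = 0 ∨ z.re % 4 = 1 ∨ z.re % 4 = 2 ∨ z.re % 4 = 3 := by omega
  have h2 : z.im % 4 = 0 ∨ z.im % 4 = 1 ∨ z.im % 4 = 2 ∨ z.im % 4 = 3 := by omega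
  rcases h1 with h1 | h1 | h1 | h1 <;> rcases h2 with h2 | h2 | h2 | h2 <;>
    simp [Int.add_emod, Int.mul_emod, h1, h2] at h <;> omega

lemma param_ext {c n : ℕ} {x y : Σ _ : ℕ × ℕ, (ℕ × ℕ) × GaussianInt} (hc : 0 < c)
    (hx : x ∈ paramSet c n) (hy : y ∈ paramSet c n) (h1 : x.2.2 = y.2.2)
    (h2 : x.2.1.1 = y.2.1.1) (h3 : x.2.1.2 = y.2.1.2) : x = y := by
  obtain ⟨⟨d, m⟩, ⟨p, q⟩, z⟩ := x
  obtain ⟨⟨d', m'⟩, ⟨p', q'⟩, z'⟩ := y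
  simp only at h1 h2 h3
  subst h1 h2 h3
  obtain ⟨-, h3, h4⟩ := mem_paramSet.1 hx
  obtain ⟨-, h3', h4'⟩ := mem_paramSet.1 hy
  obtain ⟨⟨rfl, -⟩, -⟩ := mem_symPairs.1 h3
  obtain ⟨⟨rfl, -⟩, -⟩ := mem_symPairs.1 h3'
  have e := (mem_primReps.1 h4).1.2.symm.trans (mem_primReps.1 h4').1.2
  simp only at e
  have e' : c * m = c * m' := by exact_mod_cast e
  obtain rfl := Nat.eq_of_mul_eq_mul_left hc e'
  rfl

/-- In `p q N(z) = 2 n` with `n` odd, `p` and `q` cannot both be even. Hence they are odd and `N(z)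
= 2 m` with `p q m = n`, which is the reason for the factor 2 in the norm. -/
lemma rhombicSet_odd {n : ℕ} (hn : Odd n) :
    rhombicSet n = (fun x : Σ _ : ℕ × ℕ, (ℕ × ℕ) × GaussianInt =>
      rhomb x.2.2 x.2.1.1 x.2.1.2) '' (paramSet 2 n) := by
  ext Λ
  rw [mem_rhombicSet_iff]
  constructor
  · rintro ⟨z, p, q, hp, rfl, h⟩
    have hpar : Odd p ∧ Odd q ∧ Even z.norm := by
      refine hp.parity.resolve_left ?_
      rintro ⟨⟨a, rfl⟩, ⟨b, rfl⟩⟩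
      obtain ⟨k, rfl⟩ := hn
      push_cast at h
      have : 2 * ((a * b : ℤ) * z.norm) = 2 * k + 1 := by linarith
      omega
    obtain ⟨m', hm'⟩ := hpar.2.2
    have hN := hp.inQuad.norm_pos
    obtain ⟨m, rfl⟩ := Int.eq_ofNat_of_zero_le (show 0 ≤ m' by omega)
    have hpq : p * q * m = n := by
      rw [hm'] at h
      have : (p * q * m : ℤ) = n := by linarith
      exact_mod_cast this
    refine ⟨⟨(p * q, m), (p, q), z⟩, ?_, rfl⟩
    rw [Finset.mem_coe, mem_paramSet]
    refine ⟨⟨hpq, hn.pos.ne'⟩, mem_symPairs.2 ⟨⟨rfl, ?_⟩, hp.ne, hp.lt, hp.gt⟩, mem_primReps.2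
      ⟨⟨hp.inQuad, ?_⟩, hp.coprime⟩⟩
    · exact mul_ne_zero hp.left_ne_zero hp.right_ne_zero
    · rw [hm']; push_cast; ring
  · rintro ⟨x, hx, rfl⟩
    refine ⟨_, _, _, isParam_odd hn hx, rfl, ?_⟩
    obtain ⟨⟨d, m⟩, ⟨p, q⟩, z⟩ := x
    obtain ⟨⟨h1, h2⟩, h3, h4⟩ := mem_paramSet.1 hx
    obtain ⟨⟨rfl, h5⟩, -⟩ := mem_symPairs.1 h3
    obtain ⟨⟨h9, h10⟩, h11⟩ := mem_primReps.1 h4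
    simp only at h1 h10 ⊢
    rw [h10, ← h1]
    push_cast; ring

/-- Here `p q N(z) = 4 k`. Odd `p` and `q` would force `4 ∣ N(z)`, impossible for primitive `z`; so
`p = 2 a`, `q = 2 b` and `a b N(z) = k`. -/
lemma rhombicSet_even (k : ℕ) (hk : k ≠ 0) :
    rhombicSet (2 * k) = (fun x : Σ _ : ℕ × ℕ, (ℕ × ℕ) × GaussianInt =>
      rhomb x.2.2 (2 * x.2.1.1 : ℕ) (2 * x.2.1.2 : ℕ)) '' (paramSet 1 k) := by
  ext Λ
  rw [mem_rhombicSet_iff]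
  constructor
  · rintro ⟨z, p, q, hp, rfl, h⟩
    have hpar : Even p ∧ Even q := by
      refine hp.parity.resolve_right ?_
      rintro ⟨⟨a, rfl⟩, ⟨b, rfl⟩, -⟩
      apply norm_emod_four_ne_zero hp.coprime
      push_cast at h
      -- Expanding `(2a + 1)(2b + 1) N(z) = 4 k` shows first that `N(z)` is even and then that it is
      -- divisible by 4.
      have h4 : z.norm = 4 * (k - (a * b) * z.norm) - 2 * ((a + b) * z.norm) := by linarith
      have h5 : Even z.norm := ⟨2 * (k - (a * b) * z.norm) - (a + b) * z.norm, by linarith⟩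
      obtain ⟨c, hc⟩ := h5
      have h6 : z.norm = 4 * (k - (a * b) * z.norm - (a + b) * c) := by
        have : (a + b) * z.norm = 2 * ((a + b) * c) := by rw [hc]; ring
        linarith
      omega
    obtain ⟨⟨a, rfl⟩, ⟨b, rfl⟩⟩ := hpar
    have hN := hp.inQuad.norm_pos
    obtain ⟨m, hm⟩ := Int.eq_ofNat_of_zero_le hN.le
    have ha := hp.left_ne_zero
    have hb := hp.right_ne_zero
    have hlt := hp.lt
    have hgt := hp.gt
    have hne := hp.ne
    have hpq : a * b * m = k := by
      rw [hm] at h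
      push_cast at h
      have : (a * b * m : ℤ) = k := by linarith
      exact_mod_cast this
    refine ⟨⟨(a * b, m), (a, b), z⟩, ?_, by simp only [two_mul]⟩
    rw [Finset.mem_coe, mem_paramSet]
    refine ⟨⟨hpq, hk⟩, mem_symPairs.2 ⟨⟨rfl, ?_⟩, ?_, ?_, ?_⟩, mem_primReps.2
      ⟨⟨hp.inQuad, ?_⟩, hp.coprime⟩⟩
    · exact mul_ne_zero (by omega) (by omega)
    · omega
    · nlinarith
    · nlinarith
    · rw [hm]; push_cast; ring
  · rintro ⟨x, hx, rfl⟩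
    refine ⟨_, _, _, isParam_even hx, rfl, ?_⟩
    obtain ⟨⟨d, m⟩, ⟨p, q⟩, z⟩ := x
    obtain ⟨⟨h1, h2⟩, h3, h4⟩ := mem_paramSet.1 hx
    obtain ⟨⟨rfl, h5⟩, -⟩ := mem_symPairs.1 h3
    obtain ⟨⟨h9, h10⟩, h11⟩ := mem_primReps.1 h4
    simp only at h1 h10 ⊢
    rw [h10, ← h1]
    push_cast; ring

lemma injOn_rhomb_odd {n : ℕ} (hn : Odd n) :
    Set.InjOn (fun x : Σ _ : ℕ × ℕ, (ℕ × ℕ) × GaussianInt => rhomb x.2.2 x.2.1.1 x.2.1.2)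
      (paramSet 2 n) := by
  intro x hx y hy h
  obtain ⟨h1, h2, h3⟩ := (isParam_odd hn hy).unique (isParam_odd hn hx) h
  exact param_ext two_pos hx hy h1 h2 h3

lemma injOn_rhomb_even (k : ℕ) :
    Set.InjOn (fun x : Σ _ : ℕ × ℕ, (ℕ × ℕ) × GaussianInt =>
      rhomb x.2.2 (2 * x.2.1.1 : ℕ) (2 * x.2.1.2 : ℕ)) (paramSet 1 k) := by
  intro x hx y hy h
  obtain ⟨h1, h2, h3⟩ := (isParam_even hy).unique (isParam_even hx) h
  exact param_ext one_pos hx hy h1 (by omega) (by omega)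

lemma finite_rhombicSet {n : ℕ} (hn : n ≠ 0) : (rhombicSet n).Finite := by
  rcases Nat.even_or_odd' n with ⟨k, rfl | rfl⟩
  · rw [rhombicSet_even k (by omega)]
    exact (Finset.finite_toSet _).image _
  · rw [rhombicSet_odd (odd_two_mul_add_one k)]
    exact (Finset.finite_toSet _).image _

lemma countSub_rhombic (n : ℕ) :
    countSub (fun Γ => IsRhombic Γ ∧ IsWellRounded Γ) n = (rhombicSet n).ncard :=
  countSub_eq _ n

lemma ncard_rhombicSet_even {k : ℕ} (hk : k ≠ 0) : (rhombicSet (2 * k)).ncard =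
    2 * ∑ x ∈ k.divisorsAntidiagonal, (closePairs x.1).card * sSqPr x.2 := by
  rw [rhombicSet_even k hk, (injOn_rhomb_even k).ncard_image, Set.ncard_coe_finset, card_paramSet]
  simp only [one_mul, sSqPr_eq_card]

lemma aSq_eq_add {n : ℕ} (hn : n ≠ 0) : aSq n = sSq n + (rhombicSet n).ncard := by
  have hset : {Λ : AddSubgroup GaussianInt | Λ.index = n ∧ IsWellRounded (Λ.map toPlane)} =
      {Λ : AddSubgroup GaussianInt | Λ.index = n ∧ IsSimilarTo (Λ.map toPlane) squareLattice} ∪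
        rhombicSet n := by
    ext Λ
    rw [Set.mem_union, rhombicSet, Set.mem_ofPred_eq, Set.mem_ofPred_eq, Set.mem_ofPred_eq,
      isRhombic_and_isWellRounded_iff, isSimilarTo_iff, isWellRounded_iff]
    constructor
    · rintro ⟨h, u, v, huv⟩
      by_cases hd : dot u v = 0
      · exact Or.inl ⟨h, u, ne_zero_of_crs_left huv.1, huv.eq_principal hd⟩
      · exact Or.inr ⟨h, u, v, huv, hd⟩
    · rintro (⟨h, z, hz, rfl⟩ | ⟨h, u, v, huv, -⟩)
      · exact ⟨h, z, _, isReducedBasis_principal hz⟩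
      · exact ⟨h, u, v, huv⟩
  have hfin : {Λ : AddSubgroup GaussianInt | Λ.index = n ∧
      IsSimilarTo (Λ.map toPlane) squareLattice}.Finite := by
    rw [setOf_similar_eq]
    exact (Finset.finite_toSet _).image _
  rw [aSq, sSq, countSub_eq, countSub_eq, hset, Set.ncard_union_eq _ hfin (finite_rhombicSet hn)]
  rw [Set.disjoint_left]
  rintro Λ ⟨-, h1⟩ ⟨-, h2, -⟩
  obtain ⟨z, hz, rfl⟩ := (isSimilarTo_iff Λ).1 h1
  exact not_isRhombic_principal hz h2

/-! ### Primitive elements of norm `m` and `2 m` -/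

/-- Multiplication by `1 + i`, followed by a unit to return to the quadrant. -/
def timesOneAddI (z : GaussianInt) : GaussianInt :=
  if z.im < z.re then ⟨z.re - z.im, z.re + z.im⟩ else ⟨z.re + z.im, z.im - z.re⟩

/-- The inverse of `timesOneAddI`. -/
def divOneAddI (z : GaussianInt) : GaussianInt :=
  if z.re ≤ z.im then ⟨(z.re + z.im) / 2, (z.im - z.re) / 2⟩
  else ⟨(z.re - z.im) / 2, (z.re + z.im) / 2⟩

/-- A common divisor of `a - b` and `a + b` divides `2 a` and `2 b`; as `a + b` is odd, the factor 2
plays no role. -/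
lemma isCoprime_sub_add {a b : ℤ} (h : IsCoprime a b) (ho : ¬ Even (a + b)) :
    IsCoprime (a - b) (a + b) := by
  have h1 : IsCoprime (a - b) b := by
    have := h.add_mul_right_left (-1)
    rwa [neg_one_mul, ← sub_eq_add_neg] at this
  have h2 : IsCoprime (a - b) 2 := by
    rw [Int.not_even_iff_odd] at ho
    obtain ⟨k, hk⟩ := ho
    exact ⟨1, b - k, by linarith⟩
  have h3 : IsCoprime (a - b) (2 * b) := h2.mul_right h1
  have := h3.add_mul_left_right 1
  rwa [mul_one, show 2 * b + (a - b) = a + b by ring] at this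

lemma isCoprime_of_sub_add {a b : ℤ} (h : IsCoprime (a - b) (a + b)) : IsCoprime a b := by
  obtain ⟨x, y, hxy⟩ := h
  exact ⟨x + y, y - x, by linarith⟩

lemma not_even_re_add_im {z : GaussianInt} (h : Odd z.norm) : ¬ Even (z.re + z.im) := by
  rw [norm_eq, ← Int.not_even_iff_odd] at h
  rw [Int.even_add, Int.even_mul, Int.even_mul] at h
  rw [Int.even_add]
  tauto

/-- Multiplication by `1 + i` doubles the norm; it preserves primitivity because `re + im` is odd
when the norm is odd. Conversely, an element of even norm has coordinates of equal parity and is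
divisible by `1 + i`. The case distinctions in `timesOneAddI` and `divOneAddI` choose the unit that
returns to the quadrant. -/
lemma card_primReps_two_mul {m : ℕ} (hm : Odd m) :
    (primReps (2 * m)).card = (primReps m).card := by
  symm
  have hodd : ∀ z ∈ primReps m, ¬ Even (z.re + z.im) := by
    intro z hz
    apply not_even_re_add_im
    rw [(mem_primReps.1 hz).1.2]
    exact_mod_cast hm
  have hpar : ∀ z ∈ primReps (2 * m), ∃ a b, z.re = a - b ∧ z.im = a + b := by
    intro z hz
    have h := (mem_primReps.1 hz).1.2
    rw [norm_eq] at h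
    have h2 : Even (z.re * z.re + z.im * z.im) := by rw [h]; push_cast; exact even_two_mul _
    rw [Int.even_add, Int.even_mul, Int.even_mul, or_self, or_self] at h2
    obtain ⟨a, ha⟩ := Int.even_add.2 h2
    exact ⟨a, a - z.re, by ring, by linarith⟩
  refine Finset.card_bij' (fun z _ => timesOneAddI z) (fun z _ => divOneAddI z) ?_ ?_ ?_ ?_
  · intro z hz
    have ho := hodd z hz
    obtain ⟨⟨⟨h1, h2⟩, h3⟩, h4⟩ := mem_primReps.1 hz
    rw [norm_eq] at h3
    rw [mem_primReps, timesOneAddI]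
    split_ifs with h
    · refine ⟨⟨⟨by simp; omega, by simp; omega⟩, ?_⟩, isCoprime_sub_add h4 ho⟩
      rw [norm_eq]; push_cast; linarith
    · refine ⟨⟨⟨by simp; omega, by simp; omega⟩, ?_⟩, ?_⟩
      · rw [norm_eq]; push_cast; linarith
      · have := (isCoprime_sub_add h4.symm (by rwa [add_comm])).symm
        rwa [add_comm] at this
  · intro z hz
    obtain ⟨a, b, ha, hb⟩ := hpar z hz
    obtain ⟨⟨⟨h1, h2⟩, h3⟩, h4⟩ := mem_primReps.1 hz
    rw [norm_eq] at h3
    rw [ha] at h1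
    rw [hb] at h2
    rw [ha, hb] at h3 h4
    push_cast at h3
    have h5 : a * a + b * b = m := by linarith
    rw [mem_primReps, divOneAddI, ha, hb]
    have e1 : (a - b + (a + b)) / 2 = a := by omega
    have e2 : (a + b - (a - b)) / 2 = b := by omega
    have e3 : (a - b - (a + b)) / 2 = -b := by omega
    rw [e1, e2, e3]
    have hab : a ≠ 0 ∨ b ≠ 0 := by
      by_contra hcon
      push Not at hcon
      omega
    split_ifs with h
    · have ha0 : 0 < a := by
        omega
      exact ⟨⟨⟨ha0, by simp; omega⟩, by rw [norm_eq]; exact h5⟩, isCoprime_of_sub_add h4⟩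
    · refine ⟨⟨⟨by simp; omega, by simp; omega⟩, by rw [norm_eq]; linarith⟩, ?_⟩
      rw [IsCoprime.neg_left_iff]
      exact (isCoprime_of_sub_add h4).symm
  · intro z hz
    obtain ⟨⟨⟨h1, h2⟩, h3⟩, h4⟩ := mem_primReps.1 hz
    simp only [timesOneAddI, divOneAddI]
    split_ifs <;> ext <;> simp at * <;> omega
  · intro z hz
    obtain ⟨a, b, ha, hb⟩ := hpar z hz
    obtain ⟨⟨⟨h1, h2⟩, h3⟩, h4⟩ := mem_primReps.1 hz
    simp only [timesOneAddI, divOneAddI]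
    split_ifs <;> ext <;> simp at * <;> omega

lemma sSqPr_two_mul {m : ℕ} (hm : Odd m) : sSqPr (2 * m) = sSqPr m := by
  rw [sSqPr_eq_card, sSqPr_eq_card, card_primReps_two_mul hm]

lemma sSqPr_four_mul (m : ℕ) : sSqPr (4 * m) = 0 := by
  rw [sSqPr_eq_card, Finset.card_eq_zero, Finset.eq_empty_iff_forall_notMem]
  intro z hz
  obtain ⟨⟨h1, h2⟩, h3⟩ := mem_primReps.1 hz
  apply norm_emod_four_ne_zero h3
  omega

lemma ncard_rhombicSet_odd {n : ℕ} (hn : Odd n) : (rhombicSet n).ncard =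
    2 * ∑ x ∈ n.divisorsAntidiagonal, (closePairs x.1).card * sSqPr x.2 := by
  rw [rhombicSet_odd hn, (injOn_rhomb_odd hn).ncard_image, Set.ncard_coe_finset, card_paramSet]
  congr 1
  refine Finset.sum_congr rfl fun x hx => ?_
  have hx' := (Nat.mem_divisorsAntidiagonal.1 hx).1
  rw [← hx', Nat.odd_mul] at hn
  rw [sSqPr_eq_card, card_primReps_two_mul hn.2]

/-! ### Ideals of given norm: multiplicativity and prime powers -/

instance : Module.Free ℤ GaussianInt := Module.Free.of_basis gaussBasis

instance : Module.Finite ℤ GaussianInt := Module.Finite.of_basis gaussBasis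

/-- The ideals of norm `n` of a ring. -/
abbrev IdealsOfNorm (R : Type*) [CommRing R] [IsDedekindDomain R] [Module.Free ℤ R] (n : ℕ) : Type _ :=
  {I : Ideal R // Ideal.absNorm I = n}

lemma absNorm_span_gauss (z : GaussianInt) : Ideal.absNorm (Ideal.span {z}) = z.norm.natAbs := by
  by_cases hz : z = 0
  · subst hz; simp
  · rw [← index_principal hz]; rfl

lemma card_idealsOfNorm {n : ℕ} (hn : n ≠ 0) :
    Nat.card (IdealsOfNorm GaussianInt n) = (quadReps n).card := by
  rw [← Set.ncard_coe_finset, ← Nat.card_coe_set_eq]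
  symm
  refine Nat.card_congr (Equiv.ofBijective (fun z => ⟨Ideal.span {z.1}, ?_⟩) ⟨?_, ?_⟩)
  · rw [absNorm_span_gauss, natAbs_norm_eq_iff]
    exact (mem_quadReps.1 z.2).2
  · rintro ⟨z, hz⟩ ⟨w, hw⟩ h
    simp only [Subtype.mk.injEq] at h ⊢
    apply injOn_principal n hz hw
    rw [principal, h]; rfl
  · rintro ⟨I, hI⟩
    obtain ⟨z, rfl⟩ := (IsPrincipalIdealRing.principal I).principal
    have hz : z ≠ 0 := by
      rintro rfl
      rw [Ideal.submodule_span_eq, absNorm_span_gauss] at hI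
      simp at hI
      exact hn hI.symm
    obtain ⟨w, hw, h⟩ := exists_inQuad_principal_eq hz
    have h' : (Ideal.span {w} : Ideal GaussianInt) = Ideal.span {z} :=
      Submodule.toAddSubgroup_injective h.symm
    refine ⟨⟨w, mem_quadReps.2 ⟨hw, ?_⟩⟩, Subtype.ext h'⟩
    rw [Ideal.submodule_span_eq, ← h', absNorm_span_gauss, natAbs_norm_eq_iff] at hI
    exact hI

section ideals

variable {R : Type*} [CommRing R]

lemma span_natCast_sup_eq_top {m n : ℕ} (h : m.Coprime n) {I J : Ideal R} (hI : (m : R) ∈ I)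
    (hJ : (n : R) ∈ J) : I ⊔ J = ⊤ := by
  rw [Ideal.eq_top_iff_one]
  obtain ⟨a, b, hab⟩ := Nat.isCoprime_iff_coprime.2 h
  have : (1 : R) = a * m + b * n := by
    have := congrArg (Int.cast : ℤ → R) hab
    push_cast at this
    exact this.symm
  rw [this]
  exact Ideal.add_mem _ (Ideal.mem_sup_left (I.mul_mem_left _ hI))
    (Ideal.mem_sup_right (J.mul_mem_left _ hJ))

/-- The ideals `J` and `(m)` are comaximal, so `I = I (J + (m))`, which lies in `I J + (m)`. -/
lemma mul_sup_span_eq {m n : ℕ} (h : m.Coprime n) {I J : Ideal R} (hI : (m : R) ∈ I)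
    (hJ : (n : R) ∈ J) : I * J ⊔ Ideal.span {(m : R)} = I := by
  apply le_antisymm
  · exact sup_le Ideal.mul_le_left ((Ideal.span_singleton_le_iff_mem _).2 hI)
  · have htop := span_natCast_sup_eq_top h (Ideal.mem_span_singleton_self (m : R)) hJ
    calc I = I * (Ideal.span {(m : R)} ⊔ J) := by rw [htop, Ideal.mul_top]
      _ = I * Ideal.span {(m : R)} ⊔ I * J := Ideal.mul_sup I _ _
      _ ≤ I * J ⊔ Ideal.span {(m : R)} :=
        sup_le (Ideal.mul_le_right.trans le_sup_right) le_sup_left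

/-- The product lies in `K` because `m n` does, and it contains `K (m) + K (n) = K` because `(m)`
and `(n)` are comaximal. -/
lemma sup_span_mul_sup_span {m n : ℕ} (h : m.Coprime n) {K : Ideal R} (hK : ((m * n : ℕ) : R) ∈ K) :
    (K ⊔ Ideal.span {(m : R)}) * (K ⊔ Ideal.span {(n : R)}) = K := by
  have htop := span_natCast_sup_eq_top h (Ideal.mem_span_singleton_self (m : R))
    (Ideal.mem_span_singleton_self (n : R))
  apply le_antisymm
  · rw [Ideal.sup_mul]
    refine sup_le Ideal.mul_le_left ?_
    rw [Ideal.mul_sup]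
    refine sup_le Ideal.mul_le_right ?_
    rw [Ideal.span_singleton_mul_span_singleton, Ideal.span_singleton_le_iff_mem]
    exact_mod_cast hK
  · calc K = K * (Ideal.span {(m : R)} ⊔ Ideal.span {(n : R)}) := by rw [htop, Ideal.mul_top]
      _ = Ideal.span {(m : R)} * K ⊔ K * Ideal.span {(n : R)} := by
        rw [Ideal.mul_sup, mul_comm K]
      _ ≤ _ := sup_le (Ideal.mul_mono le_sup_right le_sup_left)
        (Ideal.mul_mono le_sup_left le_sup_right)

variable [IsDedekindDomain R] [Module.Free ℤ R] [Module.Finite ℤ R]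

lemma absNorm_span_natCast (m : ℕ) :
    Ideal.absNorm (Ideal.span {(m : R)}) = m ^ Module.finrank ℤ R := by
  rw [Ideal.absNorm_span_singleton]
  have : (m : R) = algebraMap ℤ R m := by simp
  rw [this, Algebra.norm_algebraMap]
  simp [Int.natAbs_pow]

/-- This norm divides a power of `m`, hence is coprime to `n`; it also divides the norm `m n` of
`K`. -/
lemma absNorm_sup_span {m n : ℕ} (h : m.Coprime n) {K : Ideal R}
    (hK : Ideal.absNorm K = m * n) :
    Ideal.absNorm (K ⊔ Ideal.span {(m : R)}) ∣ m := by
  have hdvd : Ideal.absNorm (K ⊔ Ideal.span {(m : R)}) ∣ m ^ Module.finrank ℤ R := by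
    rw [← absNorm_span_natCast (R := R)]
    exact Ideal.absNorm_dvd_absNorm_of_le le_sup_right
  have hcop : (Ideal.absNorm (K ⊔ Ideal.span {(m : R)})).Coprime n :=
    Nat.Coprime.coprime_dvd_left hdvd (Nat.Coprime.pow_left _ h)
  apply hcop.dvd_of_dvd_mul_right
  rw [← hK]
  exact Ideal.absNorm_dvd_absNorm_of_le le_sup_left

/-- Ideals of norm `m n` with `m`, `n` coprime factor uniquely into ideals of norm `m` and `n`. -/
def idealsOfNormMulEquiv {m n : ℕ} (h : m.Coprime n) (hm : m ≠ 0) (hn : n ≠ 0) :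
    IdealsOfNorm R m × IdealsOfNorm R n ≃ IdealsOfNorm R (m * n) where
  toFun x := ⟨x.1.1 * x.2.1, by rw [map_mul, x.1.2, x.2.2]⟩
  invFun K := by
    have hK : ((m * n : ℕ) : R) ∈ K.1 := by
      have := Ideal.absNorm_mem K.1
      rwa [K.2] at this
    have hprod : Ideal.absNorm (K.1 ⊔ Ideal.span {(m : R)}) *
        Ideal.absNorm (K.1 ⊔ Ideal.span {(n : R)}) = m * n := by
      rw [← map_mul, sup_span_mul_sup_span h hK, K.2]
    have h1 := absNorm_sup_span h K.2
    have h2 := absNorm_sup_span h.symm (K.2.trans (mul_comm _ _))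
    have l1 := Nat.le_of_dvd (Nat.pos_of_ne_zero hm) h1
    have l2 := Nat.le_of_dvd (Nat.pos_of_ne_zero hn) h2
    have hm' := Nat.pos_of_ne_zero hm
    have hn' := Nat.pos_of_ne_zero hn
    -- The two norms are at most `m` and `n` and have product `m n`, so both are equalities.
    exact ⟨⟨K.1 ⊔ Ideal.span {(m : R)}, by nlinarith⟩, ⟨K.1 ⊔ Ideal.span {(n : R)}, by nlinarith⟩⟩
  left_inv := by
    rintro ⟨⟨I, hI⟩, ⟨J, hJ⟩⟩
    have hI' : (m : R) ∈ I := hI ▸ Ideal.absNorm_mem I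
    have hJ' : (n : R) ∈ J := hJ ▸ Ideal.absNorm_mem J
    simp only [Prod.mk.injEq, Subtype.mk.injEq]
    exact ⟨mul_sup_span_eq h hI' hJ', by rw [mul_comm I J]; exact mul_sup_span_eq h.symm hJ' hI'⟩
  right_inv := by
    rintro ⟨K, hK⟩
    have hK' : ((m * n : ℕ) : R) ∈ K := by rw [← hK]; exact Ideal.absNorm_mem _
    exact Subtype.ext (sup_span_mul_sup_span h hK')

end ideals

lemma sSq_eq_card_ideals {n : ℕ} (hn : n ≠ 0) : sSq n = Nat.card (IdealsOfNorm GaussianInt n) := by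
  rw [card_idealsOfNorm hn, sSq_eq_card]

lemma sSq_mul {m n : ℕ} (h : m.Coprime n) (hm : m ≠ 0) (hn : n ≠ 0) :
    sSq (m * n) = sSq m * sSq n := by
  rw [sSq_eq_card_ideals hm, sSq_eq_card_ideals hn, sSq_eq_card_ideals (mul_ne_zero hm hn),
    ← Nat.card_prod]
  exact (Nat.card_congr (idealsOfNormMulEquiv h hm hn)).symm

lemma sSq_zero : sSq 0 = 0 := by
  rw [sSq_eq_card, Finset.card_eq_zero, Finset.eq_empty_iff_forall_notMem]
  intro z hz
  have := mem_quadReps.1 hz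
  have h := this.1.norm_pos
  rw [this.2] at h
  simp at h

lemma sSq_one : sSq 1 = 1 := by
  rw [sSq_eq_card_ideals one_ne_zero, Nat.card_eq_one_iff_unique]
  refine ⟨⟨?_⟩, ⟨⟨⊤, Ideal.absNorm_top⟩⟩⟩
  rintro ⟨I, hI⟩ ⟨J, hJ⟩
  rw [Ideal.absNorm_eq_one_iff] at hI hJ
  simp [hI, hJ]

/-- The quotient of a prime-power count: representatives up to units. -/
lemma sSq_eq_of_forall_associated {ι : Type*} {n : ℕ} (hn : n ≠ 0) (s : Finset ι)
    (f : ι → GaussianInt) (hf : ∀ i ∈ s, (f i).norm = n)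
    (hinj : ∀ i ∈ s, ∀ j ∈ s, Associated (f i) (f j) → i = j)
    (hsurj : ∀ z : GaussianInt, z.norm = n → ∃ i ∈ s, Associated (f i) z) :
    sSq n = s.card := by
  have hs : s.card = Nat.card s := by simp
  rw [sSq_eq_card_ideals hn, hs]
  symm
  refine Nat.card_congr (Equiv.ofBijective (fun i => ⟨Ideal.span {f i.1}, ?_⟩) ⟨?_, ?_⟩)
  · rw [absNorm_span_gauss, natAbs_norm_eq_iff, hf i.1 i.2]
  · rintro ⟨i, hi⟩ ⟨j, hj⟩ h
    simp only [Subtype.mk.injEq] at h ⊢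
    exact hinj i hi j hj (Ideal.span_singleton_eq_span_singleton.1 h)
  · rintro ⟨I, hI⟩
    obtain ⟨z, rfl⟩ := (IsPrincipalIdealRing.principal I).principal
    rw [Ideal.submodule_span_eq, absNorm_span_gauss, natAbs_norm_eq_iff] at hI
    obtain ⟨i, hi, h⟩ := hsurj z hI
    exact ⟨⟨i, hi⟩, Subtype.ext (Ideal.span_singleton_eq_span_singleton.2 h)⟩

lemma prime_of_norm_prime {z : GaussianInt} {p : ℕ} (hp : p.Prime) (h : z.norm = p) : Prime z := by
  rw [← irreducible_iff_prime]
  refine ⟨fun hu => ?_, fun a b hab => ?_⟩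
  · rw [← Zsqrtd.norm_eq_one_iff, h, Int.natAbs_natCast] at hu
    exact hp.one_lt.ne' hu
  · have h1 : a.norm.natAbs * b.norm.natAbs = p := by
      rw [← Int.natAbs_mul, ← Zsqrtd.norm_mul, ← hab, h, Int.natAbs_natCast]
    rw [← Zsqrtd.norm_eq_one_iff, ← Zsqrtd.norm_eq_one_iff]
    rcases (Nat.dvd_prime hp).1 (Dvd.intro _ h1) with h2 | h2
    · exact Or.inl h2
    · right
      rw [h2] at h1
      exact Nat.eq_of_mul_eq_mul_left hp.pos (by rw [h1, mul_one])

lemma exists_norm_eq_prime {p : ℕ} (hp : p.Prime) (h : p % 4 ≠ 3) :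
    ∃ z : GaussianInt, z.norm = p := by
  have := Fact.mk hp
  obtain ⟨a, b, hab⟩ := Nat.Prime.sq_add_sq h
  refine ⟨⟨a, b⟩, ?_⟩
  rw [norm_eq, ← hab]; push_cast; ring

lemma mul_star_eq_of_norm {z : GaussianInt} {n : ℕ} (h : z.norm = n) :
    z * star z = (n : GaussianInt) := by
  rw [← Zsqrtd.norm_eq_mul_conj, h]; simp

/-- An element of norm `p ^ k`, with `p` the norm of `π`, is a product of powers of `π` and
its conjugate, up to units. -/
lemma exists_associated_of_norm_eq_pow {π : GaussianInt} {p : ℕ} (hp : p.Prime) (hπ : π.norm = p)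
    (k : ℕ) : ∀ z : GaussianInt, z.norm = (p ^ k : ℕ) →
      ∃ x ∈ Finset.HasAntidiagonal.antidiagonal k, Associated (π ^ x.1 * star π ^ x.2) z := by
  have hprime := prime_of_norm_prime hp hπ
  induction k with
  | zero =>
    intro z hz
    refine ⟨(0, 0), by simp, ?_⟩
    rw [pow_zero, Nat.cast_one, Zsqrtd.norm_eq_one_iff' (by norm_num)] at hz
    simpa using (associated_one_iff_isUnit.2 hz).symm
  | succ k ih =>
    intro z hz
    -- The prime `π` divides `z * star z = p ^ (k + 1)`, so `π` divides `z` or, after conjugation,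
    -- `star π` does.
    have hdvd : π ∣ z * star z := by
      rw [mul_star_eq_of_norm hz, pow_succ, Nat.cast_mul, ← mul_star_eq_of_norm hπ]
      exact (Dvd.intro _ rfl).mul_left _
    have hp0 : (p : ℤ) ≠ 0 := by exact_mod_cast hp.ne_zero
    have hnorm : ∀ {a w : GaussianInt}, a.norm = p → z = a * w → w.norm = (p ^ k : ℕ) := by
      intro a w ha hw
      rw [hw, Zsqrtd.norm_mul, ha, pow_succ, mul_comm (p ^ k), Nat.cast_mul] at hz
      exact mul_left_cancel₀ hp0 hz
    rcases hprime.dvd_or_dvd hdvd with ⟨w, hw⟩ | ⟨w, hw⟩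
    · obtain ⟨⟨a, b⟩, hx, h⟩ := ih w (hnorm hπ hw)
      rw [Finset.HasAntidiagonal.mem_antidiagonal] at hx
      refine ⟨(a + 1, b), by rw [Finset.HasAntidiagonal.mem_antidiagonal]; simp only at hx ⊢; omega, ?_⟩
      rw [hw]
      have := h.mul_left π
      rwa [← mul_assoc, ← pow_succ'] at this
    · have hw' : z = star π * star w := by
        rw [← star_star z, hw, star_mul, mul_comm]
      obtain ⟨⟨a, b⟩, hx, h⟩ := ih (star w) (hnorm (by rw [Zsqrtd.norm_conj, hπ]) hw')
      rw [Finset.HasAntidiagonal.mem_antidiagonal] at hx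
      refine ⟨(a, b + 1), by rw [Finset.HasAntidiagonal.mem_antidiagonal]; simp only at hx ⊢; omega, ?_⟩
      rw [hw']
      have := h.mul_left (star π)
      rwa [mul_left_comm, ← pow_succ'] at this

lemma norm_pow_mul_pow {π : GaussianInt} {p : ℕ} (hπ : π.norm = p) (a b : ℕ) :
    (π ^ a * star π ^ b).norm = (p ^ (a + b) : ℕ) := by
  have h1 : ∀ (w : GaussianInt) (n : ℕ), (w ^ n).norm = w.norm ^ n := fun w n =>
    map_pow Zsqrtd.normMonoidHom w n
  rw [Zsqrtd.norm_mul, h1, h1, Zsqrtd.norm_conj, hπ, pow_add]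
  push_cast; ring

/-- Otherwise `π` divides its trace `2 π.re`. Taking norms, `p` divides `π.re`, hence also `π.im`,
and then `p ^ 2` divides `π.norm = p`. -/
lemma not_dvd_star {π : GaussianInt} {p : ℕ} (hp : p.Prime) (hp2 : p ≠ 2) (hπ : π.norm = p) :
    ¬ π ∣ star π := by
  intro h
  have h1 : π ∣ ((2 * π.re : ℤ) : GaussianInt) := by
    have : ((2 * π.re : ℤ) : GaussianInt) = π + star π := by ext <;> simp; ring
    rw [this]; exact dvd_add dvd_rfl h
  obtain ⟨t, ht⟩ := h1
  have h2 := congrArg Zsqrtd.norm ht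
  rw [Zsqrtd.norm_intCast, Zsqrtd.norm_mul, hπ] at h2
  have hpp : Prime (p : ℤ) := Nat.prime_iff_prime_int.1 hp
  have h3 : (p : ℤ) ∣ 2 * π.re := by
    rcases hpp.dvd_or_dvd (Dvd.intro _ h2.symm) with h | h <;> exact h
  have h4 : (p : ℤ) ∣ π.re := by
    rcases hpp.dvd_or_dvd h3 with h | h
    · exfalso
      have : p ∣ 2 := by exact_mod_cast h
      exact hp2 ((Nat.prime_dvd_prime_iff_eq hp Nat.prime_two).1 this)
    · exact h
  have hn : π.re * π.re + π.im * π.im = p := by rw [← norm_eq, hπ]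
  have h5 : (p : ℤ) ∣ π.im := by
    have : (p : ℤ) ∣ π.im * π.im := by
      have e : π.im * π.im = p - π.re * π.re := by linarith
      rw [e]; exact dvd_sub dvd_rfl (h4.mul_right _)
    rcases hpp.dvd_or_dvd this with h | h <;> exact h
  have h6 : (p * p : ℤ) ∣ p := by
    have := dvd_add (mul_dvd_mul h4 h4) (mul_dvd_mul h5 h5)
    rwa [hn] at this
  have h7 : p * p ∣ p := by exact_mod_cast h6
  have := Nat.le_of_dvd hp.pos h7
  have := hp.two_le
  nlinarith

/-- The classes are `π ^ a * star π ^ b` with `a + b = k`. They are distinct: cancelling the common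
power of `π` in an association would leave `π` dividing a power of `star π`. -/
lemma sSq_prime_pow_one_mod_four {p : ℕ} (hp : p.Prime) (h : p % 4 = 1) (k : ℕ) :
    sSq (p ^ k) = k + 1 := by
  obtain ⟨π, hπ⟩ := exists_norm_eq_prime hp (by omega)
  have hprime := prime_of_norm_prime hp hπ
  have hnd := not_dvd_star hp (by rintro rfl; omega) hπ
  rw [← Finset.Nat.card_antidiagonal k]
  refine sSq_eq_of_forall_associated (pow_ne_zero k hp.ne_zero) _
    (fun x => π ^ x.1 * star π ^ x.2) ?_ ?_ (exists_associated_of_norm_eq_pow hp hπ k)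
  · intro x hx
    rw [norm_pow_mul_pow hπ, Finset.HasAntidiagonal.mem_antidiagonal.1 hx]
  · have key : ∀ a b a' b' : ℕ, a' < a → ¬ Associated (π ^ a * star π ^ b)
        (π ^ a' * star π ^ b') := by
      intro a b a' b' hlt hass
      obtain ⟨c, rfl⟩ := Nat.exists_eq_add_of_lt hlt
      rw [show a' + c + 1 = a' + (c + 1) by ring, pow_add, mul_assoc] at hass
      have h1 := hass.of_mul_left (Associated.refl _) (pow_ne_zero _ hprime.ne_zero)
      apply hnd
      apply hprime.dvd_of_dvd_pow (n := b')
      refine dvd_trans ?_ h1.dvd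
      rw [pow_succ', mul_assoc]
      exact Dvd.intro _ rfl
    rintro ⟨a, b⟩ hx ⟨a', b'⟩ hy hass
    rw [Finset.HasAntidiagonal.mem_antidiagonal] at hx hy
    simp only at hx hy hass
    rcases lt_trichotomy a a' with h | h | h
    · exact absurd hass.symm (key _ _ _ _ h)
    · rw [Prod.mk.injEq]; omega
    · exact absurd hass (key _ _ _ _ h)

/-- The prime `1 + i` is associated to its conjugate, so all products of given length coincide up to
units. -/
lemma sSq_two_pow (k : ℕ) : sSq (2 ^ k) = 1 := by
  obtain ⟨π, hπ⟩ : ∃ π : GaussianInt, π = ⟨1, 1⟩ := ⟨_, rfl⟩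
  have hn : π.norm = (2 : ℕ) := by rw [hπ, norm_eq]; norm_num
  have hass : Associated (star π) π := by
    refine ⟨⟨gI, -gI, ?_, ?_⟩, ?_⟩
    · rw [mul_neg, gI_mul_gI]; ring
    · rw [neg_mul, gI_mul_gI]; ring
    · rw [hπ]; ext <;> simp
  rw [← Finset.card_singleton k]
  refine sSq_eq_of_forall_associated (pow_ne_zero k two_ne_zero) _ (fun i => π ^ i) ?_ ?_ ?_
  · intro i hi
    have := norm_pow_mul_pow hn i 0
    rw [Finset.mem_singleton] at hi
    simpa [hi] using this
  · intro i hi j hj _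
    rw [Finset.mem_singleton] at hi hj
    rw [hi, hj]
  · intro z hz
    obtain ⟨⟨a, b⟩, hx, h⟩ := exists_associated_of_norm_eq_pow Nat.prime_two hn k z hz
    refine ⟨k, Finset.mem_singleton_self k, ?_⟩
    rw [Finset.HasAntidiagonal.mem_antidiagonal] at hx
    simp only at hx h
    rw [← hx, pow_add]
    exact ((Associated.refl (π ^ a)).mul_mul (hass.pow_pow).symm).trans h

/-- An inert `p` stays prime and equals its conjugate, so it divides `z`; each division lowers the
exponent of the norm by two. -/
lemma exists_associated_of_norm_eq_inert_pow {p : ℕ} (hp : p.Prime) (h : p % 4 = 3)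
    (k : ℕ) : ∀ z : GaussianInt, z.norm = (p ^ k : ℕ) →
      Even k ∧ Associated ((p : GaussianInt) ^ (k / 2)) z := by
  have := Fact.mk hp
  have hprime : Prime (p : GaussianInt) := GaussianInt.prime_of_nat_prime_of_mod_four_eq_three p h
  have hp0 : (p : ℤ) ≠ 0 := by exact_mod_cast hp.ne_zero
  induction k using Nat.strong_induction_on with
  | _ k ih =>
    intro z hz
    rcases Nat.eq_zero_or_pos k with rfl | hk
    · rw [pow_zero, Nat.cast_one, Zsqrtd.norm_eq_one_iff' (by norm_num)] at hz
      simpa using (associated_one_iff_isUnit.2 hz).symm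
    · obtain ⟨j, rfl⟩ := Nat.exists_eq_succ_of_ne_zero hk.ne'
      have hdvd : (p : GaussianInt) ∣ z * star z := by
        rw [mul_star_eq_of_norm hz, pow_succ, Nat.cast_mul]
        exact Dvd.intro_left _ rfl
      have hz' : ∃ w, z = p * w := by
        rcases hprime.dvd_or_dvd hdvd with h | ⟨w, hw⟩
        · exact h
        · refine ⟨star w, ?_⟩
          rw [← star_star z, hw, star_mul, star_natCast, mul_comm]
      obtain ⟨w, rfl⟩ := hz'
      rw [Zsqrtd.norm_mul, Zsqrtd.norm_natCast, Nat.succ_eq_add_one, pow_succ, mul_comm (p ^ j),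
        Nat.cast_mul, mul_assoc] at hz
      have hz1 := mul_left_cancel₀ hp0 hz
      have hj : j ≠ 0 := by
        rintro rfl
        have : (p : ℤ) ∣ 1 := Dvd.intro _ (by simpa using hz1)
        have h1 : p ∣ 1 := by exact_mod_cast this
        exact hp.one_lt.ne' (Nat.dvd_one.1 h1)
      obtain ⟨i, rfl⟩ := Nat.exists_eq_succ_of_ne_zero hj
      rw [Nat.succ_eq_add_one, pow_succ, mul_comm (p ^ i), Nat.cast_mul] at hz1
      obtain ⟨h1, h2⟩ := ih i (by omega) w (mul_left_cancel₀ hp0 hz1)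
      refine ⟨by simpa [Nat.even_add_one] using h1, ?_⟩
      rw [show (i.succ + 1) / 2 = i / 2 + 1 by omega, pow_succ']
      exact h2.mul_left _

lemma sSq_prime_pow_three_mod_four {p : ℕ} (hp : p.Prime) (h : p % 4 = 3) (k : ℕ) :
    sSq (p ^ k) = if Even k then 1 else 0 := by
  have key := exists_associated_of_norm_eq_inert_pow hp h k
  split_ifs with hk
  · rw [← Finset.card_singleton k]
    refine sSq_eq_of_forall_associated (pow_ne_zero k hp.ne_zero) _
      (fun i => (p : GaussianInt) ^ (i / 2)) ?_ ?_ ?_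
    · intro i hi
      rw [Finset.mem_singleton.1 hi, ← Nat.cast_pow, Zsqrtd.norm_natCast]
      obtain ⟨j, rfl⟩ := hk
      rw [← two_mul, Nat.mul_div_cancel_left _ two_pos, two_mul, pow_add]
      push_cast; ring
    · intro i hi j hj _
      rw [Finset.mem_singleton.1 hi, Finset.mem_singleton.1 hj]
    · intro z hz
      exact ⟨k, Finset.mem_singleton_self k, (key z hz).2⟩
  · rw [← Finset.card_empty (α := ℕ)]
    refine sSq_eq_of_forall_associated (pow_ne_zero k hp.ne_zero) _
      (fun i => (p : GaussianInt) ^ (i / 2)) ?_ ?_ ?_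
    · simp
    · simp
    · intro z hz
      exact absurd (key z hz).1 hk

/-- The arithmetic function counting the similar sublattices. -/
def sSqArith : ArithmeticFunction ℤ := ⟨fun n => sSq n, by simp [sSq_zero]⟩

/-- The nontrivial character modulo `4` as an arithmetic function. -/
def chiArith : ArithmeticFunction ℤ := ⟨fun n => ZMod.χ₄ n, by simp⟩

lemma sSqArith_isMultiplicative : sSqArith.IsMultiplicative := by
  rw [ArithmeticFunction.IsMultiplicative.iff_ne_zero]
  refine ⟨by simp [sSqArith, sSq_one], ?_⟩
  intro m n hm hn h
  simp [sSqArith, sSq_mul h hm hn]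

lemma chiArith_isMultiplicative : chiArith.IsMultiplicative := by
  refine ⟨by simp [chiArith], ?_⟩
  intro m n _
  simp only [chiArith, ArithmeticFunction.coe_mk, Nat.cast_mul, map_mul]

/-- Both sides are multiplicative, so prime powers suffice. The sum of `χ₄` over the divisors of `p
^ k` is `1`, `k + 1`, or an alternating sum of signs, for `p = 2`, `p ≡ 1` and `p ≡ 3` modulo 4. -/
lemma sSqArith_eq : sSqArith = (ArithmeticFunction.zeta : ArithmeticFunction ℤ) * chiArith := by
  rw [ArithmeticFunction.IsMultiplicative.eq_iff_eq_on_prime_powers _ sSqArith_isMultiplicative _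
    (ArithmeticFunction.isMultiplicative_zeta.natCast.mul chiArith_isMultiplicative)]
  intro p k hp
  rw [ArithmeticFunction.coe_zeta_mul_apply, Nat.sum_divisors_prime_pow hp]
  simp only [sSqArith, chiArith, ArithmeticFunction.coe_mk, Nat.cast_pow, map_pow]
  have hcases : p = 2 ∨ p % 4 = 1 ∨ p % 4 = 3 := by
    rcases hp.eq_two_or_odd with h | h
    · exact Or.inl h
    · omega
  rcases hcases with rfl | h | h
  · rw [sSq_two_pow]
    have : ZMod.χ₄ ((2 : ℕ) : ZMod 4) = 0 := by decide
    rw [this, Finset.sum_range_succ']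
    simp
  · rw [sSq_prime_pow_one_mod_four hp h, ZMod.χ₄_nat_one_mod_four h]
    simp
  · rw [sSq_prime_pow_three_mod_four hp h, ZMod.χ₄_nat_three_mod_four h]
    rw [neg_one_geom_sum]
    by_cases hk : Even k <;> simp [hk, Nat.even_add_one]

/-! ### Identification with the Dedekind zeta function -/

section dedekind

open NumberField

/-- The Gaussian integers are the ring of integers of the fourth cyclotomic field. -/
lemma exists_ringEquiv_ringOfIntegers (K : Type*) [Field K] [NumberField K]
    [IsCyclotomicExtension {4} ℚ K] : Nonempty (GaussianInt ≃+* 𝓞 K) := by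
  have hζ := IsCyclotomicExtension.zeta_spec 4 ℚ K
  set ζ := IsCyclotomicExtension.zeta 4 ℚ K
  have hsq : ζ * ζ = -1 := by
    rw [← sq]
    exact (hζ.pow (by norm_num) (by norm_num : 4 = 2 * 2)).eq_neg_one_of_two_right
  let z : 𝓞 K := hζ.toInteger
  have hz : z * z = ((-1 : ℤ) : 𝓞 K) := by
    apply RingOfIntegers.coe_injective
    push_cast
    exact hsq
  let f : GaussianInt →+* 𝓞 K := Zsqrtd.lift ⟨z, hz⟩
  -- No integer has square `-1`.
  have hinj : Function.Injective f :=
    Zsqrtd.lift_injective _ fun n h => by nlinarith [mul_self_nonneg n]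
  refine ⟨RingEquiv.ofBijective f ⟨hinj, fun x => ?_⟩⟩
  -- Surjectivity: the ring of integers is `ℤ[ζ]`, and `ζ` is the image of `i`.
  have hcl := IsCyclotomicExtension.Rat.isIntegralClosure_adjoin_singleton hζ
  obtain ⟨y, hy⟩ := hcl.isIntegral_iff.1 x.isIntegral_coe
  have key : ∀ t ∈ Algebra.adjoin ℤ {ζ}, ∃ g : GaussianInt, (f g : K) = t := by
    intro t ht
    induction ht using Algebra.adjoin_induction with
    | mem t ht =>
      rw [Set.mem_singleton_iff] at ht
      refine ⟨gI, ?_⟩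
      rw [ht]
      simp [f, gI, z]
      rfl
    | algebraMap n => exact ⟨n, by simp⟩
    | add a b _ _ ha hb =>
      obtain ⟨g, rfl⟩ := ha
      obtain ⟨h, rfl⟩ := hb
      exact ⟨g + h, by simp⟩
    | mul a b _ _ ha hb =>
      obtain ⟨g, rfl⟩ := ha
      obtain ⟨h, rfl⟩ := hb
      exact ⟨g * h, by simp⟩
  obtain ⟨g, hg⟩ := key _ y.2
  exact ⟨g, RingOfIntegers.coe_injective (hg.trans hy)⟩

lemma absNorm_map_ringEquiv {R S : Type*} [CommRing R] [IsDedekindDomain R] [Module.Free ℤ R]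
    [CommRing S] [IsDedekindDomain S] [Module.Free ℤ S] (e : R ≃+* S) (I : Ideal R) :
    Ideal.absNorm (I.map (e : R →+* S)) = Ideal.absNorm I := by
  rw [Ideal.absNorm_apply, Ideal.absNorm_apply, Submodule.cardQuot_apply,
    Submodule.cardQuot_apply]
  exact Nat.card_congr (Ideal.quotientEquiv I (I.map (e : R →+* S)) e rfl).symm.toEquiv

/-- A ring isomorphism preserves the number of ideals of each norm. -/
lemma card_idealsOfNorm_congr {R S : Type*} [CommRing R] [IsDedekindDomain R] [Module.Free ℤ R]
    [CommRing S] [IsDedekindDomain S] [Module.Free ℤ S] (e : R ≃+* S) (n : ℕ) :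
    Nat.card (IdealsOfNorm R n) = Nat.card (IdealsOfNorm S n) := by
  refine Nat.card_congr ⟨fun I => ⟨I.1.map (e : R →+* S), by rw [absNorm_map_ringEquiv, I.2]⟩,
    fun I => ⟨I.1.map (e.symm : S →+* R), by rw [absNorm_map_ringEquiv, I.2]⟩, ?_, ?_⟩
  · rintro ⟨I, hI⟩
    exact Subtype.ext (by simp [Ideal.map_map])
  · rintro ⟨I, hI⟩
    exact Subtype.ext (by simp [Ideal.map_map])

lemma phiSq_eq_dedekindZeta (s : ℂ) :
    PhiSq s = NumberField.dedekindZeta (CyclotomicField 4 ℚ) s := by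
  have : NeZero ((4 : ℕ) : ℚ) := ⟨by norm_num⟩
  have h := CyclotomicField.isCyclotomicExtension 4 ℚ
  -- The `ℚ`-algebra structure of a number field and that of `CyclotomicField` are different terms;
  -- they agree since such a structure is unique.
  have : @IsCyclotomicExtension {4} ℚ (CyclotomicField 4 ℚ) _ _ DivisionRing.toRatAlgebra := by
    rwa [Subsingleton.elim (DivisionRing.toRatAlgebra) (CyclotomicField.algebra 4 ℚ)]
  obtain ⟨e⟩ := exists_ringEquiv_ringOfIntegers (CyclotomicField 4 ℚ)
  rw [PhiSq, dirichletSeries, NumberField.dedekindZeta]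
  refine LSeries_congr (fun {n} hn => ?_) s
  rw [sSq_eq_card_ideals hn, card_idealsOfNorm_congr e n]

end dedekind

/-! ### Dirichlet series of the counting functions -/

lemma sSq_eq_sum_chi (n : ℕ) :
    (sSq n : ℤ) = ∑ x ∈ n.divisorsAntidiagonal, ZMod.χ₄ x.2 := by
  have h : sSqArith n = _ := congrArg (fun f : ArithmeticFunction ℤ => f n) sSqArith_eq
  rw [ArithmeticFunction.mul_apply] at h
  change (sSq n : ℤ) = _ at h
  rw [h]
  refine Finset.sum_congr rfl fun x hx => ?_
  have : x.1 ≠ 0 := Nat.ne_zero_of_mem_divisorsAntidiagonal hx |>.1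
  simp [chiArith, this]

/-- The character `χ₄` with complex values. -/
abbrev chiC : DirichletCharacter ℂ 4 := ZMod.χ₄.ringHomComp (Int.castRingHom ℂ)

open scoped LSeries.notation in
lemma sSq_eq_convolution (n : ℕ) :
    (sSq n : ℂ) = ((1 : ℕ → ℂ) ⍟ fun n : ℕ => chiC n) n := by
  rw [LSeries.convolution_def]
  have := congrArg (Int.cast : ℤ → ℂ) (sSq_eq_sum_chi n)
  push_cast at this
  rw [this]
  refine Finset.sum_congr rfl fun x hx => ?_
  simp [MulChar.ringHomComp_apply]

lemma lSeriesHasSum_sSq {s : ℂ} (hs : 1 < s.re) :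
    LSeriesHasSum (fun n => (sSq n : ℂ)) s (riemannZeta s * LChi s) := by
  have h2 : LSeriesHasSum (fun n : ℕ => chiC n) s (LChi s) := by
    rw [LChi, DirichletCharacter.LFunction_eq_LSeries _ hs]
    exact (DirichletCharacter.LSeriesSummable_of_one_lt_re _ hs).LSeriesHasSum
  have := (LSeriesHasSum_one hs).convolution h2
  rwa [← LSeriesHasSum_congr s _ (fun {n} _ => sSq_eq_convolution n)] at this

lemma sSqPr_le_sSq (n : ℕ) : sSqPr n ≤ sSq n := by
  rw [sSq_eq_card, sSqPr_eq_card]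
  exact Finset.card_le_card (Finset.filter_subset _ _)

lemma sSqPr_zero : sSqPr 0 = 0 := by
  have := sSqPr_le_sSq 0
  rwa [sSq_zero, Nat.le_zero] at this

lemma lSeriesSummable_of_le {f g : ℕ → ℕ} (h : ∀ n, f n ≤ g n) {s : ℂ}
    (hg : LSeriesSummable (fun n => (g n : ℂ)) s) : LSeriesSummable (fun n => (f n : ℂ)) s := by
  refine Summable.of_norm_bounded hg.norm fun n => LSeries.norm_term_le s ?_
  simpa using h n

lemma lSeriesSummable_sSqPr {s : ℂ} (hs : 1 < s.re) :
    LSeriesSummable (fun n => (sSqPr n : ℂ)) s :=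
  lSeriesSummable_of_le sSqPr_le_sSq (lSeriesHasSum_sSq hs).LSeriesSummable

lemma norm_natCast_mul (d : ℕ) (w : GaussianInt) :
    ((d : GaussianInt) * w).norm = d * d * w.norm := by
  rw [Zsqrtd.norm_mul, Zsqrtd.norm_natCast]

lemma inQuad_natCast_mul {d : ℕ} (hd : d ≠ 0) {w : GaussianInt} :
    InQuad ((d : GaussianInt) * w) ↔ InQuad w := by
  have : (0 : ℤ) < d := by exact_mod_cast Nat.pos_of_ne_zero hd
  simp only [InQuad, Zsqrtd.re_mul, Zsqrtd.im_mul, Zsqrtd.re_natCast, Zsqrtd.im_natCast, mul_zero,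
    zero_mul, add_zero, mul_pos_iff_of_pos_left this, mul_nonneg_iff_of_pos_left this]

/-- Each nonzero `z` is `d w` with `w` primitive and `d` the gcd of the coordinates of `z`, and
`N(z) = d² N(w)`. Sorting by `(d², N(w))` gives the sum. -/
lemma sSq_eq_sum_sSqPr (n : ℕ) :
    sSq n = ∑ x ∈ n.divisorsAntidiagonal, (if IsSquare x.1 then 1 else 0) * sSqPr x.2 := by
  rw [sSq_eq_card]
  let g : GaussianInt → ℕ := fun z => Int.gcd z.re z.im
  have hg : ∀ {d : ℕ} {w : GaussianInt}, IsCoprime w.re w.im → g (d * w) = d := by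
    intro d w hw
    simpa [g] using gcd_natCast_mul hw d
  have hex : ∀ z ∈ quadReps n, ∃ (d : ℕ) (w : GaussianInt), d ≠ 0 ∧ IsCoprime w.re w.im ∧
      z = d * w ∧ InQuad w ∧ d * d * w.norm.natAbs = n := by
    intro z hz
    obtain ⟨h1, h2⟩ := mem_quadReps.1 hz
    obtain ⟨d, w, hd, hw, rfl⟩ := exists_natCast_mul_primitive h1.ne_zero
    refine ⟨d, w, hd, hw, rfl, (inQuad_natCast_mul hd).1 h1, ?_⟩
    rw [norm_natCast_mul] at h2
    have := GaussianInt.norm_nonneg w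
    zify
    rwa [abs_of_nonneg this]
  rw [Finset.card_eq_sum_card_fiberwise (f := fun z => (g z * g z, n / (g z * g z)))
    (t := n.divisorsAntidiagonal)]
  · refine Finset.sum_congr rfl fun x hx => ?_
    obtain ⟨a, b⟩ := x
    obtain ⟨hab, hn⟩ := Nat.mem_divisorsAntidiagonal.1 hx
    simp only at hab ⊢
    split_ifs with hsq
    · obtain ⟨d, rfl⟩ := hsq
      have hd : d ≠ 0 := by rintro rfl; simp at hab; exact hn hab.symm
      rw [one_mul, sSqPr_eq_card]
      symm
      refine Finset.card_bij (fun w _ => (d : GaussianInt) * w) ?_ ?_ ?_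
      · intro w hw
        obtain ⟨⟨h1, h2⟩, h3⟩ := mem_primReps.1 hw
        rw [Finset.mem_filter, mem_quadReps, hg h3, inQuad_natCast_mul hd, norm_natCast_mul, h2]
        refine ⟨⟨h1, by exact_mod_cast hab⟩, ?_⟩
        rw [← hab, Nat.mul_div_cancel_left]
        positivity
      · intro w _ w' _ h
        exact mul_left_cancel₀ (by exact_mod_cast hd) h
      · intro z hz
        rw [Finset.mem_filter] at hz
        obtain ⟨e, w, he, hw, rfl, hwq, hn'⟩ := hex z hz.1
        have h2 := hz.2
        rw [hg hw, Prod.mk.injEq] at h2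
        have hed : e = d := Nat.mul_self_inj.1 h2.1
        subst hed
        refine ⟨w, mem_primReps.2 ⟨⟨hwq, ?_⟩, hw⟩, rfl⟩
        rw [← natAbs_norm_eq_iff]
        apply Nat.eq_of_mul_eq_mul_left (Nat.pos_of_ne_zero (mul_ne_zero he he))
        rw [hn', hab]
    · rw [zero_mul, Finset.card_eq_zero, Finset.filter_eq_empty_iff]
      intro z _ h
      rw [Prod.mk.injEq] at h
      exact hsq ⟨_, h.1.symm⟩
  · intro z hz
    obtain ⟨d, w, hd, hw, rfl, hwq, hn'⟩ := hex z hz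
    simp only
    rw [Finset.mem_coe, hg hw, Nat.mem_divisorsAntidiagonal]
    constructor
    · rw [← hn', Nat.mul_div_cancel_left]
      positivity
    · rw [← hn']
      have := hwq.norm_pos
      exact mul_ne_zero (mul_ne_zero hd hd) (by omega)

/-- Lift of a function along the squares. -/
def onSquares (f : ℕ → ℂ) (n : ℕ) : ℂ := if IsSquare n then f (Nat.sqrt n) else 0

lemma onSquares_sq (f : ℕ → ℂ) (n : ℕ) : onSquares f (n * n) = f n := by
  rw [onSquares, if_pos ⟨n, rfl⟩, Nat.sqrt_eq]

lemma term_onSquares (f : ℕ → ℂ) (s : ℂ) (n : ℕ) :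
    LSeries.term (onSquares f) s (n * n) = LSeries.term f (2 * s) n := by
  rcases eq_or_ne n 0 with rfl | hn
  · simp
  · rw [LSeries.term_of_ne_zero (mul_ne_zero hn hn), LSeries.term_of_ne_zero hn, onSquares_sq]
    congr 1
    rw [Nat.cast_mul, Complex.natCast_mul_natCast_cpow, ← Complex.cpow_add _ _ (by exact_mod_cast hn),
      two_mul]

lemma lSeriesHasSum_onSquares {f : ℕ → ℂ} {s a : ℂ} (h : LSeriesHasSum f (2 * s) a) :
    LSeriesHasSum (onSquares f) s a := by
  have hinj : Function.Injective (fun n : ℕ => n * n) := fun a b h => Nat.mul_self_inj.1 h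
  rw [LSeriesHasSum, ← hinj.hasSum_iff]
  · have : LSeries.term (onSquares f) s ∘ (fun n : ℕ => n * n) = LSeries.term f (2 * s) :=
      funext fun n => term_onSquares f s n
    rw [this]; exact h
  · intro n hn
    have : ¬ IsSquare n := by
      rintro ⟨r, rfl⟩; exact hn ⟨r, rfl⟩
    rw [LSeries.term_def, onSquares, if_neg this]
    simp

open scoped LSeries.notation in
lemma sSq_eq_onSquares_convolution (n : ℕ) :
    (sSq n : ℂ) = (onSquares 1 ⍟ fun n : ℕ => (sSqPr n : ℂ)) n := by
  rw [LSeries.convolution_def, sSq_eq_sum_sSqPr]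
  push_cast
  refine Finset.sum_congr rfl fun x hx => ?_
  simp [onSquares]

lemma phiSq_eq {s : ℂ} (hs : 1 < s.re) : PhiSq s = riemannZeta (2 * s) * PhiSqPr s := by
  have h2s : 1 < (2 * s).re := by simp; linarith
  have := (lSeriesHasSum_onSquares (LSeriesHasSum_one h2s)).convolution
    (lSeriesSummable_sSqPr hs).LSeriesHasSum
  rw [← LSeriesHasSum_congr s _ (fun {n} _ => sSq_eq_onSquares_convolution n)] at this
  exact this.LSeries_eq

/-- The number of factorizations `d = p q` with `(p, q)` in a given set. -/
def pairCount (S : ℕ × ℕ → Prop) (d : ℕ) : ℕ :=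
  open Classical in (d.divisorsAntidiagonal.filter S).card

/-- The double Dirichlet series over a set of pairs. -/
def pairTerm (S : ℕ × ℕ → Prop) (s : ℂ) (x : ℕ × ℕ) : ℂ :=
  open Classical in if S x then 1 / ((x.1 : ℂ) ^ s * (x.2 : ℂ) ^ s) else 0

/-- The series is dominated by the product of two absolutely convergent zeta series. -/
lemma summable_pairTerm {S : ℕ × ℕ → Prop} (hS : ∀ x, S x → x.1 * x.2 ≠ 0) {s : ℂ}
    (hs : 1 < s.re) : Summable (pairTerm S s) := by
  have h1 : Summable fun n => ‖LSeries.term 1 s n‖ := (LSeriesHasSum_one hs).summable.norm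
  have h2 := Summable.mul_norm h1 h1
  refine Summable.of_norm_bounded h2 fun x => ?_
  rw [pairTerm]
  split_ifs with h
  · have := hS x h
    rw [LSeries.term_of_ne_zero (left_ne_zero_of_mul this),
      LSeries.term_of_ne_zero (right_ne_zero_of_mul this)]
    simp only [Pi.one_apply]
    rw [div_mul_div_comm, one_mul]
  · rw [norm_zero]; positivity

/-- Absolute convergence permits grouping the pairs by their product. -/
lemma lSeriesHasSum_pairCount {S : ℕ × ℕ → Prop} (hS : ∀ x, S x → x.1 * x.2 ≠ 0) {s : ℂ}
    (hs : 1 < s.re) : LSeriesHasSum (fun n => (pairCount S n : ℂ)) s (∑' x, pairTerm S s x) := by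
  classical
  have h := (summable_pairTerm hS hs).hasSum.tsum_fiberwise (fun x => x.1 * x.2)
  rw [LSeriesHasSum]
  convert! h using 1
  ext n
  -- The fibre over 0 is infinite, but `S` avoids it by `hS`.
  rcases eq_or_ne n 0 with rfl | hn
  · rw [LSeries.term_zero]
    symm
    convert! tsum_zero with x
    have hx : x.1.1 * x.1.2 = 0 := x.2
    rw [pairTerm, if_neg]
    exact fun h => hS _ h hx
  · have hset : (fun x : ℕ × ℕ => x.1 * x.2) ⁻¹' {n} = ↑n.divisorsAntidiagonal := by
      ext x; simp [hn]
    rw [hset, Finset.tsum_subtype' n.divisorsAntidiagonal, LSeries.term_of_ne_zero hn, pairCount,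
      Finset.card_filter]
    push_cast
    rw [Finset.sum_div]
    refine Finset.sum_congr rfl fun x hx => ?_
    rw [pairTerm]
    split_ifs
    · rw [← (Nat.mem_divisorsAntidiagonal.1 hx).1, Nat.cast_mul,
        Complex.natCast_mul_natCast_cpow]
    · simp

lemma natCast_lt_sqrt_three_mul {p q : ℕ} : (q : ℝ) < √3 * p ↔ q ^ 2 < 3 * p ^ 2 := by
  rw [← sq_lt_sq₀ (by positivity) (by positivity), mul_pow, Real.sq_sqrt (by norm_num)]
  exact_mod_cast Iff.rfl

/-- The pairs `p < q < √3 p`. -/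
def IsClose (x : ℕ × ℕ) : Prop := x.1 < x.2 ∧ x.2 ^ 2 < 3 * x.1 ^ 2

lemma IsClose.mul_ne_zero {x : ℕ × ℕ} (h : IsClose x) : x.1 * x.2 ≠ 0 := by
  have h1 := h.1
  have h2 := h.2
  have : x.1 ≠ 0 := by
    intro h0
    rw [h0] at h2
    simp at h2
  exact Nat.mul_ne_zero this (by omega)

/-- The pairs `p < q < √3 p` of odd numbers. -/
def IsCloseOdd (x : ℕ × ℕ) : Prop := IsClose x ∧ Odd x.1 ∧ Odd x.2

lemma pairCount_isClose (d : ℕ) : pairCount IsClose d = (closePairs d).card := by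
  rw [pairCount, closePairs]
  congr

lemma pairCount_isCloseOdd {d : ℕ} (hd : Odd d) :
    pairCount IsCloseOdd d = (closePairs d).card := by
  classical
  rw [← pairCount_isClose, pairCount, pairCount]
  congr 1
  refine Finset.filter_congr fun x hx => ?_
  rw [← (Nat.mem_divisorsAntidiagonal.1 hx).1, Nat.odd_mul] at hd
  simp [IsCloseOdd, hd]

lemma pairCount_isCloseOdd_of_even {d : ℕ} (hd : Even d) : pairCount IsCloseOdd d = 0 := by
  classical
  rw [pairCount, Finset.card_eq_zero, Finset.filter_eq_empty_iff]
  rintro x hx ⟨-, h⟩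
  rw [← (Nat.mem_divisorsAntidiagonal.1 hx).1, ← Nat.not_odd_iff_even, Nat.odd_mul] at hd
  exact hd h

lemma mem_Ioo_even_iff {p q : ℕ} :
    q ∈ Finset.Ioo p ⌈√3 * (p : ℝ)⌉₊ ↔ IsClose (p, q) := by
  rw [Finset.mem_Ioo, Nat.lt_ceil, natCast_lt_sqrt_three_mul]; rfl

/-- Doubling and adding 1 turns the bound on `l` into `2 l + 1 < √3 (2 k + 1)`. -/
lemma mem_Ioo_odd_iff {k l : ℕ} :
    l ∈ Finset.Ioo k ⌈√3 * (k : ℝ) + (√3 - 1) / 2⌉₊ ↔ IsCloseOdd (2 * k + 1, 2 * l + 1) := by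
  have : (l : ℝ) < √3 * k + (√3 - 1) / 2 ↔ ((2 * l + 1 : ℕ) : ℝ) < √3 * ((2 * k + 1 : ℕ) : ℝ) := by
    push_cast
    constructor <;> intro h <;> linarith
  rw [Finset.mem_Ioo, Nat.lt_ceil, this, natCast_lt_sqrt_three_mul]
  simp [IsCloseOdd, IsClose]

lemma tsum_pairTerm_even (s : ℂ) (p : ℕ) : ∑' q, pairTerm IsClose s (p, q) = innerEven s p := by
  rw [innerEven, tsum_eq_sum (s := Finset.Ioo p ⌈√3 * (p : ℝ)⌉₊)]
  · refine Finset.sum_congr rfl fun q hq => ?_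
    rw [pairTerm, if_pos (mem_Ioo_even_iff.1 hq)]
  · intro q hq
    rw [pairTerm, if_neg (fun h => hq (mem_Ioo_even_iff.2 h))]

lemma summable_innerEven {s : ℂ} (hs : 1 < s.re) : Summable (innerEven s) := by
  have h := (summable_pairTerm (fun x => IsClose.mul_ne_zero) hs).hasSum.prod_fiberwise
    (fun p => ((summable_pairTerm (fun x => IsClose.mul_ne_zero) hs).prod_factor p).hasSum)
  simp only [tsum_pairTerm_even] at h
  exact h.summable

lemma tsum_innerEven {s : ℂ} (hs : 1 < s.re) :
    ∑' p, innerEven s p = ∑' x, pairTerm IsClose s x := by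
  rw [(summable_pairTerm (fun x => IsClose.mul_ne_zero) hs).tsum_prod]
  simp only [tsum_pairTerm_even]

/-- The embedding `(k, l) ↦ (2 k + 1, 2 l + 1)`. -/
def oddPair (x : ℕ × ℕ) : ℕ × ℕ := (2 * x.1 + 1, 2 * x.2 + 1)

lemma oddPair_injective : Function.Injective oddPair := by
  rintro ⟨a, b⟩ ⟨c, d⟩ h
  simp only [oddPair, Prod.mk.injEq] at h ⊢
  omega

lemma pairTerm_isCloseOdd_eq_zero (s : ℂ) {x : ℕ × ℕ} (hx : x ∉ Set.range oddPair) :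
    pairTerm IsCloseOdd s x = 0 := by
  rw [pairTerm, if_neg]
  rintro ⟨-, ⟨a, ha⟩, ⟨b, hb⟩⟩
  exact hx ⟨(a, b), by rw [oddPair, ← ha, ← hb]⟩

lemma summable_pairTerm_oddPair {s : ℂ} (hs : 1 < s.re) :
    Summable fun x => pairTerm IsCloseOdd s (oddPair x) :=
  (summable_pairTerm (fun _ h => h.1.mul_ne_zero) hs).comp_injective oddPair_injective

lemma tsum_pairTerm_odd (s : ℂ) (k : ℕ) :
    ∑' l, pairTerm IsCloseOdd s (oddPair (k, l)) = innerOdd s k := by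
  rw [innerOdd, tsum_eq_sum (s := Finset.Ioo k ⌈√3 * (k : ℝ) + (√3 - 1) / 2⌉₊)]
  · refine Finset.sum_congr rfl fun l hl => ?_
    rw [pairTerm, if_pos (show IsCloseOdd (oddPair (k, l)) from mem_Ioo_odd_iff.1 hl)]
    simp [oddPair]
  · intro l hl
    rw [pairTerm, if_neg (fun h : IsCloseOdd (oddPair (k, l)) => hl (mem_Ioo_odd_iff.2 h))]

lemma summable_innerOdd {s : ℂ} (hs : 1 < s.re) : Summable (innerOdd s) := by
  have h := (summable_pairTerm_oddPair hs).hasSum.prod_fiberwise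
    (fun p => ((summable_pairTerm_oddPair hs).prod_factor p).hasSum)
  simp only [tsum_pairTerm_odd] at h
  exact h.summable

lemma tsum_innerOdd {s : ℂ} (hs : 1 < s.re) :
    ∑' k, innerOdd s k = ∑' x, pairTerm IsCloseOdd s x := by
  have h1 : ∑' k, innerOdd s k = ∑' x, pairTerm IsCloseOdd s (oddPair x) := by
    rw [(summable_pairTerm_oddPair hs).tsum_prod]
    simp only [tsum_pairTerm_odd]
  rw [h1]
  refine oddPair_injective.tsum_eq (f := pairTerm IsCloseOdd s) fun x hx => ?_
  by_contra h
  exact hx (pairTerm_isCloseOdd_eq_zero s h)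

/-- Extension of a function from `n` to `2 n`, by zero on odd numbers. -/
def onEvens {R : Type*} [Zero R] (f : ℕ → R) (n : ℕ) : R := if Even n then f (n / 2) else 0

lemma onEvens_two_mul {R : Type*} [Zero R] (f : ℕ → R) (n : ℕ) : onEvens f (2 * n) = f n := by
  rw [onEvens, if_pos (even_two_mul n), Nat.mul_div_cancel_left _ two_pos]

lemma onEvens_of_odd {R : Type*} [Zero R] (f : ℕ → R) {n : ℕ} (h : Odd n) : onEvens f n = 0 :=
  if_neg (Nat.not_even_iff_odd.2 h)

lemma lSeriesHasSum_onEvens {f : ℕ → ℂ} {s a : ℂ} (h : LSeriesHasSum f s a) :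
    LSeriesHasSum (onEvens f) s (2 ^ (-s) * a) := by
  have hinj : Function.Injective (fun n : ℕ => 2 * n) := fun a b h => by simpa using h
  rw [LSeriesHasSum, ← hinj.hasSum_iff]
  · convert! h.mul_left (2 ^ (-s)) using 1
    ext n
    rcases eq_or_ne n 0 with rfl | hn
    · simp
    · simp only [Function.comp]
      rw [LSeries.term_of_ne_zero (by omega), LSeries.term_of_ne_zero hn, onEvens_two_mul]
      rw [Nat.cast_mul, Complex.natCast_mul_natCast_cpow, Complex.cpow_neg]
      push_cast
      field_simp
  · intro n hn
    have : Odd n := by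
      rw [← Nat.not_even_iff_odd, even_iff_two_dvd]
      rintro ⟨k, rfl⟩
      exact hn ⟨k, rfl⟩
    rw [LSeries.term_def, onEvens_of_odd f this]
    simp

/-- The number of primitive similar sublattices of index `n` for odd `n`, and `0` else. -/
def sSqPrOdd (n : ℕ) : ℕ := if Odd n then sSqPr n else 0

/-- Indices divisible by 4 do not occur, and index `2 m` with `m` odd has the same count as `m`. On
Dirichlet series this is the factor `1 + 2 ^ (-s)`. -/
lemma sSqPr_eq_add (n : ℕ) : sSqPr n = sSqPrOdd n + onEvens sSqPrOdd n := by
  rcases Nat.even_or_odd' n with ⟨k, rfl | rfl⟩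
  · rw [onEvens_two_mul, sSqPrOdd, sSqPrOdd, if_neg (by simp), zero_add]
    split_ifs with h
    · exact sSqPr_two_mul h
    · obtain ⟨j, rfl⟩ := Nat.not_odd_iff_even.1 h
      rw [← two_mul, ← mul_assoc]
      exact sSqPr_four_mul j
  · have h := odd_two_mul_add_one k
    rw [onEvens_of_odd _ h, sSqPrOdd, if_pos h, add_zero]

lemma sSqPrOdd_le (n : ℕ) : sSqPrOdd n ≤ sSqPr n := by
  rw [sSqPrOdd]; split_ifs <;> omega

lemma onEvens_natCast (f : ℕ → ℕ) (n : ℕ) :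
    ((onEvens f n : ℕ) : ℂ) = onEvens (fun n => (f n : ℂ)) n := by
  rw [onEvens, onEvens]; split_ifs <;> simp

lemma one_add_two_cpow_neg_ne_zero {s : ℂ} (hs : 1 < s.re) : (1 : ℂ) + 2 ^ (-s) ≠ 0 := by
  intro h
  have h1 : ‖(2 : ℂ) ^ (-s)‖ = 1 := by
    rw [← neg_eq_iff_add_eq_zero] at h
    rw [← h]; simp
  have h2 : ‖((2 : ℝ) : ℂ) ^ (-s)‖ = (2 : ℝ) ^ (-s).re :=
    Complex.norm_cpow_eq_rpow_re_of_pos two_pos _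
  rw [Complex.ofReal_ofNat, h1, Complex.neg_re] at h2
  have : (2 : ℝ) ^ (-s.re) < 1 := Real.rpow_lt_one_of_one_lt_of_neg one_lt_two (by linarith)
  linarith

lemma lSeriesHasSum_sSqPrOdd {s : ℂ} (hs : 1 < s.re) :
    LSeriesHasSum (fun n => (sSqPrOdd n : ℂ)) s (PhiSqPr s / (1 + 2 ^ (-s))) := by
  have h := (lSeriesSummable_of_le sSqPrOdd_le (lSeriesSummable_sSqPr hs)).LSeriesHasSum
  set a := LSeries (fun n => (sSqPrOdd n : ℂ)) s
  have h2 : LSeriesHasSum (fun n => (sSqPr n : ℂ)) s (a + 2 ^ (-s) * a) := by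
    have := h.add (lSeriesHasSum_onEvens h)
    convert! this using 2 with n
    rw [sSqPr_eq_add n, Nat.cast_add, onEvens_natCast]
    rfl
  have h3 : PhiSqPr s = a + 2 ^ (-s) * a := h2.LSeries_eq
  have h4 : PhiSqPr s / (1 + 2 ^ (-s)) = a := by
    rw [h3, div_eq_iff (one_add_two_cpow_neg_ne_zero hs)]; ring
  rw [h4]; exact h

open scoped LSeries.notation in
lemma rhombicEven_eq {n : ℕ} (hn : n ≠ 0) :
    (rhombicEven n : ℂ) = onEvens (fun n => 2 *
      ((fun n => (pairCount IsClose n : ℂ)) ⍟ fun n => (sSqPr n : ℂ)) n) n := by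
  rw [rhombicEven, onEvens]
  split_ifs with h
  · obtain ⟨k, rfl⟩ := h
    rw [countSub_rhombic, ← two_mul, ncard_rhombicSet_even (by omega), LSeries.convolution_def,
      Nat.mul_div_cancel_left _ two_pos]
    push_cast
    simp only [pairCount_isClose]
  · simp

/-- Restricting both factors to odd arguments changes nothing at odd `n` and gives 0 at even `n`, so
the formula is a genuine Dirichlet convolution for all `n`. -/
lemma rhombicOdd_eq (n : ℕ) : rhombicOdd n =
    2 * ∑ x ∈ n.divisorsAntidiagonal, pairCount IsCloseOdd x.1 * sSqPrOdd x.2 := by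
  rw [rhombicOdd]
  split_ifs with h
  · rw [countSub_rhombic, ncard_rhombicSet_odd h]
    congr 1
    refine Finset.sum_congr rfl fun x hx => ?_
    rw [← (Nat.mem_divisorsAntidiagonal.1 hx).1, Nat.odd_mul] at h
    rw [pairCount_isCloseOdd h.1, sSqPrOdd, if_pos h.2]
  · symm
    rw [mul_eq_zero]
    refine Or.inr (Finset.sum_eq_zero fun x hx => ?_)
    rw [← (Nat.mem_divisorsAntidiagonal.1 hx).1, Nat.odd_mul, not_and_or] at h
    rcases h with h | h
    · rw [pairCount_isCloseOdd_of_even (Nat.not_odd_iff_even.1 h), zero_mul]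
    · rw [sSqPrOdd, if_neg h, mul_zero]

lemma lSeriesHasSum_rhombicEven {s : ℂ} (hs : 1 < s.re) :
    LSeriesHasSum (fun n => (rhombicEven n : ℂ)) s (PhiEven s) := by
  have h1 := (lSeriesHasSum_pairCount (fun x => IsClose.mul_ne_zero) hs).convolution
    (lSeriesSummable_sSqPr hs).LSeriesHasSum
  have h2 := lSeriesHasSum_onEvens (h1.smul 2)
  rw [LSeriesHasSum_congr s _ (fun {n} hn => rhombicEven_eq hn)]
  have h3 : PhiEven s = 2 ^ (-s) * (2 * ((∑' x, pairTerm IsClose s x) * PhiSqPr s)) := by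
    rw [PhiEven, tsum_innerEven hs, Complex.cpow_neg]
    ring
  rw [h3]
  exact h2

lemma lSeriesHasSum_rhombicOdd {s : ℂ} (hs : 1 < s.re) :
    LSeriesHasSum (fun n => (rhombicOdd n : ℂ)) s (PhiOdd s) := by
  have h1 := (lSeriesHasSum_pairCount (S := IsCloseOdd) (fun x h => h.1.mul_ne_zero) hs).convolution
    (lSeriesHasSum_sSqPrOdd hs)
  have h2 := h1.smul 2
  convert! h2 using 1
  · ext n
    rw [rhombicOdd_eq, Pi.smul_apply, LSeries.convolution_def]
    push_cast
    rw [smul_eq_mul]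
  · rw [PhiOdd, tsum_innerOdd hs]
    ring

lemma aSq_eq {n : ℕ} (hn : n ≠ 0) : aSq n = sSq n + rhombicEven n + rhombicOdd n := by
  rw [aSq_eq_add hn, rhombicEven, rhombicOdd, countSub_rhombic]
  rcases Nat.even_or_odd n with h | h
  · rw [if_pos h, if_neg (Nat.not_odd_iff_even.2 h), add_zero]
  · rw [if_pos h, if_neg (Nat.not_even_iff_odd.2 h), add_zero]

lemma lSeriesHasSum_aSq {s : ℂ} (hs : 1 < s.re) :
    LSeriesHasSum (fun n => (aSq n : ℂ)) s (PhiSq s + PhiEven s + PhiOdd s) := by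
  have h := ((lSeriesHasSum_sSq hs).LSeriesSummable.LSeriesHasSum.add
    (lSeriesHasSum_rhombicEven hs)).add (lSeriesHasSum_rhombicOdd hs)
  refine (LSeriesHasSum_congr s _ fun {n} hn => ?_).2 h
  rw [aSq_eq hn]
  push_cast
  rfl

lemma phiWr_eq {s : ℂ} (hs : 1 < s.re) : PhiWr s = PhiSq s + PhiEven s + PhiOdd s :=
  (lSeriesHasSum_aSq hs).LSeries_eq

/-! ### Comparison of sums with integrals and the two-sided bound -/

/-- A primitive of `t ↦ t ^ (-s)`. -/
def powPrimitive (s t : ℝ) : ℝ := t ^ (1 - s) / (1 - s)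

/-- The mean value theorem; the intermediate point is interior, which keeps the later inequalities
strict. -/
lemma exists_powPrimitive_sub {s a b : ℝ} (hs : 1 < s) (ha : 0 < a) (hab : a < b) :
    ∃ c ∈ Set.Ioo a b, powPrimitive s b - powPrimitive s a = (b - a) * c ^ (-s) := by
  have hd : ∀ t, 0 < t → HasDerivAt (powPrimitive s) (t ^ (-s)) t := by
    intro t ht
    have h := (Real.hasDerivAt_rpow_const (p := 1 - s) (Or.inl ht.ne')).div_const (1 - s)
    have hs' : 1 - s ≠ 0 := by linarith
    have he : (1 - s) * t ^ (1 - s - 1) / (1 - s) = t ^ (-s) := by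
      rw [mul_div_cancel_left₀ _ hs']; congr 1; ring
    rw [he] at h
    exact h
  obtain ⟨c, hc, h⟩ := exists_hasDerivAt_eq_slope (powPrimitive s) (fun t => t ^ (-s)) hab
    (fun t ht => (hd t (ha.trans_le ht.1)).continuousAt.continuousWithinAt)
    (fun t ht => hd t (ha.trans ht.1))
  refine ⟨c, hc, ?_⟩
  rw [h, mul_div_cancel₀ _ (by linarith)]

lemma powPrimitive_sub_lt {s a b : ℝ} (hs : 1 < s) (ha : 0 < a) (hab : a < b) :
    powPrimitive s b - powPrimitive s a < (b - a) * a ^ (-s) := by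
  obtain ⟨c, hc, h⟩ := exists_powPrimitive_sub hs ha hab
  rw [h]
  exact mul_lt_mul_of_pos_left (Real.rpow_lt_rpow_of_neg ha hc.1 (by linarith)) (by linarith)

lemma lt_powPrimitive_sub {s a b : ℝ} (hs : 1 < s) (ha : 0 < a) (hab : a < b) :
    (b - a) * b ^ (-s) < powPrimitive s b - powPrimitive s a := by
  obtain ⟨c, hc, h⟩ := exists_powPrimitive_sub hs ha hab
  rw [h]
  exact mul_lt_mul_of_pos_left (Real.rpow_lt_rpow_of_neg (ha.trans hc.1) hc.2 (by linarith))
    (by linarith)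

lemma powPrimitive_lt {s a b : ℝ} (hs : 1 < s) (ha : 0 < a) (hab : a < b) :
    powPrimitive s a < powPrimitive s b := by
  have := lt_powPrimitive_sub hs ha hab
  have h2 : 0 < (b - a) * b ^ (-s) :=
    mul_pos (by linarith) (Real.rpow_pos_of_pos (ha.trans hab) _)
  linarith

/-- Comparison with right endpoints. Steps `h = 1`, `c = 0` serve the even case and `h = 2`, `c = 1`
the odd case. -/
lemma mul_sum_Ioc_le_powPrimitive {s h c : ℝ} (hs : 1 < s) (hh : 0 < h) {p m : ℕ}
    (hp : 0 < h * p + c) (hpm : p ≤ m) :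
    h * ∑ l ∈ Finset.Ioc p m, (h * l + c) ^ (-s) ≤
      powPrimitive s (h * m + c) - powPrimitive s (h * p + c) := by
  induction m, hpm using Nat.le_induction with
  | base => simp
  | succ m hm ih =>
    rw [Finset.sum_Ioc_succ_top (by omega), mul_add]
    have hm' : h * p + c ≤ h * m + c := by gcongr
    have hlt : h * m + c < h * (m + 1 : ℕ) + c := by push_cast; linarith
    have := lt_powPrimitive_sub hs (hp.trans_le hm') hlt
    have he : h * ((m + 1 : ℕ) : ℝ) + c - (h * m + c) = h := by push_cast; ring
    rw [he] at this
    linarith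

lemma powPrimitive_lt_mul_sum_Ico {s h c : ℝ} (hs : 1 < s) (hh : 0 < h) {p m : ℕ}
    (hp : 0 < h * p + c) (hpm : p ≤ m) :
    powPrimitive s (h * (m + 1 : ℕ) + c) - powPrimitive s (h * p + c) <
      h * ((h * p + c) ^ (-s) + ∑ l ∈ Finset.Ioc p m, (h * l + c) ^ (-s)) := by
  have key : ∀ m : ℕ, p ≤ m → powPrimitive s (h * (m + 1 : ℕ) + c) - powPrimitive s (h * m + c) <
      h * (h * m + c) ^ (-s) := by
    intro m hm
    have hm' : h * p + c ≤ h * m + c := by gcongr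
    have hlt : h * m + c < h * (m + 1 : ℕ) + c := by push_cast; linarith
    have := powPrimitive_sub_lt hs (hp.trans_le hm') hlt
    have he : h * ((m + 1 : ℕ) : ℝ) + c - (h * m + c) = h := by push_cast; ring
    rwa [he] at this
  induction m, hpm using Nat.le_induction with
  | base => simpa using key p le_rfl
  | succ m hm ih =>
    rw [Finset.sum_Ioc_succ_top (by omega), ← add_assoc, mul_add]
    have := key (m + 1) (by omega)
    linarith

/-- The integral of `t ^ (-s)` from `1` to `√3`. -/
def sqrtThreeIntegral (s : ℝ) : ℝ := (1 - √3 ^ (1 - s)) / (s - 1)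

lemma one_lt_sqrt_three : (1 : ℝ) < √3 := by
  rw [Real.lt_sqrt (by norm_num)]; norm_num

/-- Scaling by `P` reduces the integral over `[P, √3 P]` to that over `[1, √3]`. -/
lemma powPrimitive_sqrt_three {s P : ℝ} (hs : 1 < s) (hP : 0 < P) :
    powPrimitive s (√3 * P) - powPrimitive s P = P ^ (1 - s) * sqrtThreeIntegral s := by
  rw [powPrimitive, powPrimitive, sqrtThreeIntegral, Real.mul_rpow (by positivity) hP.le]
  have h1 : 1 - s ≠ 0 := by linarith
  have h2 : s - 1 ≠ 0 := by linarith
  field_simp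
  ring

lemma rpow_neg_mul_rpow_one_sub {P s : ℝ} (hP : 0 < P) :
    P ^ (-s) * P ^ (1 - s) = P ^ (-(2 * s - 1)) := by
  rw [← Real.rpow_add hP]; congr 1; ring

lemma rpow_neg_mul_self {P s : ℝ} (hP : 0 < P) : P ^ (-s) * P ^ (-s) = P ^ (-(2 * s)) := by
  rw [← Real.rpow_add hP]; congr 1; ring

section progression

variable {s h c : ℝ} {p m : ℕ}

lemma progression_upper (hs : 1 < s) (hh : 0 < h) (hp : 0 < h * p + c) (hpm : p ≤ m)
    (hm : h * m + c < √3 * (h * p + c)) :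
    (h * p + c) ^ (-s) * ∑ l ∈ Finset.Ioc p m, (h * l + c) ^ (-s) <
      sqrtThreeIntegral s / h * (h * p + c) ^ (-(2 * s - 1)) := by
  have hm' : h * p + c ≤ h * m + c := by gcongr
  have h1 := mul_sum_Ioc_le_powPrimitive hs hh hp hpm
  have h2 := powPrimitive_lt hs (hp.trans_le hm') hm
  have h3 := powPrimitive_sqrt_three hs hp
  have h4 : ∑ l ∈ Finset.Ioc p m, (h * l + c) ^ (-s) <
      (h * p + c) ^ (1 - s) * sqrtThreeIntegral s / h := by
    rw [lt_div_iff₀ hh]; linarith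
  refine (mul_lt_mul_of_pos_left h4 (Real.rpow_pos_of_pos hp _)).trans_eq ?_
  rw [← rpow_neg_mul_rpow_one_sub hp]
  ring

/-- The sum over left endpoints exceeds the integral but contains the term `l = p`, which the inner
sum omits; multiplied by the outer factor, that term is the subtracted `(h * p + c) ^ (-(2 * s))`.
-/
lemma progression_lower (hs : 1 < s) (hh : 0 < h) (hp : 0 < h * p + c) (hpm : p ≤ m)
    (hm : √3 * (h * p + c) ≤ h * (m + 1 : ℕ) + c) :
    sqrtThreeIntegral s / h * (h * p + c) ^ (-(2 * s - 1)) - (h * p + c) ^ (-(2 * s)) <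
      (h * p + c) ^ (-s) * ∑ l ∈ Finset.Ioc p m, (h * l + c) ^ (-s) := by
  have h1 := powPrimitive_lt_mul_sum_Ico hs hh hp hpm
  have hpos : 0 < √3 * (h * p + c) := by positivity
  have h2 : powPrimitive s (√3 * (h * p + c)) ≤ powPrimitive s (h * (m + 1 : ℕ) + c) := by
    rcases hm.eq_or_lt with h | h
    · rw [h]
    · exact (powPrimitive_lt hs hpos h).le
  have h3 := powPrimitive_sqrt_three hs hp
  have h4 : (h * p + c) ^ (1 - s) * sqrtThreeIntegral s / h - (h * p + c) ^ (-s) <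
      ∑ l ∈ Finset.Ioc p m, (h * l + c) ^ (-s) := by
    rw [sub_lt_iff_lt_add, div_lt_iff₀ hh]; linarith
  refine lt_of_eq_of_lt ?_ (mul_lt_mul_of_pos_left h4 (Real.rpow_pos_of_pos hp (-s)))
  rw [mul_sub, rpow_neg_mul_self hp, ← rpow_neg_mul_rpow_one_sub hp]
  ring

end progression

/-- The real version of `innerEven`. -/
def realInnerEven (s : ℝ) (p : ℕ) : ℝ :=
  (p : ℝ) ^ (-s) * ∑ q ∈ Finset.Ioo p ⌈√3 * (p : ℝ)⌉₊, (q : ℝ) ^ (-s)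

/-- The real version of `innerOdd`. -/
def realInnerOdd (s : ℝ) (k : ℕ) : ℝ :=
  (2 * (k : ℝ) + 1) ^ (-s) * ∑ l ∈ Finset.Ioo k ⌈√3 * (k : ℝ) + (√3 - 1) / 2⌉₊,
    (2 * (l : ℝ) + 1) ^ (-s)

lemma one_div_cpow_eq_ofReal {x : ℝ} (hx : 0 ≤ x) (s : ℝ) :
    1 / (x : ℂ) ^ (s : ℂ) = ((x ^ (-s) : ℝ) : ℂ) := by
  rw [Real.rpow_neg hx, Complex.ofReal_inv, Complex.ofReal_cpow hx, one_div]

lemma innerEven_ofReal (s : ℝ) (p : ℕ) : innerEven s p = (realInnerEven s p : ℂ) := by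
  rw [innerEven, realInnerEven, Finset.mul_sum, Complex.ofReal_sum]
  refine Finset.sum_congr rfl fun q _ => ?_
  rw [Complex.ofReal_mul, ← one_div_cpow_eq_ofReal p.cast_nonneg,
    ← one_div_cpow_eq_ofReal q.cast_nonneg]
  push_cast
  rw [div_mul_div_comm, one_mul]

lemma innerOdd_ofReal (s : ℝ) (k : ℕ) : innerOdd s k = (realInnerOdd s k : ℂ) := by
  rw [innerOdd, realInnerOdd, Finset.mul_sum, Complex.ofReal_sum]
  refine Finset.sum_congr rfl fun q _ => ?_
  rw [Complex.ofReal_mul, ← one_div_cpow_eq_ofReal (by positivity),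
    ← one_div_cpow_eq_ofReal (by positivity)]
  push_cast
  rw [div_mul_div_comm, one_mul]

/-- The number `m` is the largest integer strictly below `x`, so `m + 1` already reaches `x`. -/
lemma Ioo_ceil_eq {x : ℝ} {p : ℕ} (hx : (p : ℝ) < x) :
    ∃ m : ℕ, p ≤ m ∧ (m : ℝ) < x ∧ x ≤ (m + 1 : ℕ) ∧ Finset.Ioo p ⌈x⌉₊ = Finset.Ioc p m := by
  have h := Nat.lt_ceil.2 hx
  refine ⟨⌈x⌉₊ - 1, by omega, Nat.lt_ceil.1 (by omega), ?_, ?_⟩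
  · rw [Nat.sub_add_cancel (by omega)]; exact Nat.le_ceil x
  · ext a; simp only [Finset.mem_Ioo, Finset.mem_Ioc]; omega

lemma realInnerEven_bounds {s : ℝ} (hs : 1 < s) {p : ℕ} (hp : p ≠ 0) :
    sqrtThreeIntegral s * (p : ℝ) ^ (-(2 * s - 1)) - (p : ℝ) ^ (-(2 * s)) < realInnerEven s p ∧
      realInnerEven s p < sqrtThreeIntegral s * (p : ℝ) ^ (-(2 * s - 1)) := by
  have hp' : (0 : ℝ) < p := by positivity
  obtain ⟨m, hpm, h1, h2, h3⟩ := Ioo_ceil_eq (p := p) (x := √3 * p)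
    (by nlinarith [one_lt_sqrt_three])
  have hu := progression_upper (h := 1) (c := 0) (p := p) (m := m) hs one_pos (by linarith) hpm
    (by simpa)
  have hl := progression_lower (h := 1) (c := 0) (p := p) (m := m) hs one_pos (by linarith) hpm
    (by simpa using h2)
  simp only [one_mul, add_zero, div_one] at hu hl
  rw [realInnerEven, h3]
  exact ⟨hl, hu⟩

lemma realInnerOdd_bounds {s : ℝ} (hs : 1 < s) (k : ℕ) :
    sqrtThreeIntegral s / 2 * (2 * (k : ℝ) + 1) ^ (-(2 * s - 1)) - (2 * (k : ℝ) + 1) ^ (-(2 * s)) <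
        realInnerOdd s k ∧
      realInnerOdd s k < sqrtThreeIntegral s / 2 * (2 * (k : ℝ) + 1) ^ (-(2 * s - 1)) := by
  have hk : (0 : ℝ) ≤ k := by positivity
  obtain ⟨m, hpm, h1, h2, h3⟩ := Ioo_ceil_eq (p := k) (x := √3 * (k : ℝ) + (√3 - 1) / 2)
    (by nlinarith [one_lt_sqrt_three])
  have hu := progression_upper (h := 2) (c := 1) (p := k) (m := m) hs two_pos (by positivity) hpm
    (by linarith)
  have hl := progression_lower (h := 2) (c := 1) (p := k) (m := m) hs two_pos (by positivity) hpm
    (by linarith)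
  rw [realInnerOdd, h3]
  exact ⟨hl, hu⟩

/-- The zeta function at real arguments. -/
def realZeta (t : ℝ) : ℝ := ∑' n : ℕ, (n : ℝ) ^ (-t)

lemma summable_natCast_rpow_neg {t : ℝ} (ht : 1 < t) : Summable fun n : ℕ => (n : ℝ) ^ (-t) :=
  Real.summable_nat_rpow.2 (by linarith)

lemma riemannZeta_ofReal {t : ℝ} (ht : 1 < t) : riemannZeta t = (realZeta t : ℂ) := by
  rw [zeta_eq_tsum_one_div_nat_cpow (by simpa), realZeta, Complex.ofReal_tsum]
  refine tsum_congr fun n => ?_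
  rw [← one_div_cpow_eq_ofReal n.cast_nonneg, Complex.ofReal_natCast]

lemma realZeta_pos {t : ℝ} (ht : 1 < t) : 0 < realZeta t :=
  (summable_natCast_rpow_neg ht).tsum_pos (fun n => by positivity) 1 (by simp)

lemma hasSum_odd_rpow_neg {t : ℝ} (ht : 1 < t) :
    HasSum (fun k : ℕ => (2 * (k : ℝ) + 1) ^ (-t)) ((1 - 2 ^ (-t)) * realZeta t) := by
  have h := summable_natCast_rpow_neg ht
  have h0 : Summable fun k : ℕ => ((2 * k + 1 : ℕ) : ℝ) ^ (-t) :=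
    h.comp_injective (i := fun k : ℕ => 2 * k + 1) fun a b hab => by simpa using hab
  have h1 : Summable fun k : ℕ => ((2 * k : ℕ) : ℝ) ^ (-t) :=
    h.comp_injective (i := fun k : ℕ => 2 * k) fun a b hab => by simpa using hab
  have h2 : _ = realZeta t := tsum_even_add_odd (f := fun n : ℕ => (n : ℝ) ^ (-t)) h1 h0
  have h3 : ∑' k : ℕ, ((2 * k : ℕ) : ℝ) ^ (-t) = 2 ^ (-t) * realZeta t := by
    rw [realZeta, ← tsum_mul_left]
    refine tsum_congr fun n => ?_
    rw [Nat.cast_mul, Real.mul_rpow (by positivity) (by positivity), Nat.cast_ofNat]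
  have h4 : (1 - 2 ^ (-t)) * realZeta t = ∑' k : ℕ, ((2 * k + 1 : ℕ) : ℝ) ^ (-t) := by
    rw [h3] at h2
    linarith
  rw [h4]
  simpa only [Nat.cast_add, Nat.cast_mul, Nat.cast_ofNat, Nat.cast_one] using h0.hasSum

lemma summable_realInnerEven {s : ℝ} (hs : 1 < s) : Summable (realInnerEven s) := by
  have := summable_innerEven (s := (s : ℂ)) (by simpa)
  rw [← Complex.summable_ofReal]
  exact this.congr fun p => (innerEven_ofReal s p)

lemma summable_realInnerOdd {s : ℝ} (hs : 1 < s) : Summable (realInnerOdd s) := by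
  have := summable_innerOdd (s := (s : ℂ)) (by simpa)
  rw [← Complex.summable_ofReal]
  exact this.congr fun p => (innerOdd_ofReal s p)

lemma realInnerEven_zero (s : ℝ) : realInnerEven s 0 = 0 := by simp [realInnerEven]

lemma tsum_realInnerEven_bounds {s : ℝ} (hs : 1 < s) :
    sqrtThreeIntegral s * realZeta (2 * s - 1) - realZeta (2 * s) < ∑' p, realInnerEven s p ∧
      ∑' p, realInnerEven s p < sqrtThreeIntegral s * realZeta (2 * s - 1) := by
  have h1 := (summable_natCast_rpow_neg (t := 2 * s - 1) (by linarith)).hasSum.mul_left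
    (sqrtThreeIntegral s)
  have h2 := (summable_natCast_rpow_neg (t := 2 * s) (by linarith)).hasSum
  have h3 := (summable_realInnerEven hs).hasSum
  have e1 : (-(2 * s - 1)) ≠ 0 := by linarith
  have e2 : (-(2 * s)) ≠ 0 := by linarith
  -- The termwise bounds hold for `p ≥ 1`. At `p = 0` everything vanishes, the exponents being
  -- nonzero.
  refine ⟨hasSum_lt (i := 1) (fun p => ?_) ?_ (h1.sub h2) h3, hasSum_lt (i := 1) (fun p => ?_) ?_ h3 h1⟩
  · rcases eq_or_ne p 0 with rfl | hp
    · rw [realInnerEven_zero, Nat.cast_zero, Real.zero_rpow e1, Real.zero_rpow e2]; simp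
    · exact (realInnerEven_bounds hs hp).1.le
  · exact (realInnerEven_bounds hs one_ne_zero).1
  · rcases eq_or_ne p 0 with rfl | hp
    · rw [realInnerEven_zero, Nat.cast_zero, Real.zero_rpow e1]; simp
    · exact (realInnerEven_bounds hs hp).2.le
  · exact (realInnerEven_bounds hs one_ne_zero).2

lemma tsum_realInnerOdd_bounds {s : ℝ} (hs : 1 < s) :
    sqrtThreeIntegral s / 2 * ((1 - 2 ^ (-(2 * s - 1))) * realZeta (2 * s - 1)) -
        (1 - 2 ^ (-(2 * s))) * realZeta (2 * s) < ∑' k, realInnerOdd s k ∧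
      ∑' k, realInnerOdd s k <
        sqrtThreeIntegral s / 2 * ((1 - 2 ^ (-(2 * s - 1))) * realZeta (2 * s - 1)) := by
  have h1 := (hasSum_odd_rpow_neg (t := 2 * s - 1) (by linarith)).mul_left
    (sqrtThreeIntegral s / 2)
  have h2 := hasSum_odd_rpow_neg (t := 2 * s) (by linarith)
  have h3 := (summable_realInnerOdd hs).hasSum
  exact ⟨hasSum_lt (i := 0) (fun k => (realInnerOdd_bounds hs k).1.le)
    (realInnerOdd_bounds hs 0).1 (h1.sub h2) h3,
    hasSum_lt (i := 0) (fun k => (realInnerOdd_bounds hs k).2.le)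
    (realInnerOdd_bounds hs 0).2 h3 h1⟩

lemma sSqPr_one : sSqPr 1 = 1 := by
  have h := sSq_eq_sum_sSqPr 1
  rw [sSq_one] at h
  simpa using h.symm

/-- Strict positivity, from the term `n = 1`, is needed to multiply the strict inequalities by this
value. -/
lemma exists_phiSqPr_eq_ofReal {s : ℝ} (hs : 1 < s) : ∃ r : ℝ, 0 < r ∧ PhiSqPr s = r := by
  have h := lSeriesSummable_sSqPr (s := (s : ℂ)) (by simpa)
  have ht : ∀ n, LSeries.term (fun n => (sSqPr n : ℂ)) s n =
      ((sSqPr n * (n : ℝ) ^ (-s) : ℝ) : ℂ) := by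
    intro n
    rcases eq_or_ne n 0 with rfl | hn
    · simp [sSqPr_zero]
    · rw [LSeries.term_of_ne_zero hn, Complex.ofReal_mul, ← one_div_cpow_eq_ofReal n.cast_nonneg]
      push_cast
      rw [mul_one_div]
  rw [LSeriesSummable, funext ht, Complex.summable_ofReal] at h
  refine ⟨∑' n, (sSqPr n * (n : ℝ) ^ (-s)), h.tsum_pos (fun n => by positivity) 1 ?_, ?_⟩
  · simp [sSqPr_one]
  · rw [PhiSqPr, dirichletSeries, LSeries, Complex.ofReal_tsum]
    exact tsum_congr ht

/-- Everything is expressed through `a = 2 ^ (-s)`, after which only rational identities in `a`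
remain. -/
theorem phiWr_bounds {s : ℝ} (hs : 1 < s) :
    DSq s - PhiSq s < PhiWr s ∧ PhiWr s < DSq s + PhiSq s := by
  have hs' : 1 < (s : ℂ).re := by simpa
  obtain ⟨r, hr, hpr⟩ := exists_phiSqPr_eq_ofReal hs
  obtain ⟨e1, e2⟩ := tsum_realInnerEven_bounds hs
  obtain ⟨o1, o2⟩ := tsum_realInnerOdd_bounds hs
  set E := ∑' p, realInnerEven s p with hE
  set O := ∑' k, realInnerOdd s k with hO
  set I := sqrtThreeIntegral s
  set z₁ := realZeta (2 * s - 1) with hz₁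
  set z₂ := realZeta (2 * s) with hz₂
  have hz₂pos : 0 < z₂ := realZeta_pos (by linarith)
  set a : ℝ := 2 ^ (-s) with ha
  have ha0 : 0 < a := by positivity
  have hpow : (2 : ℝ) ^ s = a⁻¹ := by rw [ha, Real.rpow_neg two_pos.le, inv_inv]
  have hpow1 : (2 : ℝ) ^ (-(2 * s - 1)) = 2 * a ^ 2 := by
    rw [← rpow_neg_mul_rpow_one_sub two_pos, Real.rpow_sub two_pos, hpow, Real.rpow_one,
      ← ha]
    field_simp
  have hpow2 : (2 : ℝ) ^ (-(2 * s)) = a ^ 2 := by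
    rw [← rpow_neg_mul_self two_pos, sq]
  rw [hpow1] at o1 o2
  rw [hpow2] at o1
  have c2 : (2 : ℂ) ^ (s : ℂ) = ((a⁻¹ : ℝ) : ℂ) := by
    rw [← hpow, Complex.ofReal_cpow two_pos.le, Complex.ofReal_ofNat]
  have c2' : (2 : ℂ) ^ (-(s : ℂ)) = (a : ℂ) := by
    rw [Complex.cpow_neg, c2]; simp
  have cz2 : riemannZeta (2 * (s : ℂ)) = (z₂ : ℂ) := by
    rw [← riemannZeta_ofReal (by linarith)]; simp
  have cz1 : riemannZeta (2 * (s : ℂ) - 1) = (z₁ : ℂ) := by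
    rw [← riemannZeta_ofReal (by linarith)]; simp
  have hsq : PhiSq s = ((z₂ * r : ℝ) : ℂ) := by
    rw [phiSq_eq hs', hpr, cz2, Complex.ofReal_mul]
  have hev : PhiEven s = ((2 * a * r * E : ℝ) : ℂ) := by
    rw [PhiEven, hpr, c2, tsum_congr (innerEven_ofReal s), ← Complex.ofReal_tsum, ← hE]
    push_cast
    rw [div_inv_eq_mul]
  have hod : PhiOdd s = ((2 / (1 + a) * r * O : ℝ) : ℂ) := by
    rw [PhiOdd, hpr, c2', tsum_congr (innerOdd_ofReal s), ← Complex.ofReal_tsum, ← hO]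
    push_cast
    rfl
  have hI : (1 - ((√3 : ℝ) : ℂ) ^ (1 - (s : ℂ))) / ((s : ℂ) - 1) = (I : ℂ) := by
    have : (1 - (s : ℂ)) = ((1 - s : ℝ) : ℂ) := by push_cast; rfl
    rw [this, ← Complex.ofReal_cpow (by positivity)]
    simp only [I, sqrtThreeIntegral]
    push_cast
    rfl
  have hD : DSq s = (((1 + 2 * a) / (1 + a) * I * r * z₁ : ℝ) : ℂ) := by
    have hL : LChi s / riemannZeta (2 * s) * riemannZeta s = r := by
      have h1 : PhiSq s = riemannZeta s * LChi s := (lSeriesHasSum_sSq hs').LSeries_eq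
      rw [hsq] at h1
      rw [div_mul_eq_mul_div, mul_comm, ← h1, cz2]
      push_cast
      rw [mul_div_cancel_left₀]
      exact_mod_cast hz₂pos.ne'
    rw [DSq, hI, mul_assoc _ _ (riemannZeta s), hL, c2, cz1]
    have : (2 + a⁻¹) / (1 + a⁻¹) = (1 + 2 * a) / (1 + a) := by
      field_simp
      ring
    rw [← this]
    push_cast
    rfl
  -- The main terms add up because `2a + (1 - 2a²) / (1 + a) = (1 + 2a) / (1 + a)`.
  have hup : 2 * a * E + 2 / (1 + a) * O < (1 + 2 * a) / (1 + a) * I * z₁ := by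
    have : (1 + 2 * a) / (1 + a) * I * z₁ =
        2 * a * (I * z₁) + 2 / (1 + a) * (I / 2 * ((1 - 2 * a ^ 2) * z₁)) := by
      field_simp
      ring
    rw [this]
    gcongr
  -- The errors add up to `2a + 2 (1 - a²) / (1 + a) = 2` times `z₂`, that is, to `2 PhiSq` after
  -- multiplication by `r`.
  have hlo : (1 + 2 * a) / (1 + a) * I * z₁ - 2 * z₂ < 2 * a * E + 2 / (1 + a) * O := by
    have : (1 + 2 * a) / (1 + a) * I * z₁ - 2 * z₂ = 2 * a * (I * z₁ - z₂) +
        2 / (1 + a) * (I / 2 * ((1 - 2 * a ^ 2) * z₁) - (1 - a ^ 2) * z₂) := by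
      field_simp
      ring
    rw [this]
    gcongr
  have h1 := mul_lt_mul_of_pos_left hup hr
  have h2 := mul_lt_mul_of_pos_left hlo hr
  rw [phiWr_eq hs', hsq, hev, hod, hD]
  constructor
  · norm_cast
    linarith
  · norm_cast
    linarith

/-! ### Lattice points in a disc -/

open Filter Topology MeasureTheory

/-- The Gaussian integers in the open-closed quadrant of norm at most `N`. -/
def quadDisc (N : ℕ) : Finset GaussianInt := (Finset.Ioc 0 N).biUnion quadReps

lemma mem_quadDisc {N : ℕ} {z : GaussianInt} : z ∈ quadDisc N ↔ InQuad z ∧ z.norm ≤ N := by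
  rw [quadDisc, Finset.mem_biUnion]
  constructor
  · rintro ⟨n, hn, hz⟩
    rw [mem_quadReps] at hz
    rw [Finset.mem_Ioc] at hn
    exact ⟨hz.1, by rw [hz.2]; exact_mod_cast hn.2⟩
  · rintro ⟨h1, h2⟩
    have h3 := h1.norm_pos
    refine ⟨z.norm.toNat, Finset.mem_Ioc.2 ⟨by omega, by omega⟩, mem_quadReps.2 ⟨h1, by omega⟩⟩

lemma card_quadDisc (N : ℕ) : (quadDisc N).card = ∑ n ∈ Finset.Ioc 0 N, sSq n := by
  rw [quadDisc, Finset.card_biUnion]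
  · exact Finset.sum_congr rfl fun n _ => (sSq_eq_card n).symm
  · intro a _ b _ hab
    refine Finset.disjoint_left.2 fun z hz hz' => ?_
    rw [mem_quadReps] at hz hz'
    exact hab (by have := hz.2.symm.trans hz'.2; exact_mod_cast this)

/-- The Gaussian integers of norm at most `N`. -/
def latticeDisc (N : ℕ) : Finset GaussianInt :=
  insert 0 ((quadDisc N ∪ (quadDisc N).image fun z => gI * z) ∪
    ((quadDisc N).image (fun z => -z) ∪ (quadDisc N).image fun z => -(gI * z)))

lemma mem_latticeDisc {N : ℕ} {z : GaussianInt} : z ∈ latticeDisc N ↔ z.norm ≤ N := by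
  simp only [latticeDisc, Finset.mem_insert, Finset.mem_union, Finset.mem_image, mem_quadDisc]
  constructor
  · rintro (rfl | ((⟨-, h⟩ | ⟨w, ⟨-, h⟩, rfl⟩) | (⟨w, ⟨-, h⟩, rfl⟩ | ⟨w, ⟨-, h⟩, rfl⟩)))
    · simp
    · exact h
    · rwa [norm_gI_mul]
    · rwa [Zsqrtd.norm_neg]
    · rwa [Zsqrtd.norm_neg, norm_gI_mul]
  · intro h
    rcases eq_or_ne z 0 with rfl | hz
    · exact Or.inl rfl
    · obtain ⟨w, hw, rfl | rfl | rfl | rfl⟩ := exists_inQuad hz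
      · exact Or.inr (Or.inl (Or.inl ⟨hw, h⟩))
      · rw [norm_gI_mul] at h
        exact Or.inr (Or.inl (Or.inr ⟨w, ⟨hw, h⟩, rfl⟩))
      · rw [Zsqrtd.norm_neg] at h
        exact Or.inr (Or.inr (Or.inl ⟨w, ⟨hw, h⟩, rfl⟩))
      · rw [Zsqrtd.norm_neg, norm_gI_mul] at h
        exact Or.inr (Or.inr (Or.inr ⟨w, ⟨hw, h⟩, rfl⟩))

/-- The four rotated copies of the half-open quadrant are disjoint and cover all nonzero points; the
origin contributes the 1. -/
lemma card_latticeDisc (N : ℕ) :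
    (latticeDisc N).card = 4 * (∑ n ∈ Finset.Ioc 0 N, sSq n) + 1 := by
  have inj1 : Function.Injective fun z : GaussianInt => gI * z := fun a b h => by
    simpa [Zsqrtd.ext_iff, and_comm] using h
  have inj2 : Function.Injective fun z : GaussianInt => -(gI * z) := fun a b h =>
    inj1 (neg_injective h)
  rw [latticeDisc, Finset.card_insert_of_notMem, Finset.card_union_of_disjoint,
    Finset.card_union_of_disjoint, Finset.card_union_of_disjoint,
    Finset.card_image_of_injective _ inj1, Finset.card_image_of_injective _ neg_injective,
    Finset.card_image_of_injective _ inj2, card_quadDisc]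
  · ring
  · rw [Finset.disjoint_left]
    simp only [Finset.mem_image, mem_quadDisc, InQuad, not_exists, not_and]
    rintro _ ⟨w, ⟨⟨h1, h2⟩, -⟩, rfl⟩ v ⟨⟨h3, h4⟩, -⟩ h
    simp [Zsqrtd.ext_iff] at h
    omega
  · rw [Finset.disjoint_left]
    simp only [Finset.mem_image, mem_quadDisc, InQuad, not_exists, not_and]
    rintro z ⟨⟨h1, h2⟩, -⟩ v ⟨⟨h3, h4⟩, -⟩ h
    simp [Zsqrtd.ext_iff] at h
    omega
  · rw [Finset.disjoint_left]
    simp only [Finset.mem_union, Finset.mem_image, mem_quadDisc, InQuad, not_or, not_exists,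
      not_and]
    rintro _ (⟨⟨h1, h2⟩, -⟩ | ⟨w, ⟨⟨h1, h2⟩, -⟩, rfl⟩) <;>
      refine ⟨fun v hv h => ?_, fun v hv h => ?_⟩ <;>
      (simp [Zsqrtd.ext_iff] at h; omega)
  · simp only [Finset.mem_union, Finset.mem_image, mem_quadDisc, InQuad, not_or, not_exists,
      not_and]
    refine ⟨⟨by simp, fun v hv h => ?_⟩, fun v hv h => ?_, fun v hv h => ?_⟩ <;>
      (simp [Zsqrtd.ext_iff] at h; omega)

/-- The unit disc, in coordinates. -/
def unitDisc : Set (Fin 2 → ℝ) := {v | v 0 ^ 2 + v 1 ^ 2 ≤ 1}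

lemma unitDisc_eq : unitDisc = Complex.measurableEquivPi.symm ⁻¹' Metric.closedBall 0 1 := by
  ext v
  rw [Set.mem_preimage, mem_closedBall_zero_iff, ← sq_le_one_iff₀ (norm_nonneg _),
    ← Complex.normSq_eq_norm_sq, Complex.normSq_apply]
  simp [unitDisc, Complex.measurableEquivPi_symm_apply, sq]

lemma volume_unitDisc : volume.real unitDisc = Real.pi := by
  have h := (Complex.volume_preserving_equiv_pi.symm).measure_preimage
    (s := Metric.closedBall 0 1) Metric.isClosed_closedBall.measurableSet.nullMeasurableSet
  rw [unitDisc_eq, Measure.real, h, Complex.volume_closedBall]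
  simp

lemma isClosed_unitDisc : IsClosed unitDisc :=
  isClosed_le (by fun_prop) continuous_const

lemma convex_unitDisc : Convex ℝ unitDisc := by
  intro v hv w hw a b ha hb hab
  simp only [unitDisc, Set.mem_ofPred_eq, Pi.add_apply, Pi.smul_apply, smul_eq_mul] at *
  obtain rfl : b = 1 - a := by linarith
  nlinarith [mul_nonneg ha hb, sq_nonneg (v 0 - w 0), sq_nonneg (v 1 - w 1),
    mul_nonneg (mul_nonneg ha hb) (add_nonneg (sq_nonneg (v 0 - w 0)) (sq_nonneg (v 1 - w 1)))]

lemma isBounded_unitDisc : Bornology.IsBounded unitDisc := by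
  refine (Metric.isBounded_closedBall (x := 0) (r := 1)).subset fun v hv => ?_
  rw [mem_closedBall_zero_iff, pi_norm_le_iff_of_nonneg zero_le_one]
  simp only [unitDisc, Set.mem_ofPred_eq] at hv
  intro i
  rw [Real.norm_eq_abs, ← sq_le_one_iff_abs_le_one]
  fin_cases i
  · show v 0 ^ 2 ≤ 1
    nlinarith [sq_nonneg (v 1)]
  · show v 1 ^ 2 ≤ 1
    nlinarith [sq_nonneg (v 0)]

open scoped Pointwise in
lemma smul_unitDisc_mono ⦃x y : ℝ⦄ (hx : 0 < x) (hxy : x ≤ y) :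
    x • unitDisc ⊆ y • unitDisc := by
  have hy := hx.trans_le hxy
  rintro _ ⟨v, hv, rfl⟩
  refine ⟨(x / y) • v, ?_, ?_⟩
  · have h0 : (0 : Fin 2 → ℝ) ∈ unitDisc := by simp [unitDisc]
    exact convex_unitDisc.smul_mem_of_zero_mem h0 hv ⟨by positivity, (div_le_one hy).2 hxy⟩
  · simp only [smul_smul]
    rw [mul_div_cancel₀ _ hy.ne']

open scoped Pointwise in
lemma natCard_unitDisc_inter {N : ℕ} (hN : N ≠ 0) :
    Nat.card ↑(unitDisc ∩ (√(N : ℝ))⁻¹ •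
      (Submodule.span ℤ (Set.range (Pi.basisFun ℝ (Fin 2))) : Set (Fin 2 → ℝ))) =
      (latticeDisc N).card := by
  have hN0 : (0 : ℝ) < N := by positivity
  have hx : 0 < √(N : ℝ) := by positivity
  have hinj : Function.Injective
      (fun z : GaussianInt => (√(N : ℝ))⁻¹ • (![(z.re : ℝ), (z.im : ℝ)] : Fin 2 → ℝ)) := by
    intro a b h
    have h' := smul_right_injective _ (inv_ne_zero hx.ne') h
    have h0 := congrFun h' 0
    have h1 := congrFun h' 1
    simp [-GaussianInt.intCast_re, -GaussianInt.intCast_im] at h0 h1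
    exact Zsqrtd.ext h0 h1
  rw [← Finset.card_image_of_injective _ hinj, Nat.card_coe_set_eq, ← Set.ncard_coe_finset]
  congr 1
  ext v
  have hmem : ∀ z : GaussianInt, (√(N : ℝ))⁻¹ • (![(z.re : ℝ), (z.im : ℝ)] : Fin 2 → ℝ) ∈ unitDisc ↔
      z.norm ≤ N := by
    intro z
    have h1 : (((√(N : ℝ))⁻¹ * (z.re : ℝ)) ^ 2 + ((√(N : ℝ))⁻¹ * (z.im : ℝ)) ^ 2) =
        (z.norm : ℝ) / N := by
      rw [mul_pow, mul_pow, inv_pow, Real.sq_sqrt hN0.le, norm_eq]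
      push_cast
      field_simp
    have h2 : (√(N : ℝ))⁻¹ • (![(z.re : ℝ), (z.im : ℝ)] : Fin 2 → ℝ) ∈ unitDisc ↔
      (((√(N : ℝ))⁻¹ * (z.re : ℝ)) ^ 2 + ((√(N : ℝ))⁻¹ * (z.im : ℝ)) ^ 2) ≤ 1 := Iff.rfl
    rw [h2, h1, div_le_one hN0]
    exact_mod_cast Iff.rfl
  rw [Set.mem_inter_iff, Set.mem_inv_smul_set_iff₀ hx.ne', SetLike.mem_coe,
    Module.Basis.mem_span_iff_repr_mem, Finset.mem_coe, Finset.mem_image]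
  constructor
  · rintro ⟨h1, h2⟩
    obtain ⟨a, ha⟩ := h2 0
    obtain ⟨b, hb⟩ := h2 1
    have hv : (√(N : ℝ))⁻¹ • (![(a : ℝ), (b : ℝ)] : Fin 2 → ℝ) = v := by
      rw [inv_smul_eq_iff₀ hx.ne']
      ext i
      fin_cases i
      · simpa using ha
      · simpa using hb
    refine ⟨⟨a, b⟩, ?_, hv⟩
    rw [mem_latticeDisc, ← hmem]
    show (√(N : ℝ))⁻¹ • (![(a : ℝ), (b : ℝ)] : Fin 2 → ℝ) ∈ unitDisc
    rwa [hv]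
  · rintro ⟨z, hz, rfl⟩
    refine ⟨(hmem z).2 (mem_latticeDisc.1 hz), ?_⟩
    rw [smul_inv_smul₀ hx.ne']
    intro i
    fin_cases i
    · exact ⟨z.re, by simp [-GaussianInt.intCast_re]⟩
    · exact ⟨z.im, by simp [-GaussianInt.intCast_im]⟩

/-- The number of points of `ℤ²` in the disc of radius `√N` is asymptotic to its area `π N`, and the
units account for the factor 4. -/
theorem tendsto_sum_sSq :
    Tendsto (fun N : ℕ => (∑ n ∈ Finset.Ioc 0 N, (sSq n : ℝ)) / N) atTop (𝓝 (Real.pi / 4)) := by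
  have h := tendsto_card_div_pow_atTop_volume' unitDisc isBounded_unitDisc
    isClosed_unitDisc.measurableSet (convex_unitDisc.addHaar_frontier _) smul_unitDisc_mono
  rw [volume_unitDisc] at h
  have h2 := h.comp (Real.tendsto_sqrt_atTop.comp tendsto_natCast_atTop_atTop)
  have h3 : Tendsto (fun N : ℕ => (4 * (∑ n ∈ Finset.Ioc 0 N, (sSq n : ℝ)) + 1) / N) atTop
      (𝓝 Real.pi) := by
    refine h2.congr' ?_
    filter_upwards [eventually_ne_atTop 0] with N hN
    simp only [Function.comp]
    rw [natCard_unitDisc_inter hN, card_latticeDisc, Fintype.card_fin,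
      Real.sq_sqrt N.cast_nonneg]
    push_cast
    rfl
  have h4 : Tendsto (fun N : ℕ => (1 : ℝ) / N) atTop (𝓝 0) := tendsto_one_div_atTop_nhds_zero_nat
  have h5 := (h3.sub h4).div_const 4
  rw [sub_zero] at h5
  refine h5.congr fun N => ?_
  rw [← sub_div, add_sub_cancel_right]
  ring

/-! ### Mean values of convolutions -/

/-- Summation over the hyperbolic region `p q ≤ N`. -/
lemma sum_Ioc_divisorsAntidiagonal {M : Type*} [AddCommMonoid M] (F : ℕ × ℕ → M) (N : ℕ) :
    ∑ n ∈ Finset.Ioc 0 N, ∑ x ∈ n.divisorsAntidiagonal, F x =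
      ∑ p ∈ Finset.Ioc 0 N, ∑ q ∈ Finset.Ioc 0 (N / p), F (p, q) := by
  rw [Finset.sum_sigma', Finset.sum_sigma']
  refine Finset.sum_nbij' (fun x => ⟨x.2.1, x.2.2⟩) (fun x => ⟨x.1 * x.2, (x.1, x.2)⟩)
    ?_ ?_ ?_ ?_ ?_
  · rintro ⟨n, p, q⟩ h
    simp only [Finset.mem_sigma, Finset.mem_Ioc, Nat.mem_divisorsAntidiagonal] at h ⊢
    obtain ⟨⟨h1, h2⟩, rfl, h3⟩ := h
    have hp := Nat.pos_of_ne_zero (left_ne_zero_of_mul h3)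
    have hq := Nat.pos_of_ne_zero (right_ne_zero_of_mul h3)
    exact ⟨⟨hp, (Nat.le_mul_of_pos_right p hq).trans h2⟩, hq,
      (Nat.le_div_iff_mul_le hp).2 (by rwa [mul_comm])⟩
  · rintro ⟨p, q⟩ h
    simp only [Finset.mem_sigma, Finset.mem_Ioc, Nat.mem_divisorsAntidiagonal] at h ⊢
    obtain ⟨⟨h1, h2⟩, h3, h4⟩ := h
    rw [Nat.le_div_iff_mul_le h1, mul_comm] at h4
    exact ⟨⟨Nat.mul_pos h1 h3, h4⟩, trivial, (Nat.mul_pos h1 h3).ne'⟩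
  · rintro ⟨n, p, q⟩ h
    simp only [Finset.mem_sigma, Finset.mem_Ioc, Nat.mem_divisorsAntidiagonal] at h
    obtain ⟨-, rfl, -⟩ := h
    rfl
  · rintro ⟨p, q⟩ _
    rfl
  · rintro ⟨n, p, q⟩ _
    rfl

/-- The summatory function. -/
def partialSum (f : ℕ → ℝ) (N : ℕ) : ℝ := ∑ n ∈ Finset.Ioc 0 N, f n

@[simp] lemma partialSum_zero (f : ℕ → ℝ) : partialSum f 0 = 0 := by simp [partialSum]

lemma partialSum_succ (f : ℕ → ℝ) (N : ℕ) : partialSum f (N + 1) = partialSum f N + f (N + 1) :=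
  Finset.sum_Ioc_succ_top (by omega) f

/-- The Dirichlet convolution of real functions. -/
def conv (f g : ℕ → ℝ) (n : ℕ) : ℝ := ∑ x ∈ n.divisorsAntidiagonal, f x.1 * g x.2

lemma partialSum_conv (f g : ℕ → ℝ) (N : ℕ) :
    partialSum (conv f g) N = ∑ p ∈ Finset.Ioc 0 N, f p * partialSum g (N / p) := by
  rw [partialSum]
  simp only [conv]
  rw [sum_Ioc_divisorsAntidiagonal]
  simp only [partialSum, Finset.mul_sum]

lemma tendsto_natDiv_div (a : ℕ) :
    Tendsto (fun N : ℕ => ((N / a : ℕ) : ℝ) / N) atTop (𝓝 (1 / a)) := by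
  have h := (tendsto_nat_floor_mul_div_atTop (R := ℝ) (a := 1 / a) (by positivity)).comp
    tendsto_natCast_atTop_atTop
  refine h.congr fun N => ?_
  simp only [Function.comp]
  rw [one_div_mul_eq_div, Nat.floor_div_natCast, Nat.floor_natCast]

lemma tendsto_comp_natDiv {F : ℕ → ℝ} {c : ℝ} (hF : Tendsto (fun N : ℕ => F N / N) atTop (𝓝 c))
    (h0 : F 0 = 0) (a : ℕ) :
    Tendsto (fun N : ℕ => F (N / a) / N) atTop (𝓝 (c / a)) := by
  -- For `a = 0` division by zero gives 0 on both sides, as `F 0 = 0`.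
  rcases eq_or_ne a 0 with rfl | ha
  · simp [h0]
  · have h1 := (hF.comp (Nat.tendsto_div_const_atTop ha)).mul (tendsto_natDiv_div a)
    rw [mul_one_div] at h1
    refine h1.congr' ?_
    filter_upwards [eventually_ge_atTop a] with N hN
    have : 0 < N / a := Nat.div_pos hN (Nat.pos_of_ne_zero ha)
    simp only [Function.comp]
    rw [div_mul_div_cancel₀]
    positivity

lemma exists_forall_abs_le_mul {F : ℕ → ℝ} {c : ℝ}
    (hF : Tendsto (fun N : ℕ => F N / N) atTop (𝓝 c)) (h0 : F 0 = 0) :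
    ∃ C, 0 ≤ C ∧ ∀ N : ℕ, |F N| ≤ C * N := by
  obtain ⟨C, hC⟩ := hF.abs.bddAbove_range
  refine ⟨max C 0, le_max_right _ _, fun N => ?_⟩
  rcases eq_or_ne N 0 with rfl | hN
  · simp [h0]
  · have : |F N / N| ≤ C := hC ⟨N, rfl⟩
    have hN' : (0 : ℝ) < N := by positivity
    rw [abs_div, Nat.abs_cast, div_le_iff₀ hN'] at this
    exact this.trans (by gcongr; exact le_max_left _ _)

/-- Mean values of weighted sums of dilates. -/
lemma tendsto_tsum_natDiv {ι : Type*} {F : ℕ → ℝ} {c : ℝ}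
    (hF : Tendsto (fun N : ℕ => F N / N) atTop (𝓝 c)) (h0 : F 0 = 0) {h : ι → ℝ} {a : ι → ℕ}
    (hs : Summable fun i => |h i| / a i) :
    Tendsto (fun N : ℕ => (∑' i, h i * F (N / a i)) / N) atTop (𝓝 (c * ∑' i, h i / a i)) := by
  -- A bound linear in `N` for all `N`, not only large ones, makes the terms `F (N / a i) / N` at
  -- most `C / a i`, so dominated convergence applies.
  obtain ⟨C, hC0, hC⟩ := exists_forall_abs_le_mul hF h0
  have key := tendsto_tsum_of_dominated_convergence (𝓕 := atTop)
    (f := fun (N : ℕ) i => h i * (F (N / a i) / N)) (g := fun i => h i * (c / a i))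
    (bound := fun i => C * (|h i| / a i)) (hs.mul_left C)
    (fun i => (tendsto_comp_natDiv hF h0 (a i)).const_mul (h i)) ?_
  · rw [← tsum_mul_left]
    have e : (fun i => c * (h i / a i)) = fun i => h i * (c / a i) := by
      ext i; ring
    rw [e]
    refine key.congr fun N => ?_
    rw [← tsum_div_const]
    exact tsum_congr fun i => by ring
  · filter_upwards [eventually_gt_atTop 0] with N hN i
    have hN' : (0 : ℝ) < N := by positivity
    rw [Real.norm_eq_abs, abs_mul, abs_div, Nat.abs_cast]
    have h1 : |F (N / a i)| ≤ C * (N / a i) :=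
      (hC _).trans (by gcongr; exact Nat.cast_div_le)
    have h2 : |F (N / a i)| / N ≤ C / a i := by
      rw [div_le_iff₀ hN']
      exact h1.trans_eq (by ring)
    calc |h i| * (|F (N / a i)| / N) ≤ |h i| * (C / a i) := by gcongr
      _ = _ := by ring

/-- Asymptotics of the summatory function of a convolution in which one factor has a mean value
and the other a logarithmic mean value. -/
lemma tendsto_partialSum_conv_div_mul_log {f g : ℕ → ℝ} {c d : ℝ} (hg : ∀ n, 0 ≤ g n)
    (hf : Tendsto (fun N : ℕ => partialSum f N / N) atTop (𝓝 c))
    (hB : Tendsto (fun N : ℕ => (∑ m ∈ Finset.Ioc 0 N, g m / m) / Real.log N) atTop (𝓝 d))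
    (hG : Tendsto (fun N : ℕ => partialSum g N / (N * Real.log N)) atTop (𝓝 0)) :
    Tendsto (fun N : ℕ => partialSum (conv g f) N / (N * Real.log N)) atTop (𝓝 (c * d)) := by
  set F := partialSum f
  set G := partialSum g
  set B : ℕ → ℝ := fun N => ∑ m ∈ Finset.Ioc 0 N, g m / m with hBdef
  have hB0 : ∀ N, 0 ≤ B N := fun N => Finset.sum_nonneg fun m _ => div_nonneg (hg m) m.cast_nonneg
  have hG0 : ∀ N, 0 ≤ G N := fun N => Finset.sum_nonneg fun m _ => hg m
  have approx : ∀ ε > 0, ∃ K, 0 ≤ K ∧ ∀ k : ℕ, |F k - c * k| ≤ ε * k + K := by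
    intro ε hε
    obtain ⟨n₀, hn₀⟩ := Metric.tendsto_atTop.1 hf ε hε
    -- Beyond `n₀` the error is below `ε k`; the finitely many earlier values go into the constant.
    refine ⟨∑ k ∈ Finset.range n₀, |F k - c * k|, Finset.sum_nonneg fun k _ => abs_nonneg _,
      fun k => ?_⟩
    have hS : 0 ≤ ∑ k ∈ Finset.range n₀, |F k - c * k| :=
      Finset.sum_nonneg fun k _ => abs_nonneg _
    rcases lt_or_ge k n₀ with hk | hk
    · have := Finset.single_le_sum (f := fun k : ℕ => |F k - c * k|) (fun k _ => abs_nonneg _)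
        (Finset.mem_range.2 hk)
      have h2 : 0 ≤ ε * k := by positivity
      exact this.trans (by linarith)
    · rcases eq_or_ne k 0 with rfl | hk0
      · simpa [F] using hS
      have hk' : (0 : ℝ) < k := by positivity
      have h1 := hn₀ k hk
      rw [Real.dist_eq, div_sub' hk'.ne', abs_div, Nat.abs_cast, div_lt_iff₀ hk'] at h1
      rw [mul_comm c]
      linarith
  have bound : ∀ ε > 0, ∃ K, 0 ≤ K ∧ ∀ N : ℕ,
      |partialSum (conv g f) N - c * (N * B N)| ≤ ε * (N * B N) + K * G N := by
    intro ε hε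
    obtain ⟨K, hK, hk⟩ := approx ε hε
    -- The summand `|c|` pays for replacing the integer quotient `N / m` by the real one.
    refine ⟨K + |c|, by positivity, fun N => ?_⟩
    have e1 : (N : ℝ) * B N = ∑ m ∈ Finset.Ioc 0 N, g m * (N / m) := by
      rw [hBdef, Finset.mul_sum]
      exact Finset.sum_congr rfl fun m _ => by ring
    have e2 : G N = ∑ m ∈ Finset.Ioc 0 N, g m := rfl
    rw [partialSum_conv, e1, e2, Finset.mul_sum, Finset.mul_sum, Finset.mul_sum,
      ← Finset.sum_sub_distrib, ← Finset.sum_add_distrib]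
    refine (Finset.abs_sum_le_sum_abs _ _).trans (Finset.sum_le_sum fun m hm => ?_)
    rw [Finset.mem_Ioc] at hm
    have hm0 : (0 : ℝ) < m := by exact_mod_cast hm.1
    have h1 : ((N / m : ℕ) : ℝ) ≤ N / m := Nat.cast_div_le
    have h2 : (N : ℝ) / m - 1 ≤ ((N / m : ℕ) : ℝ) := by
      rw [sub_le_iff_le_add, div_le_iff₀ hm0, mul_comm]
      exact_mod_cast (Nat.lt_mul_div_succ N hm.1).le
    have h3 : |F (N / m) - c * (N / m)| ≤ ε * (N / m) + (K + |c|) := by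
      have h4 : F (N / m) - c * (N / m) =
          (F (N / m) - c * ((N / m : ℕ) : ℝ)) - c * ((N : ℝ) / m - ((N / m : ℕ) : ℝ)) := by ring
      rw [h4]
      refine (abs_sub _ _).trans ?_
      have h5 : |c * ((N : ℝ) / m - ((N / m : ℕ) : ℝ))| ≤ |c| := by
        rw [abs_mul]
        refine mul_le_of_le_one_right (abs_nonneg _) ?_
        rw [abs_le]
        constructor <;> linarith
      have h6 : ε * ((N / m : ℕ) : ℝ) ≤ ε * (N / m) := by gcongr
      linarith [hk (N / m)]
    have h7 : g m * F (N / m) - c * (g m * (N / m)) = g m * (F (N / m) - c * (N / m)) := by ring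
    rw [h7, abs_mul, abs_of_nonneg (hg m)]
    calc _ ≤ g m * (ε * (N / m) + (K + |c|)) := by gcongr; exact hg m
      _ = _ := by ring
  rw [tendsto_iff_norm_sub_tendsto_zero]
  have hlim : Tendsto (fun N : ℕ => c * (B N / Real.log N)) atTop (𝓝 (c * d)) := hB.const_mul c
  suffices h : Tendsto (fun N : ℕ => partialSum (conv g f) N / (N * Real.log N) -
      c * (B N / Real.log N)) atTop (𝓝 0) by
    have := (h.add hlim).sub_const (c * d)
    simpa using this.norm
  rw [Metric.tendsto_nhds]
  intro ε hε
  have hD : 0 < |d| + 1 := by positivity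
  -- Once `B N / log N < |d| + 1`, this choice keeps the first error term below `ε / 2`; the second
  -- one tends to 0 by `hG`.
  obtain ⟨K, hK, hbound⟩ := bound (ε / (2 * (|d| + 1))) (by positivity)
  have hKG := hG.const_mul K
  rw [mul_zero] at hKG
  filter_upwards [eventually_ge_atTop 2, hB.eventually_lt_const (lt_of_le_of_lt (le_abs_self d)
    (lt_add_one |d|)), hKG.eventually_lt_const (half_pos hε)] with N hN h1 h2
  have hN' : (1 : ℝ) < N := by exact_mod_cast hN
  have hN0 : (0 : ℝ) < N := by linarith
  have hL : 0 < Real.log N := Real.log_pos hN'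
  rw [dist_zero_right, Real.norm_eq_abs]
  have e : partialSum (conv g f) N / (N * Real.log N) - c * (B N / Real.log N) =
      (partialSum (conv g f) N - c * (N * B N)) / (N * Real.log N) := by
    field_simp
  rw [e, abs_div, abs_of_pos (mul_pos hN0 hL)]
  calc _ ≤ (ε / (2 * (|d| + 1)) * (N * B N) + K * G N) / (N * Real.log N) := by
        gcongr; exact hbound N
    _ = ε / (2 * (|d| + 1)) * (B N / Real.log N) + K * (G N / (N * Real.log N)) := by
        field_simp
    _ < ε / (2 * (|d| + 1)) * (|d| + 1) + ε / 2 := by gcongr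
    _ = ε := by field_simp; ring

/-! ### Mean values of similar and primitive sublattices -/

/-- The summatory function of `sSq`. -/
def sumSq : ℕ → ℝ := partialSum fun n => sSq n

/-- The summatory function of `sSqPr`. -/
def sumSqPr : ℕ → ℝ := partialSum fun n => sSqPr n

/-- The summatory function of `sSqPrOdd`. -/
def sumSqPrOdd : ℕ → ℝ := partialSum fun n => sSqPrOdd n

lemma tendsto_sumSq : Tendsto (fun N : ℕ => sumSq N / N) atTop (𝓝 (Real.pi / 4)) :=
  tendsto_sum_sSq

lemma div_sq_eq_zero_of_lt {N e : ℕ} (h : N < e) : N / e ^ 2 = 0 :=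
  Nat.div_eq_of_lt (h.trans_le (Nat.le_self_pow two_ne_zero e))

/-- Terms with `e ^ 2 > N` vanish, so any upper limit `M ≥ N` will do; this freedom is used in the
Möbius inversion. -/
lemma sumSq_eq_sum {N M : ℕ} (h : N ≤ M) :
    sumSq N = ∑ e ∈ Finset.Ioc 0 M, sumSqPr (N / e ^ 2) := by
  have h1 : (fun n => (sSq n : ℝ)) =
      conv (fun n => if IsSquare n then 1 else 0) fun n => (sSqPr n : ℝ) := by
    ext n
    rw [sSq_eq_sum_sSqPr, conv]
    push_cast
    rfl
  rw [sumSq, h1, partialSum_conv]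
  symm
  have hz : ∀ e ∈ Finset.Ioc 0 M, e ∉ Finset.Ioc 0 (Nat.sqrt N) → sumSqPr (N / e ^ 2) = 0 := by
    intro e he he'
    rw [Finset.mem_Ioc] at he he'
    have : N / e ^ 2 = 0 := Nat.div_eq_of_lt (Nat.sqrt_lt'.1 (by omega))
    rw [this, sumSqPr, partialSum_zero]
  rw [← Finset.sum_subset (Finset.Ioc_subset_Ioc_right ((Nat.sqrt_le_self N).trans h)) hz]
  refine Finset.sum_of_injOn (fun e => e ^ 2) ?_ ?_ ?_ ?_
  · intro a _ b _ hab
    exact Nat.pow_left_injective two_ne_zero hab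
  · intro e he
    simp only [Finset.coe_Ioc, Set.mem_Ioc] at he ⊢
    exact ⟨by have := he.1; positivity, Nat.le_sqrt'.1 he.2⟩
  · intro p hp hp'
    rw [if_neg, zero_mul]
    rintro ⟨r, rfl⟩
    rw [Finset.mem_Ioc] at hp
    refine hp' ⟨r, ?_, sq r⟩
    simp only [Finset.coe_Ioc, Set.mem_Ioc]
    exact ⟨Nat.pos_of_ne_zero (by rintro rfl; simp at hp), Nat.le_sqrt.2 hp.2⟩
  · intro e _
    rw [if_pos ⟨e, sq e⟩, one_mul]
    rfl

open ArithmeticFunction in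
lemma sum_divisorsAntidiagonal_moebius (n : ℕ) :
    ∑ x ∈ n.divisorsAntidiagonal, (moebius x.1 : ℝ) = if n = 1 then 1 else 0 := by
  have h := congrArg (fun f : ArithmeticFunction ℤ => f n) moebius_mul_coe_zeta
  simp only [coe_mul_zeta_apply, one_apply] at h
  rw [Nat.sum_divisorsAntidiagonal (f := fun i _ => (moebius i : ℝ))]
  exact_mod_cast h

open ArithmeticFunction in
lemma sumSqPr_eq_tsum (N : ℕ) :
    sumSqPr N = ∑' d : ℕ, (moebius d : ℝ) * sumSq (N / d ^ 2) := by
  rw [tsum_eq_sum (s := Finset.Ioc 0 N)]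
  · have h1 : ∀ d ∈ Finset.Ioc 0 N, (moebius d : ℝ) * sumSq (N / d ^ 2) =
        ∑ e ∈ Finset.Ioc 0 (N / d), (moebius d : ℝ) * sumSqPr (N / (d * e) ^ 2) := by
      intro d hd
      rw [Finset.mem_Ioc] at hd
      -- With the upper limit `N / d` the pairs `(d, e)` fill the hyperbolic region `d e ≤ N`, and
      -- the sum can be regrouped by `n = d e`, where the Möbius function leaves only `n = 1`.
      rw [sumSq_eq_sum (M := N / d) (Nat.div_le_div_left (Nat.le_self_pow two_ne_zero d) hd.1),
        Finset.mul_sum]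
      refine Finset.sum_congr rfl fun e _ => ?_
      rw [Nat.div_div_eq_div_mul, mul_pow]
    rw [Finset.sum_congr rfl h1, ← sum_Ioc_divisorsAntidiagonal
      (fun x => (moebius x.1 : ℝ) * sumSqPr (N / (x.1 * x.2) ^ 2))]
    have h2 : ∀ n ∈ Finset.Ioc 0 N, ∑ x ∈ n.divisorsAntidiagonal,
        (moebius x.1 : ℝ) * sumSqPr (N / (x.1 * x.2) ^ 2) =
        if n = 1 then sumSqPr N else 0 := by
      intro n _
      have : ∀ x ∈ n.divisorsAntidiagonal, (moebius x.1 : ℝ) * sumSqPr (N / (x.1 * x.2) ^ 2) =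
          (moebius x.1 : ℝ) * sumSqPr (N / n ^ 2) := fun x hx => by
        rw [(Nat.mem_divisorsAntidiagonal.1 hx).1]
      rw [Finset.sum_congr rfl this, ← Finset.sum_mul, sum_divisorsAntidiagonal_moebius]
      split_ifs with h
      · simp [h]
      · simp
    rw [Finset.sum_congr rfl h2, Finset.sum_ite_eq']
    split_ifs with h
    · rfl
    · have : N = 0 := by
        rw [Finset.mem_Ioc] at h
        omega
      rw [this, sumSqPr, partialSum_zero]
  · intro d hd
    rcases eq_or_ne d 0 with rfl | hd0
    · simp
    · have : N / d ^ 2 = 0 := div_sq_eq_zero_of_lt (by rw [Finset.mem_Ioc] at hd; omega)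
      rw [this, sumSq, partialSum_zero, mul_zero]

open ArithmeticFunction in
lemma summable_abs_moebius_div_sq : Summable fun d : ℕ => |(moebius d : ℝ)| / (d ^ 2 : ℕ) := by
  refine Summable.of_nonneg_of_le (fun d => by positivity) (fun d => ?_)
    (Real.summable_one_div_nat_pow.2 one_lt_two)
  push_cast
  gcongr
  exact_mod_cast abs_moebius_le_one

open ArithmeticFunction in
lemma tsum_moebius_div_sq : ∑' d : ℕ, (moebius d : ℝ) / (d ^ 2 : ℕ) = 6 / Real.pi ^ 2 := by
  have h2 : 1 < (2 : ℂ).re := by norm_num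
  have h := LSeries_zeta_mul_Lseries_moebius h2
  rw [LSeries_zeta_eq_riemannZeta h2, riemannZeta_two] at h
  have h3 : LSeries (fun n => (moebius n : ℂ)) 2 =
      ((∑' d : ℕ, (moebius d : ℝ) / (d ^ 2 : ℕ) : ℝ) : ℂ) := by
    rw [LSeries, Complex.ofReal_tsum]
    refine tsum_congr fun n => ?_
    rcases eq_or_ne n 0 with rfl | hn
    · simp
    · rw [LSeries.term_of_ne_zero hn]
      push_cast
      rw [Complex.cpow_ofNat]
  rw [h3] at h
  have h4 : Real.pi ^ 2 / 6 * ∑' d : ℕ, (moebius d : ℝ) / (d ^ 2 : ℕ) = 1 := by exact_mod_cast h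
  have hpi := Real.pi_pos
  rw [eq_div_iff (by positivity)]
  linarith

/-- The mean value is `π/4` divided by `ζ(2) = π²/6`. -/
theorem tendsto_sumSqPr :
    Tendsto (fun N : ℕ => sumSqPr N / N) atTop (𝓝 (3 / (2 * Real.pi))) := by
  have h := tendsto_tsum_natDiv tendsto_sumSq (partialSum_zero _)
    (h := fun d => (ArithmeticFunction.moebius d : ℝ)) (a := fun d => d ^ 2)
    summable_abs_moebius_div_sq
  rw [tsum_moebius_div_sq] at h
  have e : Real.pi / 4 * (6 / Real.pi ^ 2) = 3 / (2 * Real.pi) := by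
    have := Real.pi_pos
    field_simp
    norm_num
  rw [e] at h
  exact h.congr fun N => by rw [sumSqPr_eq_tsum]

lemma partialSum_onEvens (f : ℕ → ℝ) (N : ℕ) :
    partialSum (onEvens f) N = partialSum f (N / 2) := by
  have h : ∀ k, partialSum (onEvens f) (2 * k) = partialSum f k ∧
      partialSum (onEvens f) (2 * k + 1) = partialSum f k := by
    intro k
    induction k with
    | zero =>
      refine ⟨by simp, ?_⟩
      rw [partialSum_succ, onEvens_of_odd _ (by simp)]; simp
    | succ k ih =>
      have h1 : partialSum (onEvens f) (2 * (k + 1)) = partialSum f (k + 1) := by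
        have e : 2 * (k + 1) = 2 * k + 1 + 1 := by ring
        rw [e, partialSum_succ, ih.2, ← e, onEvens_two_mul, partialSum_succ]
      refine ⟨h1, ?_⟩
      rw [partialSum_succ, h1, onEvens_of_odd _ (odd_two_mul_add_one _), add_zero]
  rcases Nat.even_or_odd' N with ⟨k, rfl | rfl⟩
  · rw [(h k).1]; congr 1; omega
  · rw [(h k).2]; congr 1; omega

lemma sumSqPr_eq_add (N : ℕ) : sumSqPr N = sumSqPrOdd N + sumSqPrOdd (N / 2) := by
  have h : (fun n => (sSqPr n : ℝ)) =
      fun n => (sSqPrOdd n : ℝ) + onEvens (fun n => (sSqPrOdd n : ℝ)) n := by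
    ext n
    rw [sSqPr_eq_add, Nat.cast_add, onEvens, onEvens]
    split_ifs <;> simp
  rw [sumSqPrOdd, ← partialSum_onEvens, sumSqPr, h, partialSum, Finset.sum_add_distrib]
  rfl

/-- Iterated inversion of `sumSqPr N = sumSqPrOdd N + sumSqPrOdd (N / 2)`; the remainder vanishes
once `2 ^ K > N`. -/
lemma sumSqPrOdd_eq_sum (N K : ℕ) :
    sumSqPrOdd N = ∑ k ∈ Finset.range K, (-1) ^ k * sumSqPr (N / 2 ^ k) +
      (-1) ^ K * sumSqPrOdd (N / 2 ^ K) := by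
  induction K with
  | zero => simp
  | succ K ih =>
    rw [ih, Finset.sum_range_succ, sumSqPr_eq_add (N / 2 ^ K), Nat.div_div_eq_div_mul, ← pow_succ]
    ring

lemma sumSqPrOdd_eq_tsum (N : ℕ) :
    sumSqPrOdd N = ∑' k : ℕ, (-1) ^ k * sumSqPr (N / 2 ^ k) := by
  have hz : ∀ k, N ≤ k → N / 2 ^ k = 0 := fun k hk =>
    Nat.div_eq_of_lt (hk.trans_lt Nat.lt_two_pow_self)
  rw [tsum_eq_sum (s := Finset.range N)]
  · rw [sumSqPrOdd_eq_sum N N, hz N le_rfl, sumSqPrOdd, partialSum_zero, mul_zero, add_zero]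
  · intro k hk
    rw [hz k (by simpa using hk), sumSqPr, partialSum_zero, mul_zero]

/-- The mean value is `3/(2π)` divided by `1 + 1/2`, from the alternating geometric series. -/
theorem tendsto_sumSqPrOdd :
    Tendsto (fun N : ℕ => sumSqPrOdd N / N) atTop (𝓝 (1 / Real.pi)) := by
  have e1 : (fun k : ℕ => |(-1 : ℝ) ^ k| / (2 ^ k : ℕ)) = fun k : ℕ => (1 / 2 : ℝ) ^ k := by
    ext k
    rw [abs_pow, abs_neg, abs_one, one_pow, div_pow, one_pow]
    push_cast
    rfl
  have e2 : (fun k : ℕ => (-1 : ℝ) ^ k / (2 ^ k : ℕ)) = fun k : ℕ => (-1 / 2 : ℝ) ^ k := by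
    ext k
    rw [div_pow]
    push_cast
    rfl
  have h := tendsto_tsum_natDiv tendsto_sumSqPr (partialSum_zero _)
    (h := fun k : ℕ => (-1 : ℝ) ^ k) (a := fun k => 2 ^ k)
    (by rw [e1]; exact summable_geometric_of_lt_one (by norm_num) (by norm_num))
  rw [e2, tsum_geometric_of_abs_lt_one (by rw [abs_lt]; constructor <;> norm_num)] at h
  have e : 3 / (2 * Real.pi) * (1 - -1 / 2)⁻¹ = 1 / Real.pi := by
    have := Real.pi_pos
    field_simp
    norm_num
  rw [e] at h
  exact h.congr fun N => by rw [sumSqPrOdd_eq_tsum]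

/-! ### Logarithmic mean values of close factorizations -/

section progression

variable {h c : ℝ} {p m : ℕ}

lemma mul_inv_le_log {a b : ℝ} (ha : 0 < a) (hab : a ≤ b) : (b - a) * b⁻¹ ≤ Real.log b - Real.log a := by
  have hb := ha.trans_le hab
  have h := Real.one_sub_inv_le_log_of_pos (div_pos hb ha)
  rw [Real.log_div hb.ne' ha.ne', inv_div] at h
  refine le_of_eq_of_le ?_ h
  field_simp

lemma log_le_mul_inv {a b : ℝ} (ha : 0 < a) (hab : a ≤ b) : Real.log b - Real.log a ≤ (b - a) * a⁻¹ := by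
  have hb := ha.trans_le hab
  have h := Real.log_le_sub_one_of_pos (div_pos hb ha)
  rw [Real.log_div hb.ne' ha.ne'] at h
  refine h.trans_eq ?_
  field_simp

lemma mul_sum_Ioc_inv_le (hh : 0 < h) (hp : 0 < h * p + c) (hpm : p ≤ m) :
    h * ∑ l ∈ Finset.Ioc p m, (h * l + c)⁻¹ ≤ Real.log (h * m + c) - Real.log (h * p + c) := by
  induction m, hpm using Nat.le_induction with
  | base => simp
  | succ m hm ih =>
    rw [Finset.sum_Ioc_succ_top (by omega), mul_add]
    have hm' : h * p + c ≤ h * m + c := by gcongr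
    have hlt : h * m + c ≤ h * (m + 1 : ℕ) + c := by push_cast; linarith
    have := mul_inv_le_log (hp.trans_le hm') hlt
    have he : h * ((m + 1 : ℕ) : ℝ) + c - (h * m + c) = h := by push_cast; ring
    rw [he] at this
    linarith

lemma log_le_mul_sum_Ico_inv (hh : 0 < h) (hp : 0 < h * p + c) (hpm : p ≤ m) :
    Real.log (h * (m + 1 : ℕ) + c) - Real.log (h * p + c) ≤
      h * ((h * p + c)⁻¹ + ∑ l ∈ Finset.Ioc p m, (h * l + c)⁻¹) := by
  have key : ∀ m : ℕ, p ≤ m → Real.log (h * (m + 1 : ℕ) + c) - Real.log (h * m + c) ≤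
      h * (h * m + c)⁻¹ := by
    intro m hm
    have hm' : h * p + c ≤ h * m + c := by gcongr
    have hlt : h * m + c ≤ h * (m + 1 : ℕ) + c := by push_cast; linarith
    have := log_le_mul_inv (hp.trans_le hm') hlt
    have he : h * ((m + 1 : ℕ) : ℝ) + c - (h * m + c) = h := by push_cast; ring
    rwa [he] at this
  induction m, hpm using Nat.le_induction with
  | base => simpa using key p le_rfl
  | succ m hm ih =>
    rw [Finset.sum_Ioc_succ_top (by omega), ← add_assoc, mul_add]
    have := key (m + 1) (by omega)
    linarith

/-- The sum over right endpoints is at most `log √3 / h`, and adding the omitted term `(h * p +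
c)⁻¹` makes it at least that. -/
lemma abs_sum_Ioc_inv_sub_le (hh : 0 < h) (hp : 0 < h * p + c) (hpm : p ≤ m)
    (h1 : h * m + c < √3 * (h * p + c)) (h2 : √3 * (h * p + c) ≤ h * (m + 1 : ℕ) + c) :
    |∑ l ∈ Finset.Ioc p m, (h * l + c)⁻¹ - Real.log √3 / h| ≤ (h * p + c)⁻¹ := by
  have hm' : h * p + c ≤ h * m + c := by gcongr
  have hu := mul_sum_Ioc_inv_le hh hp hpm
  have hl := log_le_mul_sum_Ico_inv hh hp hpm
  have e : Real.log (√3 * (h * p + c)) = Real.log √3 + Real.log (h * p + c) :=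
    Real.log_mul (by positivity) hp.ne'
  have l1 := Real.log_le_log (hp.trans_le hm') h1.le
  have l2 := Real.log_le_log (by positivity) h2
  have hinv : 0 < (h * p + c)⁻¹ := by positivity
  rw [abs_le]
  constructor
  · rw [neg_le_sub_iff_le_add, div_le_iff₀ hh]
    linarith
  · have : ∑ l ∈ Finset.Ioc p m, (h * l + c)⁻¹ ≤ Real.log √3 / h := by
      rw [le_div_iff₀ hh]
      linarith
    linarith

end progression

/-- The sum of the reciprocals of all `q` with `(p, q)` in a set of close pairs. -/
def closeSum (S : ℕ × ℕ → Prop) (p : ℕ) : ℝ :=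
  open Classical in ∑ q ∈ (Finset.Ioo p (2 * p)).filter fun q => S (p, q), (q : ℝ)⁻¹

lemma IsClose.lt_two_mul {p q : ℕ} (h : IsClose (p, q)) : q < 2 * p := by
  have := h.2
  dsimp only at this
  nlinarith

lemma closeSum_isClose {p : ℕ} (hp : p ≠ 0) : |closeSum IsClose p - Real.log √3| ≤ (p : ℝ)⁻¹ := by
  classical
  have hp' : (0 : ℝ) < p := by positivity
  obtain ⟨m, hpm, h1, h2, h3⟩ := Ioo_ceil_eq (p := p) (x := √3 * p)
    (by nlinarith [one_lt_sqrt_three])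
  have h := abs_sum_Ioc_inv_sub_le (h := 1) (c := 0) (p := p) (m := m) one_pos (by linarith) hpm
    (by simpa) (by simpa using h2)
  simp only [one_mul, add_zero, div_one] at h
  have e : (Finset.Ioo p (2 * p)).filter (fun q => IsClose (p, q)) = Finset.Ioc p m := by
    rw [← h3]
    ext q
    rw [Finset.mem_filter, mem_Ioo_even_iff, Finset.mem_Ioo]
    exact ⟨fun h => h.2, fun h => ⟨⟨h.1, h.lt_two_mul⟩, h⟩⟩
  rw [closeSum, ← Finset.sum_congr e.symm fun _ _ => rfl]
  exact h

lemma closeSum_isCloseOdd (p : ℕ) :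
    |closeSum IsCloseOdd p - (if Odd p then 1 else 0) * (Real.log √3 / 2)| ≤ (p : ℝ)⁻¹ := by
  classical
  split_ifs with hodd
  · obtain ⟨k, rfl⟩ := hodd
    obtain ⟨m, hpm, h1, h2, h3⟩ := Ioo_ceil_eq (p := k) (x := √3 * (k : ℝ) + (√3 - 1) / 2)
      (by nlinarith [one_lt_sqrt_three, (k.cast_nonneg : (0 : ℝ) ≤ k)])
    have h := abs_sum_Ioc_inv_sub_le (h := 2) (c := 1) (p := k) (m := m) two_pos (by positivity)
      hpm (by linarith) (by linarith)
    have e : closeSum IsCloseOdd (2 * k + 1) = ∑ l ∈ Finset.Ioc k m, (2 * (l : ℝ) + 1)⁻¹ := by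
      rw [closeSum]
      symm
      refine Finset.sum_nbij (fun l => 2 * l + 1) ?_ ?_ ?_ ?_
      · intro l hl
        rw [← h3, mem_Ioo_odd_iff] at hl
        rw [Finset.mem_filter, Finset.mem_Ioo]
        exact ⟨⟨hl.1.1, hl.1.lt_two_mul⟩, hl⟩
      · intro a _ b _ hab
        simpa using hab
      · intro q hq
        rw [Finset.mem_coe, Finset.mem_filter] at hq
        obtain ⟨l, rfl⟩ := hq.2.2.2
        refine ⟨l, ?_, rfl⟩
        rw [Finset.mem_coe, ← h3, mem_Ioo_odd_iff]
        exact hq.2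
      · intro l _
        push_cast
        rfl
    rw [e, one_mul]
    push_cast
    exact h
  · have : closeSum IsCloseOdd p = 0 := by
      rw [closeSum, Finset.filter_eq_empty_iff.2, Finset.sum_empty]
      exact fun q _ h => hodd h.2.1
    rw [this]
    simp

lemma tendsto_div_log_of_abs_sub_le {u : ℕ → ℝ} {α C : ℝ}
    (h : ∀ᶠ N : ℕ in atTop, |u N - α * Real.log N| ≤ C) :
    Tendsto (fun N : ℕ => u N / Real.log N) atTop (𝓝 α) := by
  have hlog : Tendsto (fun N : ℕ => Real.log N) atTop atTop :=
    Real.tendsto_log_atTop.comp tendsto_natCast_atTop_atTop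
  have h0 : Tendsto (fun N : ℕ => C / Real.log N) atTop (𝓝 0) := hlog.const_div_atTop C
  rw [tendsto_iff_norm_sub_tendsto_zero]
  refine squeeze_zero' (Eventually.of_forall fun _ => norm_nonneg _) ?_ h0
  filter_upwards [h, hlog.eventually_gt_atTop 0] with N hN hpos
  rw [Real.norm_eq_abs, div_sub' hpos.ne', abs_div, abs_of_pos hpos, mul_comm]
  gcongr

lemma abs_sum_inv_sub_log_le {N : ℕ} (hN : N ≠ 0) :
    |∑ n ∈ Finset.Ioc 0 N, (n : ℝ)⁻¹ - Real.log N| ≤ 1 := by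
  have hN1 : 1 ≤ N := by omega
  have hs : ∑ n ∈ Finset.Ioc 0 N, (n : ℝ)⁻¹ = 1 + ∑ n ∈ Finset.Ioc 1 N, (n : ℝ)⁻¹ := by
    rw [← Finset.sum_Ioc_consecutive _ zero_le_one hN1, show Finset.Ioc 0 1 = {1} from rfl]
    simp
  have h1 := mul_sum_Ioc_inv_le (h := 1) (c := 0) (p := 1) (m := N) one_pos (by simp) hN1
  have h2 := log_le_mul_sum_Ico_inv (h := 1) (c := 0) (p := 1) (m := N) one_pos (by simp) hN1
  simp only [one_mul, add_zero, Nat.cast_one, Real.log_one, sub_zero, inv_one] at h1 h2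
  have h3 : Real.log N ≤ Real.log ((N + 1 : ℕ) : ℝ) :=
    Real.log_le_log (by positivity) (by push_cast; linarith)
  rw [abs_le]
  constructor <;> linarith

lemma tendsto_sum_inv_div_log :
    Tendsto (fun N : ℕ => (∑ n ∈ Finset.Ioc 0 N, (n : ℝ)⁻¹) / Real.log N) atTop (𝓝 1) := by
  refine tendsto_div_log_of_abs_sub_le (C := 1) ?_
  filter_upwards [eventually_ne_atTop 0] with N hN
  rw [one_mul]
  exact abs_sum_inv_sub_log_le hN

/-- The even terms up to `N` form half the harmonic sum up to `N / 2`. -/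
lemma sum_Ioc_odd_inv (N : ℕ) : ∑ n ∈ Finset.Ioc 0 N, (if Odd n then 1 else 0) * (n : ℝ)⁻¹ =
    ∑ n ∈ Finset.Ioc 0 N, (n : ℝ)⁻¹ - (1 / 2) * ∑ n ∈ Finset.Ioc 0 (N / 2), (n : ℝ)⁻¹ := by
  have h := partialSum_onEvens (fun n => (1 / 2) * (n : ℝ)⁻¹) N
  simp only [partialSum] at h
  rw [Finset.mul_sum, ← h, ← Finset.sum_sub_distrib]
  refine Finset.sum_congr rfl fun n _ => ?_
  rcases Nat.even_or_odd' n with ⟨k, rfl | rfl⟩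
  · rw [onEvens_two_mul, if_neg (by simp)]
    push_cast
    rw [mul_inv]
    ring
  · rw [onEvens_of_odd _ (odd_two_mul_add_one k), if_pos (odd_two_mul_add_one k)]
    ring

lemma tendsto_sum_odd_inv_div_log :
    Tendsto (fun N : ℕ => (∑ n ∈ Finset.Ioc 0 N, (if Odd n then 1 else 0) * (n : ℝ)⁻¹) /
      Real.log N) atTop (𝓝 (1 / 2)) := by
  -- The harmonic sum up to `N` contributes an error 1; half the one up to `N / 2` contributes `1/2`
  -- times `1 + log 3`, since `N ≤ 3 (N / 2)` for `N ≥ 2`.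
  refine tendsto_div_log_of_abs_sub_le (C := 1 + (1 / 2) * (1 + Real.log 3)) ?_
  filter_upwards [eventually_ge_atTop 2] with N hN
  have hN2 : N / 2 ≠ 0 := by omega
  have h1 := abs_sum_inv_sub_log_le (N := N) (by omega)
  have h2 := abs_sum_inv_sub_log_le hN2
  have h3 : Real.log ((N / 2 : ℕ) : ℝ) ≤ Real.log N :=
    Real.log_le_log (by positivity) (by exact_mod_cast Nat.div_le_self N 2)
  have h4 : Real.log N ≤ Real.log 3 + Real.log ((N / 2 : ℕ) : ℝ) := by
    rw [← Real.log_mul (by norm_num) (by positivity)]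
    refine Real.log_le_log (by positivity) ?_
    have : N ≤ 3 * (N / 2) := by omega
    exact_mod_cast this
  rw [sum_Ioc_odd_inv]
  rw [abs_le] at *
  constructor <;> linarith

/-- Here `u N` is within a constant factor of `√N`. The constant 8 has room for both roundings in
`Nat.sqrt (N / 2)`. -/
lemma tendsto_log_div_log_of_sq {u : ℕ → ℕ} (h1 : ∀ᶠ N in atTop, u N ^ 2 ≤ N)
    (h2 : ∀ᶠ N in atTop, N ≤ 8 * u N ^ 2) :
    Tendsto (fun N : ℕ => Real.log (u N) / Real.log N) atTop (𝓝 (1 / 2)) := by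
  refine tendsto_div_log_of_abs_sub_le (C := Real.log 8) ?_
  filter_upwards [h1, h2, eventually_gt_atTop 0] with N a b hN
  have hu : u N ≠ 0 := by
    rintro h
    rw [h] at b
    omega
  have hl : Real.log ((u N ^ 2 : ℕ) : ℝ) = 2 * Real.log (u N) := by
    push_cast
    rw [Real.log_pow]
    norm_num
  have c1 : 2 * Real.log (u N) ≤ Real.log N := by
    rw [← hl]
    exact Real.log_le_log (by positivity) (by exact_mod_cast a)
  have c2 : Real.log N ≤ Real.log 8 + 2 * Real.log (u N) := by
    rw [← hl, ← Real.log_mul (by norm_num) (by positivity)]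
    exact Real.log_le_log (by positivity) (by exact_mod_cast b)
  have c3 : 0 ≤ Real.log 8 := Real.log_nonneg (by norm_num)
  rw [abs_le]
  constructor <;> linarith

section closePairs

variable {S : ℕ × ℕ → Prop}

lemma sum_Ioc_mul_pairCount (φ : ℕ → ℝ) (N : ℕ) :
    ∑ n ∈ Finset.Ioc 0 N, φ n * pairCount S n =
      open Classical in ∑ p ∈ Finset.Ioc 0 N, ∑ q ∈ Finset.Ioc 0 (N / p),
        if S (p, q) then φ (p * q) else 0 := by
  classical
  rw [← sum_Ioc_divisorsAntidiagonal (fun x => if S x then φ (x.1 * x.2) else 0)]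
  refine Finset.sum_congr rfl fun n _ => ?_
  rw [pairCount, Finset.card_filter, Nat.cast_sum, Finset.mul_sum]
  refine Finset.sum_congr (by rfl) fun x hx => ?_
  rw [(Nat.mem_divisorsAntidiagonal.1 hx).1]
  split_ifs <;> simp

/-- From `p < q` and `p q ≤ N` follows `p² < N`; and `q < 2 p` because `√3 < 2`. -/
lemma mem_of_isClose (hS : ∀ x, S x → IsClose x) {N p q : ℕ} (h : S (p, q))
    (hq : q ∈ Finset.Ioc 0 (N / p)) : p ∈ Finset.Ioc 0 (Nat.sqrt N) ∧ q ∈ Finset.Ioo p (2 * p) := by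
  have hc := hS _ h
  have h0 := hc.mul_ne_zero
  have hp : 0 < p := Nat.pos_of_ne_zero (left_ne_zero_of_mul h0)
  rw [Finset.mem_Ioc, Nat.le_div_iff_mul_le hp] at hq
  have h1 : p < q := hc.1
  refine ⟨Finset.mem_Ioc.2 ⟨hp, Nat.le_sqrt.2 ?_⟩, Finset.mem_Ioo.2 ⟨h1, hc.lt_two_mul⟩⟩
  nlinarith

lemma sum_Ioc_mul_pairCount_le (hS : ∀ x, S x → IsClose x) {φ : ℕ → ℝ} (hφ : ∀ n, 0 ≤ φ n)
    (N : ℕ) : ∑ n ∈ Finset.Ioc 0 N, φ n * pairCount S n ≤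
      open Classical in ∑ p ∈ Finset.Ioc 0 (Nat.sqrt N),
        ∑ q ∈ (Finset.Ioo p (2 * p)).filter fun q => S (p, q), φ (p * q) := by
  classical
  rw [sum_Ioc_mul_pairCount]
  have h1 : ∀ p, (∑ q ∈ Finset.Ioc 0 (N / p), if S (p, q) then φ (p * q) else 0) ≤
      if p ∈ Finset.Ioc 0 (Nat.sqrt N) then
        ∑ q ∈ (Finset.Ioo p (2 * p)).filter fun q => S (p, q), φ (p * q) else 0 := by
    intro p
    rw [← Finset.sum_filter]
    split_ifs with hp
    · refine Finset.sum_le_sum_of_subset_of_nonneg ?_ fun _ _ _ => hφ _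
      intro q hq
      rw [Finset.mem_filter] at hq ⊢
      exact ⟨(mem_of_isClose hS hq.2 hq.1).2, hq.2⟩
    · rw [Finset.filter_eq_empty_iff.2, Finset.sum_empty]
      exact fun q hq h => hp (mem_of_isClose hS h hq).1
  refine (Finset.sum_le_sum fun p _ => h1 p).trans ?_
  rw [← Finset.sum_filter]
  refine Finset.sum_le_sum_of_subset_of_nonneg ?_ fun _ _ _ => Finset.sum_nonneg fun _ _ => hφ _
  intro p hp
  exact (Finset.mem_filter.1 hp).2

/-- If `p ≤ √(N / 2)` and `q < 2 p`, then `p q ≤ 2 p² ≤ N`, so every such pair is counted. -/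
lemma le_sum_Ioc_mul_pairCount {φ : ℕ → ℝ} (hφ : ∀ n, 0 ≤ φ n) (N : ℕ) :
    (open Classical in ∑ p ∈ Finset.Ioc 0 (Nat.sqrt (N / 2)),
        ∑ q ∈ (Finset.Ioo p (2 * p)).filter fun q => S (p, q), φ (p * q)) ≤
      ∑ n ∈ Finset.Ioc 0 N, φ n * pairCount S n := by
  classical
  rw [sum_Ioc_mul_pairCount]
  have hsub : Finset.Ioc 0 (Nat.sqrt (N / 2)) ⊆ Finset.Ioc 0 N :=
    Finset.Ioc_subset_Ioc_right ((Nat.sqrt_le_self _).trans (Nat.div_le_self _ _))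
  have hnn : ∀ p, 0 ≤ ∑ q ∈ Finset.Ioc 0 (N / p), if S (p, q) then φ (p * q) else 0 :=
    fun p => Finset.sum_nonneg fun q _ => by
      split_ifs
      exacts [hφ _, le_rfl]
  refine le_trans (Finset.sum_le_sum fun p hp => ?_)
    (Finset.sum_le_sum_of_subset_of_nonneg hsub fun p _ _ => hnn p)
  rw [← Finset.sum_filter]
  refine Finset.sum_le_sum_of_subset_of_nonneg ?_ fun _ _ _ => hφ _
  intro q hq
  rw [Finset.mem_filter, Finset.mem_Ioo] at hq
  rw [Finset.mem_filter, Finset.mem_Ioc]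
  rw [Finset.mem_Ioc, Nat.le_sqrt, Nat.le_div_iff_mul_le two_pos] at hp
  refine ⟨⟨by omega, (Nat.le_div_iff_mul_le hp.1).2 ?_⟩, hq.2⟩
  nlinarith

lemma sum_filter_inv_mul (p : ℕ) :
    (open Classical in ∑ q ∈ (Finset.Ioo p (2 * p)).filter fun q => S (p, q),
      ((p * q : ℕ) : ℝ)⁻¹) = closeSum S p * (p : ℝ)⁻¹ := by
  rw [closeSum, Finset.sum_mul]
  refine Finset.sum_congr rfl fun q _ => ?_
  push_cast
  rw [mul_inv, mul_comm]

/-- There are at most `√N` choices of `p` and fewer than `p` of `q`. This crude bound suffices,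
being `o(N log N)`. -/
lemma partialSum_pairCount_le (hS : ∀ x, S x → IsClose x) (N : ℕ) :
    partialSum (fun n => pairCount S n) N ≤ N := by
  classical
  have h := sum_Ioc_mul_pairCount_le hS (φ := fun _ => 1) (fun _ => zero_le_one) N
  simp only [one_mul] at h
  refine h.trans ?_
  have h2 : ∀ p ∈ Finset.Ioc 0 (Nat.sqrt N),
      ∑ q ∈ (Finset.Ioo p (2 * p)).filter fun q => S (p, q), (1 : ℝ) ≤ Nat.sqrt N := by
    intro p hp
    rw [Finset.mem_Ioc] at hp
    rw [Finset.sum_const, nsmul_one]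
    have : ((Finset.Ioo p (2 * p)).filter fun q => S (p, q)).card ≤ Nat.sqrt N := by
      refine (Finset.card_filter_le _ _).trans ?_
      rw [Nat.card_Ioo]
      omega
    exact_mod_cast this
  refine (Finset.sum_le_sum h2).trans ?_
  rw [Finset.sum_const, Nat.card_Ioc, nsmul_eq_mul, Nat.sub_zero]
  exact_mod_cast Nat.sqrt_le N

lemma tendsto_partialSum_pairCount (hS : ∀ x, S x → IsClose x) :
    Tendsto (fun N : ℕ => partialSum (fun n => pairCount S n) N / (N * Real.log N)) atTop
      (𝓝 0) := by
  have hlog : Tendsto (fun N : ℕ => Real.log N) atTop atTop :=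
    Real.tendsto_log_atTop.comp tendsto_natCast_atTop_atTop
  refine squeeze_zero' (Eventually.of_forall fun N => ?_) ?_ (hlog.const_div_atTop 1)
  · refine div_nonneg (Finset.sum_nonneg fun _ _ => Nat.cast_nonneg _)
      (mul_nonneg N.cast_nonneg (Real.log_natCast_nonneg N))
  · filter_upwards [eventually_ge_atTop 2] with N hN
    have hN0 : (0 : ℝ) < N := by positivity
    have hL : 0 < Real.log N := Real.log_pos (by exact_mod_cast hN)
    rw [div_le_div_iff₀ (by positivity) hL, one_mul]
    gcongr
    exact partialSum_pairCount_le hS N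

/-- With the weight `1/p`, the errors are bounded by the convergent series of `1/p²`, negligible
against `log M`. -/
lemma tendsto_sum_closeSum {w : ℕ → ℝ} {L κ : ℝ}
    (hw : ∀ p, p ≠ 0 → |closeSum S p - w p * L| ≤ (p : ℝ)⁻¹)
    (hκ : Tendsto (fun N : ℕ => (∑ n ∈ Finset.Ioc 0 N, w n * (n : ℝ)⁻¹) / Real.log N) atTop (𝓝 κ)) :
    Tendsto (fun M : ℕ => (∑ p ∈ Finset.Ioc 0 M, closeSum S p * (p : ℝ)⁻¹) / Real.log M) atTop
      (𝓝 (L * κ)) := by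
  have hsum : Summable fun p : ℕ => ((p : ℝ) ^ 2)⁻¹ :=
    Real.summable_nat_pow_inv.2 one_lt_two
  have h1 : Tendsto (fun M : ℕ => (∑ p ∈ Finset.Ioc 0 M, closeSum S p * (p : ℝ)⁻¹ -
      L * ∑ n ∈ Finset.Ioc 0 M, w n * (n : ℝ)⁻¹) / Real.log M) atTop (𝓝 0) := by
    refine tendsto_div_log_of_abs_sub_le (C := ∑' p : ℕ, ((p : ℝ) ^ 2)⁻¹)
      (Eventually.of_forall fun M => ?_)
    rw [zero_mul, sub_zero, Finset.mul_sum, ← Finset.sum_sub_distrib]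
    refine (Finset.abs_sum_le_sum_abs _ _).trans
      (le_trans (Finset.sum_le_sum fun p hp => ?_) (hsum.sum_le_tsum _ fun p _ => by positivity))
    rw [Finset.mem_Ioc] at hp
    have e : closeSum S p * (p : ℝ)⁻¹ - L * (w p * (p : ℝ)⁻¹) =
        (closeSum S p - w p * L) * (p : ℝ)⁻¹ := by ring
    rw [e, abs_mul, abs_inv, Nat.abs_cast, sq, mul_inv]
    gcongr
    exact hw p (by omega)
  have h2 := h1.add (hκ.const_mul L)
  rw [zero_add] at h2
  refine h2.congr fun M => ?_
  rw [← mul_div_assoc, ← add_div, sub_add_cancel]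

/-- The sum lies between the sums of `closeSum S p / p` up to `√(N / 2)` and up to `√N`. Both grow
like `L κ log √N`, which is the source of the factor 1/2. -/
lemma tendsto_sum_pairCount_div (hS : ∀ x, S x → IsClose x) {w : ℕ → ℝ} {L κ : ℝ}
    (hw : ∀ p, p ≠ 0 → |closeSum S p - w p * L| ≤ (p : ℝ)⁻¹)
    (hκ : Tendsto (fun N : ℕ => (∑ n ∈ Finset.Ioc 0 N, w n * (n : ℝ)⁻¹) / Real.log N) atTop (𝓝 κ)) :
    Tendsto (fun N : ℕ => (∑ m ∈ Finset.Ioc 0 N, (pairCount S m : ℝ) / m) / Real.log N) atTop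
      (𝓝 (L * κ / 2)) := by
  have hT := tendsto_sum_closeSum hw hκ
  have lim : ∀ u : ℕ → ℕ, (∀ N, u N ^ 2 ≤ N) → (∀ᶠ N in atTop, N ≤ 8 * u N ^ 2) →
      Tendsto (fun N : ℕ => (∑ p ∈ Finset.Ioc 0 (u N), closeSum S p * (p : ℝ)⁻¹) / Real.log N)
        atTop (𝓝 (L * κ / 2)) := by
    intro u h1 h2
    have hu : Tendsto u atTop atTop := by
      refine tendsto_atTop.2 fun b => ?_
      filter_upwards [h2, eventually_ge_atTop (8 * b ^ 2)] with N hN hb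
      exact (Nat.pow_le_pow_iff_left two_ne_zero).1 (by omega)
    have h3 := (hT.comp hu).mul (tendsto_log_div_log_of_sq (Eventually.of_forall h1) h2)
    rw [mul_one_div] at h3
    refine h3.congr' ?_
    filter_upwards [hu.eventually_ge_atTop 2] with N hN
    have : 0 < Real.log (u N) := Real.log_pos (by exact_mod_cast hN)
    simp only [Function.comp]
    rw [div_mul_div_cancel₀ this.ne']
  have lim1 := lim (fun N => Nat.sqrt (N / 2))
    (fun N => (Nat.sqrt_le' _).trans (Nat.div_le_self _ _)) (by
      filter_upwards [eventually_ge_atTop 2] with N hN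
      have h1 := Nat.lt_succ_sqrt' (N / 2)
      have h2 : 1 ≤ Nat.sqrt (N / 2) := Nat.le_sqrt.2 (by omega)
      rw [Nat.succ_eq_add_one] at h1
      have h3 : N < 2 * (N / 2 + 1) := by omega
      nlinarith)
  have lim2 := lim Nat.sqrt Nat.sqrt_le' (by
      filter_upwards [eventually_ge_atTop 1] with N hN
      have h1 := Nat.lt_succ_sqrt' N
      have h2 : 1 ≤ Nat.sqrt N := Nat.le_sqrt.2 (by omega)
      rw [Nat.succ_eq_add_one] at h1
      nlinarith)
  have e : ∀ N : ℕ, ∑ m ∈ Finset.Ioc 0 N, (pairCount S m : ℝ) / m =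
      ∑ m ∈ Finset.Ioc 0 N, (m : ℝ)⁻¹ * pairCount S m :=
    fun N => Finset.sum_congr rfl fun m _ => by rw [div_eq_inv_mul]
  refine tendsto_of_tendsto_of_tendsto_of_le_of_le lim1 lim2 (fun N => ?_) (fun N => ?_)
  · dsimp only
    refine div_le_div_of_nonneg_right ?_ (Real.log_natCast_nonneg N)
    rw [e]
    refine le_of_eq_of_le ?_ (le_sum_Ioc_mul_pairCount (fun n => by positivity) N)
    exact Finset.sum_congr rfl fun p _ => (sum_filter_inv_mul p).symm
  · dsimp only
    refine div_le_div_of_nonneg_right ?_ (Real.log_natCast_nonneg N)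
    rw [e]
    refine (sum_Ioc_mul_pairCount_le hS (fun n => by positivity) N).trans_eq ?_
    exact Finset.sum_congr rfl fun p _ => sum_filter_inv_mul p

end closePairs

lemma log_sqrt_three : Real.log √3 = Real.log 3 / 2 := Real.log_sqrt (by norm_num)

lemma tendsto_sum_pairCount_isClose :
    Tendsto (fun N : ℕ => (∑ m ∈ Finset.Ioc 0 N, (pairCount IsClose m : ℝ) / m) / Real.log N)
      atTop (𝓝 (Real.log 3 / 4)) := by
  have h := tendsto_sum_pairCount_div (S := IsClose) (w := fun _ => 1) (L := Real.log √3) (κ := 1)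
    (fun _ h => h) (fun p hp => by rw [one_mul]; exact closeSum_isClose hp)
    (by simpa only [one_mul] using tendsto_sum_inv_div_log)
  rw [log_sqrt_three] at h
  convert! h using 2
  ring

lemma tendsto_sum_pairCount_isCloseOdd :
    Tendsto (fun N : ℕ => (∑ m ∈ Finset.Ioc 0 N, (pairCount IsCloseOdd m : ℝ) / m) / Real.log N)
      atTop (𝓝 (Real.log 3 / 16)) := by
  have h := tendsto_sum_pairCount_div (S := IsCloseOdd) (w := fun n => if Odd n then 1 else 0)
    (fun _ h => h.1) (fun p _ => closeSum_isCloseOdd p) tendsto_sum_odd_inv_div_log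
  rw [log_sqrt_three] at h
  convert! h using 2
  ring

/-! ### Asymptotics of the summatory function -/

/-- The number of rhombic well-rounded sublattices of index `2 n`, halved. -/
def halfRhombicEven : ℕ → ℝ := conv (fun n => pairCount IsClose n) fun n => sSqPr n

lemma rhombicEven_eq_onEvens {n : ℕ} (hn : n ≠ 0) :
    (rhombicEven n : ℝ) = 2 * onEvens halfRhombicEven n := by
  rw [rhombicEven, onEvens]
  split_ifs with h
  · obtain ⟨k, rfl⟩ := h
    rw [countSub_rhombic, ← two_mul, ncard_rhombicSet_even (by omega), halfRhombicEven, conv,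
      Nat.mul_div_cancel_left _ two_pos]
    push_cast
    simp only [pairCount_isClose]
  · simp

lemma sum_aSq_eq (N : ℕ) : ∑ n ∈ Finset.Ioc 0 N, (aSq n : ℝ) = sumSq N +
    2 * partialSum halfRhombicEven (N / 2) +
    2 * partialSum (conv (fun n => pairCount IsCloseOdd n) fun n => sSqPrOdd n) N := by
  rw [← partialSum_onEvens, sumSq, partialSum, partialSum, partialSum, Finset.mul_sum,
    Finset.mul_sum, ← Finset.sum_add_distrib, ← Finset.sum_add_distrib]
  refine Finset.sum_congr rfl fun n hn => ?_
  have hn0 : n ≠ 0 := by rw [Finset.mem_Ioc] at hn; omega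
  rw [aSq_eq hn0, Nat.cast_add, Nat.cast_add, rhombicEven_eq_onEvens hn0, rhombicOdd_eq, conv]
  push_cast
  rfl

lemma tendsto_log_half_div_log :
    Tendsto (fun N : ℕ => Real.log ((N / 2 : ℕ) : ℝ) / Real.log N) atTop (𝓝 1) := by
  refine tendsto_div_log_of_abs_sub_le (C := Real.log 3) ?_
  filter_upwards [eventually_ge_atTop 2] with N hN
  have h3 : Real.log ((N / 2 : ℕ) : ℝ) ≤ Real.log N :=
    Real.log_le_log (by have : N / 2 ≠ 0 := by omega
                        positivity) (by exact_mod_cast Nat.div_le_self N 2)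
  have h4 : Real.log N ≤ Real.log 3 + Real.log ((N / 2 : ℕ) : ℝ) := by
    have : N / 2 ≠ 0 := by omega
    rw [← Real.log_mul (by norm_num) (by positivity)]
    refine Real.log_le_log (by positivity) ?_
    have : N ≤ 3 * (N / 2) := by omega
    exact_mod_cast this
  have h5 : 0 ≤ Real.log 3 := Real.log_nonneg (by norm_num)
  rw [one_mul, abs_le]
  constructor <;> linarith

lemma tendsto_comp_half {F : ℕ → ℝ} {c : ℝ}
    (hF : Tendsto (fun N : ℕ => F N / (N * Real.log N)) atTop (𝓝 c)) :
    Tendsto (fun N : ℕ => F (N / 2) / (N * Real.log N)) atTop (𝓝 (c / 2)) := by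
  have h := ((hF.comp (Nat.tendsto_div_const_atTop two_ne_zero)).mul (tendsto_natDiv_div 2)).mul
    tendsto_log_half_div_log
  rw [mul_one, Nat.cast_ofNat, mul_one_div] at h
  refine h.congr' ?_
  filter_upwards [eventually_ge_atTop 4] with N hN
  have h1 : 1 < N / 2 := by omega
  have h2 : 0 < Real.log ((N / 2 : ℕ) : ℝ) := Real.log_pos (by exact_mod_cast h1)
  have h3 : (0 : ℝ) < ((N / 2 : ℕ) : ℝ) := by positivity
  simp only [Function.comp]
  field_simp

/-- The similar sublattices contribute only `O(N)`. Even indices contribute `3 log 3 / (8π)`,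
including the factor 1/2 from `N / 2`, and odd indices `log 3 / (8π)`. -/
theorem tendsto_sum_aSq :
    Tendsto (fun N : ℕ => (∑ n ∈ Finset.Ioc 0 N, (aSq n : ℝ)) / (N * Real.log N)) atTop
      (𝓝 (Real.log 3 / (2 * Real.pi))) := by
  have hlog : Tendsto (fun N : ℕ => Real.log N) atTop atTop :=
    Real.tendsto_log_atTop.comp tendsto_natCast_atTop_atTop
  have h1 : Tendsto (fun N : ℕ => sumSq N / (N * Real.log N)) atTop (𝓝 0) :=
    (tendsto_sumSq.div_atTop hlog).congr fun N => div_div _ _ _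
  have h2 := tendsto_comp_half (tendsto_partialSum_conv_div_mul_log (fun n => Nat.cast_nonneg _)
    tendsto_sumSqPr tendsto_sum_pairCount_isClose (tendsto_partialSum_pairCount fun _ h => h))
  have h3 := tendsto_partialSum_conv_div_mul_log (fun n => Nat.cast_nonneg _)
    tendsto_sumSqPrOdd tendsto_sum_pairCount_isCloseOdd
    (tendsto_partialSum_pairCount fun _ h => h.1)
  have h4 := (h1.add (h2.const_mul 2)).add (h3.const_mul 2)
  have e : 0 + 2 * (3 / (2 * Real.pi) * (Real.log 3 / 4) / 2) +
      2 * (1 / Real.pi * (Real.log 3 / 16)) = Real.log 3 / (2 * Real.pi) := by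
    have := Real.pi_pos
    field_simp
    ring
  rw [e] at h4
  refine h4.congr fun N => ?_
  rw [sum_aSq_eq, ← mul_div_assoc, ← mul_div_assoc, ← add_div, ← add_div]
  rfl

lemma tendsto_log_floor_div_log :
    Tendsto (fun x : ℝ => Real.log ⌊x⌋₊ / Real.log x) atTop (𝓝 1) := by
  have h0 : Tendsto (fun x : ℝ => Real.log ((⌊x⌋₊ : ℝ) / x)) atTop (𝓝 0) := by
    have := tendsto_nat_floor_div_atTop (R := ℝ)
    simpa using this.log one_ne_zero
  have h1 := (h0.div_atTop Real.tendsto_log_atTop).add_const 1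
  rw [zero_add] at h1
  refine h1.congr' ?_
  filter_upwards [eventually_gt_atTop 1] with x hx
  have hx0 : 0 < Real.log x := Real.log_pos hx
  have hf : (⌊x⌋₊ : ℝ) ≠ 0 := by
    have := Nat.floor_pos.2 hx.le
    positivity
  rw [Real.log_div hf (by linarith)]
  field_simp
  ring

/-- Passage from integers to real `x`: both `⌊x⌋₊ / x` and `log ⌊x⌋₊ / log x` tend to 1. -/
theorem aSq_asymptotic :
    (fun x : ℝ => ASq x - Real.log 3 / (2 * Real.pi) * (x * Real.log x))
      =o[atTop] fun x : ℝ => x * Real.log x := by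
  have hpos : ∀ᶠ x : ℝ in atTop, 0 < x * Real.log x := by
    filter_upwards [eventually_gt_atTop 1] with x hx
    exact mul_pos (by linarith) (Real.log_pos hx)
  rw [Asymptotics.isLittleO_iff_tendsto' (hpos.mono fun x hx h => absurd h hx.ne')]
  have h := ((tendsto_sum_aSq.comp (tendsto_nat_floor_atTop (α := ℝ))).mul
    (tendsto_nat_floor_div_atTop (R := ℝ))).mul tendsto_log_floor_div_log
  have h2 := h.sub_const (Real.log 3 / (2 * Real.pi))
  rw [mul_one, mul_one, sub_self] at h2
  refine h2.congr' ?_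
  filter_upwards [eventually_ge_atTop 2] with x hx
  have hf : 2 ≤ ⌊x⌋₊ := Nat.le_floor hx
  have hf1 : 0 < Real.log ⌊x⌋₊ := Real.log_pos (by exact_mod_cast hf)
  have hf2 : (0 : ℝ) < ⌊x⌋₊ := by positivity
  have hx1 : 0 < Real.log x := Real.log_pos (by linarith)
  have hx0 : 0 < x := by linarith
  have hA : ASq x = ∑ n ∈ Finset.Ioc 0 ⌊x⌋₊, (aSq n : ℝ) := rfl
  simp only [Function.comp]
  rw [hA]
  field_simp

end WellRounded

end

theorem theorem3 :
    (∀ s : ℂ, 1 < s.re →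
      -- the Dirichlet series of the well-rounded sublattices
      (DirichletSummable aSq s ∧ PhiWr s = PhiSq s + PhiEven s + PhiOdd s) ∧
      -- the Dirichlet series of the (primitive) similar sublattices
      (DirichletSummable sSq s ∧ DirichletSummable sSqPr s ∧
        PhiSq s = riemannZeta (2 * s) * PhiSqPr s ∧
        PhiSq s = NumberField.dedekindZeta (CyclotomicField 4 ℚ) s ∧
        PhiSq s = LChi s * riemannZeta s) ∧
      -- the explicit functions count the rhombic well-rounded sublattices
      (Summable (innerEven s) ∧ DirichletSummable rhombicEven s ∧
        dirichletSeries rhombicEven s = PhiEven s) ∧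
      (Summable (innerOdd s) ∧ DirichletSummable rhombicOdd s ∧
        dirichletSeries rhombicOdd s = PhiOdd s)) ∧
    -- the inequality; `z < w` in `ℂ` means that `w - z` is a positive real number
    (∀ s : ℝ, 1 < s →
      DSq s - PhiSq s < PhiWr s ∧ PhiWr s < DSq s + PhiSq s) ∧
    -- the asymptotic growth
    ((fun x : ℝ => ASq x - Real.log 3 / (2 * Real.pi) * (x * Real.log x))
      =o[Filter.atTop] fun x : ℝ => x * Real.log x) := by
  refine ⟨fun s hs => ⟨?_, ?_, ?_, ?_⟩, fun s hs => phiWr_bounds hs, aSq_asymptotic⟩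
  · exact ⟨(lSeriesHasSum_aSq hs).LSeriesSummable, phiWr_eq hs⟩
  · refine ⟨(lSeriesHasSum_sSq hs).LSeriesSummable, lSeriesSummable_sSqPr hs, phiSq_eq hs,
      phiSq_eq_dedekindZeta s, ?_⟩
    rw [mul_comm]
    exact (lSeriesHasSum_sSq hs).LSeries_eq
  · exact ⟨summable_innerEven hs, (lSeriesHasSum_rhombicEven hs).LSeriesSummable,
      (lSeriesHasSum_rhombicEven hs).LSeries_eq⟩
  · exact ⟨summable_innerOdd hs, (lSeriesHasSum_rhombicOdd hs).LSeriesSummable,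
      (lSeriesHasSum_rhombicOdd hs).LSeries_eq⟩
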